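/- Let $n\ge 1$ and let $M$ be the compact toric manifold of dimension $n$ determined by a complete fan of smooth cones in $\mathbb R^n$. The primitive edge generators $u_1,\dots,u_d\in\mathbb Z^n$ of the fan are regarded as outer normals of polytopes: if a maximal cone is generated by $u_{i_1},\dots,u_{i_n}$, its affine chart $\mathbb C^n$ has as coordinates the characters $z^{m_1},\dots,z^{m_n}$ of the open dense torus $(\mathbb C^*)^n$ with $\langle m_k,u_{i_l}\rangle=-\delta_{kl}$. Let $K^*$ be the anticanonical bundle of $M$, let $v\in\mathbb Z^n$, and let $$\Delta=\{x\in\mathbb R^n : \langle x-v,u_i\rangle\le 1,\ i=1,\dots,d\}$$ be the anticanonical polytope translated by $v$. Assume that the origin is a vertex of $\Delta$ and that the edges at this vertex are generated by $e_1,\dots,e_n$. Let $g$ be a Kähler metric on $M$, with Kähler form $\omega=\frac i2\sum g_{i\bar j}\,dz_i\wedge d\bar z_j$, that is invariant under the real torus $\mathbb T^n$ and projectively induced with polarization $K^*$ (so that $\omega\in c_1(K^*)$ in the normalization where the curvature form of a Hermitian metric $h$ is $-\frac i2\partial\bar\partial\log h$): there is a basis $t_0,\dots,t_N$ of $H^0(M,K^*)$,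 without common zeros, such that $\psi=[t_0:\dots:t_N]:M\to\mathbb CP^N$ satisfies $\psi^*\omega_{FS}=\omega$, where $\omega_{FS}=\frac i2\partial\bar\partial\log\sum_j|Z_j|^2$. Then there is a polynomial $F=\sum_I a_Ix^I$ with real coefficients in $x=(x_1,\dots,x_n)$ such that (a) $a_I\ge 0$ for all $I$, and the exponents $I$ with $a_I>0$ are exactly the points of $\Delta\cap\mathbb Z^n$; (b) $\omega=\frac i2\partial\bar\partial\log F(|z_1|^2,\dots,|z_n|^2)$ in the coordinates $z_1,\dots,z_n$ of the open dense torus $(\mathbb C^*)^n\subset M$. Moreover, for every polynomial $F$ with (a) and (b), $g$ is Kähler–Einstein (that is, $-i\,\partial\bar\partial\log\det(g_{i\bar j})=\lambda\,\omega$ on $M$ for some constant $\lambda\in\mathbb R$) if and only if there is a real constant $c>0$ such that, at $x_i=|z_i|^2$ and for all $z\in\mathbb C^n$, $$\det(A)=c\,F^{2n-1},\qquad A_{ij}=(FF_{ij}-F_iF_j)\,\bar z_iz_j+FF_j\,\delta_{ij},$$ where $F_i=\partial F/\partial x_i$ and $F_{ij}=\partial^2F/\partial x_i\partial x_j$. 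-/

import Mathlib

open scoped Manifold ContDiff ComplexOrder

noncomputable section

/-! ## Calculus on `ℂⁿ` -/

/-- The Wirtinger derivative `∂f/∂z_i = (∂f/∂x_i - √-1 ∂f/∂y_i)/2`. -/
def wirtinger {n : ℕ} (i : Fin n) (f : (Fin n → ℂ) → ℂ) (z : Fin n → ℂ) : ℂ :=
  (1 / 2) * (fderiv ℝ f z (Pi.single i 1) - Complex.I * fderiv ℝ f z (Pi.single i Complex.I))

/-- The conjugate Wirtinger derivative `∂f/∂z̄_i = (∂f/∂x_i + √-1 ∂f/∂y_i)/2`. -/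
def wirtingerBar {n : ℕ} (i : Fin n) (f : (Fin n → ℂ) → ℂ) (z : Fin n → ℂ) : ℂ :=
  (1 / 2) * (fderiv ℝ f z (Pi.single i 1) + Complex.I * fderiv ℝ f z (Pi.single i Complex.I))

/-- The matrix `(∂²f/∂z_i∂z̄_j)` of `∂∂̄f`, for a real-valued `f`. -/
def complexHessian {n : ℕ} (f : (Fin n → ℂ) → ℝ) (z : Fin n → ℂ) :
    Matrix (Fin n) (Fin n) ℂ :=
  Matrix.of fun i j => wirtinger i (fun w => wirtingerBar j (fun y => (f y : ℂ)) w) z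

/-- The complex Jacobian matrix, with entry `∂f_k/∂z_i` at `(k, i)`. -/
def complexJacobian {n : ℕ} (f : (Fin n → ℂ) → (Fin n → ℂ)) (z : Fin n → ℂ) :
    Matrix (Fin n) (Fin n) ℂ :=
  Matrix.of fun k i => fderiv ℂ f z (Pi.single i 1) k

/-- The matrix of the pull-back by `f`, at `z`, of the Hermitian form `∑ h_{kl} dw_k ⊗ dw̄_l`
at `f z`. -/
def pullbackMatrix {n : ℕ} (f : (Fin n → ℂ) → (Fin n → ℂ)) (z : Fin n → ℂ)
    (h : Matrix (Fin n) (Fin n) ℂ) : Matrix (Fin n) (Fin n) ℂ :=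
  (complexJacobian f z).transpose * h * (complexJacobian f z).map (starRingEnd ℂ)

/-! ## Complex manifolds: anticanonical sections and Kähler metrics, in charts -/

/-- `H⁰(M, K*)`: a holomorphic section of `K* = Λⁿ TM` is given in each chart `e` by
`s_e ∂_{z_1} ∧ ⋯ ∧ ∂_{z_n}`, with `s_e` holomorphic on the range of the chart (and extended by
zero), where on overlaps the coefficients differ by the Jacobian determinant. -/
def AnticanonicalSections (n : ℕ) (M : Type*) [TopologicalSpace M] [ChartedSpace (Fin n → ℂ) M] :
    Submodule ℂ (atlas (Fin n → ℂ) M → (Fin n → ℂ) → ℂ) where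
  carrier := {s | (∀ e, DifferentiableOn ℂ (s e) e.1.target) ∧
    (∀ e, ∀ z ∉ e.1.target, s e z = 0) ∧
    ∀ e e', ∀ z ∈ (e.1.symm.trans e'.1).source,
      s e' (e.1.symm.trans e'.1 z) =
        (complexJacobian (e.1.symm.trans e'.1) z).det * s e z}
  add_mem' := by
    rintro a b ⟨ha, ha', ha''⟩ ⟨hb, hb', hb''⟩
    refine ⟨fun e => (ha e).add (hb e), fun e z hz => ?_, fun e e' z hz => ?_⟩
    · simp [ha' e z hz, hb' e z hz]
    · simp only [Pi.add_apply, ha'' e e' z hz, hb'' e e' z hz]; ring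
  zero_mem' := by
    refine ⟨fun e => ?_, fun e z hz => rfl, fun e e' z hz => ?_⟩
    · exact differentiableOn_const (0 : ℂ)
    · simp
  smul_mem' := by
    rintro c a ⟨ha, ha', ha''⟩
    refine ⟨fun e => (ha e).const_smul c, fun e z hz => ?_, fun e e' z hz => ?_⟩
    · simp [ha' e z hz]
    · simp only [Pi.smul_apply, ha'' e e' z hz, smul_eq_mul]; ring

/-- A Kähler metric on the complex manifold `M`, in charts: in the chart `e` the Kähler form is
`ω = (i/2) ∑ g_{ij} dz_i ∧ dz̄_j` with `g = coeff e`. -/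
structure KahlerMetric (n : ℕ) (M : Type*) [TopologicalSpace M]
    [ChartedSpace (Fin n → ℂ) M] where
  coeff : atlas (Fin n → ℂ) M → (Fin n → ℂ) → Matrix (Fin n) (Fin n) ℂ
  smooth : ∀ e i j, ContDiffOn ℝ ∞ (fun z => coeff e z i j) e.1.target
  posDef : ∀ e, ∀ z ∈ e.1.target, (coeff e z).PosDef
  compat : ∀ e e', ∀ z ∈ (e.1.symm.trans e'.1).source,
    coeff e z = pullbackMatrix (e.1.symm.trans e'.1) z (coeff e' (e.1.symm.trans e'.1 z))
  /-- `dω = 0` -/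
  closed : ∀ e, ∀ z ∈ e.1.target, ∀ i j k,
    wirtinger k (fun w => coeff e w i j) z = wirtinger i (fun w => coeff e w k j) z

namespace KahlerMetric

variable {n : ℕ} {M : Type*} [TopologicalSpace M] [ChartedSpace (Fin n → ℂ) M]

/-- The matrix at `z` of the pull-back of the metric by a map `f` from (an open subset of) `ℂⁿ`
to `M`, computed in a chart `e` of `M` around `f z`. -/
def pullback (g : KahlerMetric n M) (f : (Fin n → ℂ) → M) (e : atlas (Fin n → ℂ) M)
    (z : Fin n → ℂ) : Matrix (Fin n) (Fin n) ℂ :=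
  pullbackMatrix (fun w => e.1 (f w)) z (g.coeff e (e.1 (f z)))

/-- The metric is invariant under `f : M → M`, that is `f^* g = g`. -/
def IsInvariant (g : KahlerMetric n M) (f : M → M) : Prop :=
  ∀ e e' : atlas (Fin n → ℂ) M, ∀ z ∈ e.1.target, f (e.1.symm z) ∈ e'.1.source →
    g.pullback (fun w => f (e.1.symm w)) e' z = g.coeff e z

/-- The coefficient matrix of the Ricci form: `ρ = -i ∂∂̄ log det g` is
`i ∑ ricci_{ij} dz_i ∧ dz̄_j`. -/
def ricci (g : KahlerMetric n M) (e : atlas (Fin n → ℂ) M) (z : Fin n → ℂ) :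
    Matrix (Fin n) (Fin n) ℂ :=
  -complexHessian (fun w => Real.log (g.coeff e w).det.re) z

/-- Kähler–Einstein: `ρ = lam ω` for a real constant `lam`; since `ω = (i/2) ∑ g_{ij} dz_i ∧ dz̄_j`,
the coefficients of `ρ` are compared with `lam / 2` times those of `g`. -/
def IsEinstein (g : KahlerMetric n M) : Prop :=
  ∃ lam : ℝ, ∀ e : atlas (Fin n → ℂ) M, ∀ z ∈ e.1.target,
    g.ricci e z = ((lam / 2 : ℝ) : ℂ) • g.coeff e z

/-- The potential of the Fubini–Study form in homogeneous coordinates,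
`ω_FS = (i/2) ∂∂̄ log ∑ |Z_j|²`. -/
def fubiniStudyPotential {N : ℕ} (Z : Fin (N + 1) → ℂ) : ℝ :=
  Real.log (∑ j, ‖Z j‖ ^ 2)

/-- The metric is projectively induced, with polarization `K*`: there is a basis `t_0, …, t_N` of
`H⁰(M, K*)`, without common zeros, such that `ψ = [t_0 : ⋯ : t_N] : M → ℂP^N` satisfies
`ψ^* ω_FS = ω`. In a chart `e` the coefficients of the `t_j` are a holomorphic lift of `ψ` to
`ℂ^(N+1) ∖ {0}`. -/
def IsProjectivelyInduced (g : KahlerMetric n M) : Prop :=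
  ∃ (N : ℕ) (t : Module.Basis (Fin (N + 1)) ℂ (AnticanonicalSections n M)),
    ∀ e : atlas (Fin n → ℂ) M, ∀ z ∈ e.1.target,
      (∃ j, (t j).1 e z ≠ 0) ∧
      g.coeff e z = complexHessian (fun w => fubiniStudyPotential fun j => (t j).1 e w) z

end KahlerMetric

/-! ## Fans and toric manifolds -/

/-- The real convex cone generated by a set of integral vectors. -/
def realCone {n : ℕ} (S : Set (Fin n → ℤ)) : PointedCone ℝ (Fin n → ℝ) :=
  PointedCone.hull ℝ ((fun u i => (u i : ℝ)) '' S)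

/-- A complete fan of smooth (unimodular) cones in `ℝⁿ`, given by its maximal cones. The rows of
`gen k` are the primitive generators of the edges of the `k`-th maximal cone. -/
structure SmoothCompleteFan (n : ℕ) where
  numCones : ℕ
  gen : Fin numCones → Matrix (Fin n) (Fin n) ℤ
  smooth : ∀ k, IsUnit (gen k).det
  inter : ∀ k l, realCone (Set.range (gen k)) ⊓ realCone (Set.range (gen l)) =
    realCone (Set.range (gen k) ∩ Set.range (gen l))
  complete : ∀ x : Fin n → ℝ, ∃ k, x ∈ realCone (Set.range (gen k))

/-- The monomial map `z ↦ (z^{B_1}, …, z^{B_n})`, where `B_1, …, B_n` are the rows of `B`. -/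
def monomialMap {n : ℕ} (B : Matrix (Fin n) (Fin n) ℤ) (z : Fin n → ℂ) : Fin n → ℂ :=
  fun j => ∏ i, z i ^ B j i

theorem zpow_sum_eq_prod {ι : Type*} {a : ℂ} (ha : a ≠ 0) (s : Finset ι) (f : ι → ℤ) :
    a ^ (∑ j ∈ s, f j) = ∏ j ∈ s, a ^ f j := by
  classical
  induction s using Finset.induction_on with
  | empty => simp
  | insert j s hj ih => rw [Finset.sum_insert hj, Finset.prod_insert hj, zpow_add₀ ha, ih]

theorem monomialMap_comp {n : ℕ} (B C : Matrix (Fin n) (Fin n) ℤ) {z : Fin n → ℂ}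
    (hz : ∀ i, z i ≠ 0) : monomialMap B (monomialMap C z) = monomialMap (B * C) z := by
  funext q
  simp only [monomialMap]
  simp_rw [← Finset.prod_zpow]
  rw [Finset.prod_comm]
  refine Finset.prod_congr rfl fun i _ => ?_
  rw [Matrix.mul_apply, zpow_sum_eq_prod (hz i)]
  exact Finset.prod_congr rfl fun j _ => by rw [← zpow_mul, mul_comm]

theorem monomialMap_mul {n : ℕ} (B : Matrix (Fin n) (Fin n) ℤ) (z w : Fin n → ℂ) :
    monomialMap B (z * w) = monomialMap B z * monomialMap B w := by
  funext q
  simp only [monomialMap, Pi.mul_apply, mul_zpow, Finset.prod_mul_distrib]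

theorem monomialMap_ne_zero {n : ℕ} (B : Matrix (Fin n) (Fin n) ℤ) {z : Fin n → ℂ}
    (hz : ∀ i, z i ≠ 0) (j : Fin n) : monomialMap B z j ≠ 0 :=
  Finset.prod_ne_zero_iff.2 fun i _ => zpow_ne_zero _ (hz i)

namespace SmoothCompleteFan

variable {n : ℕ} (S : SmoothCompleteFan n)

/-- The rows `m_1, …, m_n` of this matrix are the exponents of the coordinate characters
`z^{m_1}, …, z^{m_n}` of the affine chart `ℂⁿ` of the `k`-th maximal cone. The generators
`u_1, …, u_n` of the cone are outer normals of polytopes, so `⟨m_j, u_i⟩ = -δ_{ij}`. -/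
def chartExponents (k : Fin S.numCones) : Matrix (Fin n) (Fin n) ℤ :=
  -((S.gen k)⁻¹).transpose

/-- The exponents of the coordinates of the chart `l` as monomials in those of the chart `k`. -/
def glueExponents (k l : Fin S.numCones) : Matrix (Fin n) (Fin n) ℤ :=
  (S.gen k * (S.gen l)⁻¹).transpose

/-- The part of the chart `k` that is glued to the chart `l`, namely the affine toric variety of
the common face: coordinates vanish only along edges that both cones have. -/
def glueDomain (k l : Fin S.numCones) : Set (Fin n → ℂ) :=
  {z | ∀ i, z i = 0 → ∃ j, S.gen l j = S.gen k i}

/-- The change of coordinates from the chart `k` to the chart `l`. -/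
def glueMap (k l : Fin S.numCones) : (Fin n → ℂ) → (Fin n → ℂ) :=
  monomialMap (S.glueExponents k l)

theorem glueExponents_mul_chartExponents (k l : Fin S.numCones) :
    S.glueExponents k l * S.chartExponents k = S.chartExponents l := by
  unfold glueExponents chartExponents
  rw [Matrix.mul_neg, ← Matrix.transpose_mul, ← Matrix.mul_assoc,
    Matrix.nonsing_inv_mul _ (S.smooth k), Matrix.one_mul]

theorem glueExponents_mul (k l p : Fin S.numCones) :
    S.glueExponents l p * S.glueExponents k l = S.glueExponents k p := by
  unfold glueExponents
  rw [← Matrix.transpose_mul, Matrix.mul_assoc, ← Matrix.mul_assoc (S.gen l)⁻¹,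
    Matrix.nonsing_inv_mul _ (S.smooth l), Matrix.one_mul]

theorem glueExponents_self (k : Fin S.numCones) : S.glueExponents k k = 1 := by
  unfold glueExponents
  rw [Matrix.mul_nonsing_inv _ (S.smooth k), Matrix.transpose_one]

theorem glueExponents_common {k l : Fin S.numCones} {i j : Fin n}
    (h : S.gen l j = S.gen k i) (j' : Fin n) :
    S.glueExponents k l j' i = if j' = j then 1 else 0 := by
  have h1 : (S.gen k * (S.gen l)⁻¹) i j' = (S.gen l * (S.gen l)⁻¹) j j' := by
    simp only [Matrix.mul_apply, h]
  rw [glueExponents, Matrix.transpose_apply, h1, Matrix.mul_nonsing_inv _ (S.smooth l),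
    Matrix.one_apply]
  simp [eq_comm]

theorem glueMap_eq_zero {k l : Fin S.numCones} {z : Fin n → ℂ} (hz : z ∈ S.glueDomain k l)
    {j : Fin n} (hj : S.glueMap k l z j = 0) : ∃ i, z i = 0 ∧ S.gen l j = S.gen k i := by
  obtain ⟨i, -, hi⟩ : ∃ i ∈ Finset.univ, z i ^ S.glueExponents k l j i = 0 :=
    Finset.prod_eq_zero_iff.1 hj
  have hzi : z i = 0 := by
    by_contra h
    exact zpow_ne_zero _ h hi
  obtain ⟨j', hj'⟩ := hz i hzi
  refine ⟨i, hzi, ?_⟩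
  by_cases hjj : j = j'
  · rw [hjj, hj']
  · rw [S.glueExponents_common hj' j, if_neg hjj] at hi
    simp at hi

theorem glueMap_glueMap {k l p : Fin S.numCones} {z : Fin n → ℂ}
    (hz : z ∈ S.glueDomain k l) :
    S.glueMap l p (S.glueMap k l z) = S.glueMap k p z := by
  funext q
  simp only [glueMap, monomialMap]
  simp_rw [← Finset.prod_zpow]
  rw [Finset.prod_comm]
  refine Finset.prod_congr rfl fun i _ => ?_
  rw [← S.glueExponents_mul k l p, Matrix.mul_apply]
  by_cases h : z i = 0
  · obtain ⟨j, hj⟩ := hz i h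
    simp only [S.glueExponents_common hj]
    rw [Finset.prod_eq_single j]
    · simp
    · intro b _ hb
      simp [hb]
    · simp
  · simp_rw [← zpow_mul]
    rw [zpow_sum_eq_prod h]
    exact Finset.prod_congr rfl fun j _ => by rw [mul_comm]

theorem glueMap_mem {k l p : Fin S.numCones} {z : Fin n → ℂ}
    (hz : z ∈ S.glueDomain k l) (hp : z ∈ S.glueDomain k p) :
    S.glueMap k l z ∈ S.glueDomain l p := by
  intro j hj
  obtain ⟨i, hi, hij⟩ := S.glueMap_eq_zero hz hj
  obtain ⟨q, hq⟩ := hp i hi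
  exact ⟨q, hq.trans hij.symm⟩

theorem glueDomain_trans {k l p : Fin S.numCones} {z : Fin n → ℂ}
    (hz : z ∈ S.glueDomain k l) (hw : S.glueMap k l z ∈ S.glueDomain l p) :
    z ∈ S.glueDomain k p := by
  intro i hi
  obtain ⟨j, hj⟩ := hz i hi
  have h0 : S.glueMap k l z j = 0 := by
    refine Finset.prod_eq_zero (Finset.mem_univ i) ?_
    rw [S.glueExponents_common hj, hi]
    simp
  obtain ⟨q, hq⟩ := hw j h0
  exact ⟨q, hq.trans hj⟩

theorem mem_glueDomain_self (k : Fin S.numCones) (z : Fin n → ℂ) : z ∈ S.glueDomain k k :=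
  fun i _ => ⟨i, rfl⟩

theorem glueMap_self (k : Fin S.numCones) (z : Fin n → ℂ) : S.glueMap k k z = z := by
  funext j
  simp only [glueMap, monomialMap, glueExponents_self]
  rw [Finset.prod_eq_single j]
  · simp
  · intro i _ hi
    simp [Ne.symm hi]
  · simp

/-- Two points of the disjoint union of the charts are identified when the change of coordinates
takes one to the other. -/
def glueSetoid : Setoid (Fin S.numCones × (Fin n → ℂ)) where
  r a b := a.2 ∈ S.glueDomain a.1 b.1 ∧ S.glueMap a.1 b.1 a.2 = b.2
  iseqv := by
    refine ⟨fun a => ⟨S.mem_glueDomain_self _ _, S.glueMap_self _ _⟩, ?_, ?_⟩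
    · rintro ⟨k, z⟩ ⟨l, w⟩ ⟨h, hw⟩
      dsimp only at h hw ⊢
      subst hw
      have h' := S.glueMap_mem h (S.mem_glueDomain_self k z)
      exact ⟨h', (S.glueMap_glueMap h).trans (S.glueMap_self k z)⟩
    · rintro ⟨k, z⟩ ⟨l, w⟩ ⟨p, v⟩ ⟨h, hw⟩ ⟨h', hv⟩
      dsimp only at h hw h' hv ⊢
      subst hw hv
      exact ⟨S.glueDomain_trans h h', (S.glueMap_glueMap h).symm⟩

/-- The toric manifold of the fan: the affine charts `ℂⁿ` of the maximal cones, glued along the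
affine toric varieties of the common faces by the monomial changes of coordinates. -/
def ToricManifold : Type := Quotient S.glueSetoid

instance : TopologicalSpace S.ToricManifold :=
  inferInstanceAs (TopologicalSpace (Quotient S.glueSetoid))

/-- The inclusion of the affine chart of the `k`-th maximal cone. -/
def affineChart (k : Fin S.numCones) (z : Fin n → ℂ) : S.ToricManifold :=
  Quotient.mk S.glueSetoid (k, z)

theorem affineChart_eq_iff {k l : Fin S.numCones} {z w : Fin n → ℂ} :
    S.affineChart k z = S.affineChart l w ↔ z ∈ S.glueDomain k l ∧ S.glueMap k l z = w :=
  ⟨fun h => Quotient.exact h, fun h => Quotient.sound h⟩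

theorem exists_affineChart (x : S.ToricManifold) : ∃ k z, S.affineChart k z = x := by
  obtain ⟨⟨k, z⟩, h⟩ := Quotient.exists_rep x
  exact ⟨k, z, h⟩

theorem isOpen_glueDomain (k l : Fin S.numCones) : IsOpen (S.glueDomain k l) := by
  have : S.glueDomain k l =
      ⋂ i, {z | z i = 0 → ∃ j, S.gen l j = S.gen k i} := by
    ext z; simp [glueDomain]
  rw [this]
  refine isOpen_iInter_of_finite fun i => ?_
  by_cases h : ∃ j, S.gen l j = S.gen k i
  · simp [h]
  · simp only [h, imp_false]
    exact isOpen_ne_fun (continuous_apply i) continuous_const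

theorem contDiffOn_glueMap (k l : Fin S.numCones) :
    ContDiffOn ℂ ω (S.glueMap k l) (S.glueDomain k l) := by
  rw [contDiffOn_pi]
  intro j
  change ContDiffOn ℂ ω (fun z : Fin n → ℂ => ∏ i, z i ^ S.glueExponents k l j i) _
  refine contDiffOn_prod fun i _ => ?_
  intro z hz
  have hpr : AnalyticAt ℂ (fun z : Fin n → ℂ => z i) z :=
    (ContinuousLinearMap.proj (R := ℂ) (φ := fun _ : Fin n => ℂ) i).analyticAt z
  refine ContDiffAt.contDiffWithinAt (AnalyticAt.contDiffAt ?_)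
  by_cases h : z i = 0
  · obtain ⟨j', hj'⟩ := hz i h
    refine hpr.fun_zpow_nonneg ?_
    rw [S.glueExponents_common hj']
    split_ifs <;> simp
  · exact hpr.fun_zpow h

theorem continuous_affineChart (k : Fin S.numCones) : Continuous (S.affineChart k) :=
  continuous_quotient_mk'.comp (Continuous.prodMk_right k)

theorem isOpenEmbedding_affineChart (k : Fin S.numCones) :
    Topology.IsOpenEmbedding (S.affineChart k) := by
  refine Topology.IsOpenEmbedding.of_continuous_injective_isOpenMap
    (S.continuous_affineChart k) ?_ ?_
  · intro z w h
    rw [affineChart_eq_iff] at h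
    rw [← h.2, S.glueMap_self]
  · intro U hU
    have key : ∀ l, IsOpen (S.affineChart l ⁻¹' (S.affineChart k '' U)) := by
      intro l
      have : S.affineChart l ⁻¹' (S.affineChart k '' U) =
          S.glueDomain l k ∩ S.glueMap l k ⁻¹' U := by
        ext w
        constructor
        · rintro ⟨z, hz, h⟩
          obtain ⟨h1, h2⟩ := S.affineChart_eq_iff.1 h.symm
          exact ⟨h1, by rwa [Set.mem_preimage, h2]⟩
        · rintro ⟨h1, h2⟩
          exact ⟨_, h2, (S.affineChart_eq_iff.2 ⟨h1, rfl⟩).symm⟩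
      rw [this]
      exact (S.contDiffOn_glueMap l k).continuousOn.isOpen_inter_preimage
        (S.isOpen_glueDomain l k) hU
    refine (isQuotientMap_quotient_mk' (s := S.glueSetoid)).isOpen_preimage.1 ?_
    rw [isOpen_iff_mem_nhds]
    rintro ⟨l, w⟩ hw
    rw [nhds_prod_eq, nhds_discrete, Filter.pure_prod]
    exact Filter.mem_map.2 ((key l).mem_nhds hw)

/-- The coordinates of the `k`-th affine chart. -/
def coordChart (k : Fin S.numCones) : OpenPartialHomeomorph S.ToricManifold (Fin n → ℂ) :=
  ((S.isOpenEmbedding_affineChart k).toOpenPartialHomeomorph (S.affineChart k)).symm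

theorem coordChart_source (k : Fin S.numCones) :
    (S.coordChart k).source = Set.range (S.affineChart k) := by
  simp [coordChart]

theorem coordChart_target (k : Fin S.numCones) : (S.coordChart k).target = Set.univ := by
  simp [coordChart]

theorem coordChart_symm (k : Fin S.numCones) : ⇑(S.coordChart k).symm = S.affineChart k := by
  simp [coordChart]

theorem coordChart_affineChart (k : Fin S.numCones) (z : Fin n → ℂ) :
    S.coordChart k (S.affineChart k z) = z :=
  (S.isOpenEmbedding_affineChart k).toOpenPartialHomeomorph_left_inv

instance : ChartedSpace (Fin n → ℂ) S.ToricManifold where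
  atlas := Set.range S.coordChart
  chartAt x := S.coordChart (S.exists_affineChart x).choose
  mem_chart_source x := by
    rw [coordChart_source]
    exact (S.exists_affineChart x).choose_spec
  chart_mem_atlas x := ⟨_, rfl⟩

/-- The toric manifold is a complex manifold of dimension `n`. -/
instance : IsManifold 𝓘(ℂ, Fin n → ℂ) ω S.ToricManifold := by
  refine isManifold_of_contDiffOn _ _ _ ?_
  rintro _ _ ⟨k, rfl⟩ ⟨l, rfl⟩
  have hsub : ((S.coordChart k).symm.trans (S.coordChart l)).source ⊆ S.glueDomain k l := by
    intro z hz
    rw [OpenPartialHomeomorph.trans_source, Set.mem_inter_iff, Set.mem_preimage,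
      coordChart_source, coordChart_symm] at hz
    obtain ⟨w, hw⟩ := hz.2
    exact (S.affineChart_eq_iff.1 hw.symm).1
  simp only [modelWithCornersSelf_coe, modelWithCornersSelf_coe_symm, Set.range_id,
    Set.inter_univ, Function.comp_id, Function.id_comp, Set.preimage_id]
  refine ((S.contDiffOn_glueMap k l).mono hsub).congr fun z hz => ?_
  have h := S.affineChart_eq_iff.2 ⟨hsub hz, rfl⟩
  rw [OpenPartialHomeomorph.coe_trans, Function.comp_apply, coordChart_symm, h,
    coordChart_affineChart]

/-- The action of the complex torus `(ℂ^*)ⁿ`: in the chart of each maximal cone the `j`-th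
coordinate, being the character `z^{m_j}`, is multiplied by `t^{m_j}`. -/
def torusAction (t : Fin n → ℂˣ) : S.ToricManifold → S.ToricManifold :=
  Quotient.map (sa := S.glueSetoid) (sb := S.glueSetoid)
    (fun a => (a.1, monomialMap (S.chartExponents a.1) (fun i => (t i : ℂ)) * a.2)) (by
      rintro ⟨k, z⟩ ⟨l, w⟩ ⟨h, hw⟩
      dsimp only at h hw ⊢
      subst hw
      have ht : ∀ i, ((t i : ℂˣ) : ℂ) ≠ 0 := fun i => (t i).ne_zero
      refine ⟨fun i hi => h i ?_, ?_⟩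
      · exact (mul_eq_zero.1 hi).resolve_left (monomialMap_ne_zero _ ht i)
      · simp only [glueMap]
        rw [monomialMap_mul, monomialMap_comp _ _ ht, glueExponents_mul_chartExponents])

theorem exists_cone : Nonempty (Fin S.numCones) := ⟨(S.complete 0).choose⟩

/-- The embedding `(ℂ^*)ⁿ → M` of the open dense torus. (Only its values at points with non-zero
coordinates matter. In the chart of any maximal cone it is given by the characters `z^{m_j}`, so
the choice of the cone is immaterial, as the next theorem shows.) -/
def torusEmbedding (z : Fin n → ℂ) : S.ToricManifold :=
  S.affineChart S.exists_cone.some (monomialMap (S.chartExponents S.exists_cone.some) z)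

theorem torusEmbedding_eq (k : Fin S.numCones) {z : Fin n → ℂ} (hz : ∀ i, z i ≠ 0) :
    S.torusEmbedding z = S.affineChart k (monomialMap (S.chartExponents k) z) := by
  refine S.affineChart_eq_iff.2
    ⟨fun i hi => absurd hi (monomialMap_ne_zero _ hz i), ?_⟩
  rw [glueMap, monomialMap_comp _ _ hz, glueExponents_mul_chartExponents]

/-- The anticanonical polytope `{x | ⟨x, u⟩ ≤ 1 for all edge generators u of the fan}`, translated
by the integral vector `v`. -/
def anticanonicalPolytope (v : Fin n → ℤ) : Set (Fin n → ℝ) :=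
  {x | ∀ k i, ∑ j, (x j - v j) * (S.gen k i j : ℝ) ≤ 1}

end SmoothCompleteFan

/-- The origin is a vertex of the polytope, and the edges at this vertex are generated by
`e_1, …, e_n`: the cone that `P` spans at the origin is the cone generated by `e_1, …, e_n`. -/
def IsNormalizedAtOrigin {n : ℕ} (P : Set (Fin n → ℝ)) : Prop :=
  0 ∈ P.extremePoints ℝ ∧
    PointedCone.hull ℝ P = PointedCone.hull ℝ (Set.range fun i => (Pi.single i 1 : Fin n → ℝ))

/-! ## The polynomial `F` -/

/-- The value of the polynomial `F` at `x = (|z_1|², …, |z_n|²)`. -/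
def evalAbsSq {n : ℕ} (F : MvPolynomial (Fin n) ℝ) (z : Fin n → ℂ) : ℝ :=
  MvPolynomial.eval (fun i => ‖z i‖ ^ 2) F

/-- The coefficients of `F` are non-negative, and the exponents of its monomials with positive
coefficient are exactly the lattice points of `P`. -/
def HasPositiveSupport {n : ℕ} (F : MvPolynomial (Fin n) ℝ) (P : Set (Fin n → ℝ)) : Prop :=
  (∀ I, 0 ≤ F.coeff I) ∧
    (fun (I : Fin n →₀ ℕ) (i : Fin n) => (I i : ℤ)) '' {I | 0 < F.coeff I} =
      {J : Fin n → ℤ | (fun i => (J i : ℝ)) ∈ P}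

/-- `ω = (i/2) ∂∂̄ log F` on the open dense torus, in the coordinates `z_1, …, z_n`. -/
def IsLogPotential {n : ℕ} {S : SmoothCompleteFan n} (g : KahlerMetric n S.ToricManifold)
    (F : MvPolynomial (Fin n) ℝ) : Prop :=
  ∀ z : Fin n → ℂ, (∀ i, z i ≠ 0) → ∀ e : atlas (Fin n → ℂ) S.ToricManifold,
    S.torusEmbedding z ∈ e.1.source →
      g.pullback S.torusEmbedding e z = complexHessian (fun w => Real.log (evalAbsSq F w)) z

/-- The matrix `A_{ij} = (F F_{ij} - F_i F_j) z̄_i z_j + F F_j δ_{ij}`. -/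
def einsteinMatrix {n : ℕ} (F : MvPolynomial (Fin n) ℝ) (z : Fin n → ℂ) :
    Matrix (Fin n) (Fin n) ℂ :=
  Matrix.of fun i j =>
    (evalAbsSq (F * MvPolynomial.pderiv i (MvPolynomial.pderiv j F)
        - MvPolynomial.pderiv i F * MvPolynomial.pderiv j F) z : ℂ)
      * (starRingEnd ℂ (z i) * z j)
    + if i = j then (evalAbsSq (F * MvPolynomial.pderiv j F) z : ℂ) else 0

end

/-! On the torus, the frame `z_1∂_1 ∧ ⋯ ∧ z_n∂_n` trivializes `K*`, and a section becomes a function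
whose Laurent expansion only involves characters `z^m` with `⟨m, u⟩ ≤ 1` for all generators `u`.
Only finite-dimensionality of `H⁰(M, K*)` is needed for this: a torus element doubling one
coordinate of a chart acts on the sections, the `d`-th Taylor coefficient in that coordinate is an
eigenfunctional with eigenvalue `2^d/2`, and by Cayley–Hamilton only finitely many `d` can occur. So
sections are polynomials in every chart (`exists_mvPolynomial_section`), and comparing the charts
gives `exists_laurent`.

The tool used repeatedly is Liouville's theorem: a bounded pluriharmonic function on `ℂⁿ` is
constant. Let `φ = ∑ |t_j|²`. If `θ` is in the real torus, then `log φ∘θ - log φ` is pluriharmonic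
because the metric is invariant, and bounded because `θ` acts linearly on the sections; it vanishes
at the origin of a chart, so `φ` is invariant. Averaging is not needed: invariance kills the mixed
terms `z^m z̄^m'`, leaving `φ = ∑ a_m |z^m|²` with `a_m > 0` for every weight, since the `t_j` span.
The normalization at the origin forces `v = (1, …, 1)`, so `F = ∏ |z_i|² · φ` has exponents `m + v`,
the lattice points of the polytope. The extra factor has pluriharmonic logarithm. Any other
admissible `F` has the same support, so the quotient of the two is bounded above and below, and
Liouville makes it a constant.

For the Einstein equation, let `V = det g · φ`. The Jacobian factors cancel, so `V` is a function on
`M`, and `∂∂̄ log V` has matrix `g - ricci`. If `g` is Einstein this is `(1 - lam/2) g`; evaluating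
at a maximum and at a minimum of `log V` gives `lam = 2`, and Liouville makes `V` constant in each
chart. Conversely, constant `V` gives `ricci = g`. Finally `∂∂̄ log F` has matrix `A / F²`, so on
the torus `det A = κ V F^(2n-1)`, where `κ > 0` is the proportionality constant
(`det_einsteinMatrix_eq`). The determinant equation therefore says exactly that `V` is constant. -/

/-! ## The Levi form -/

section LeviForm

set_option linter.unusedSectionVars false

variable {E E' : Type*} [NormedAddCommGroup E] [NormedSpace ℂ E]
  [NormedAddCommGroup E'] [NormedSpace ℂ E']

/-- The Levi form of a real function: `4 ∑ a_i b̄_j ∂²f/∂z_i∂z̄_j` in coordinates. -/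
noncomputable def leviForm [NormedSpace ℝ E] (f : E → ℝ) (z a b : E) : ℂ :=
  (fderiv ℝ (fderiv ℝ f) z a b : ℂ) +
      (fderiv ℝ (fderiv ℝ f) z (Complex.I • a) (Complex.I • b) : ℂ) +
    Complex.I * ((fderiv ℝ (fderiv ℝ f) z a (Complex.I • b) : ℂ) -
      (fderiv ℝ (fderiv ℝ f) z (Complex.I • a) b : ℂ))

variable [NormedSpace ℝ E] [IsScalarTower ℝ ℂ E] [NormedSpace ℝ E'] [IsScalarTower ℝ ℂ E']

theorem leviForm_add_left (f : E → ℝ) (z a a' b : E) :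
    leviForm f z (a + a') b = leviForm f z a b + leviForm f z a' b := by
  simp only [leviForm, smul_add, map_add, add_apply]
  push_cast; ring

theorem leviForm_add_right (f : E → ℝ) (z a b b' : E) :
    leviForm f z a (b + b') = leviForm f z a b + leviForm f z a b' := by
  simp only [leviForm, smul_add, map_add]
  push_cast; ring

theorem complex_smul_eq_add (c : ℂ) (a : E) : c • a = c.re • a + c.im • (Complex.I • a) := by
  conv_lhs => rw [← Complex.re_add_im c]
  rw [add_smul, mul_smul, ← Complex.coe_algebraMap, algebraMap_smul, algebraMap_smul]

theorem I_smul_I_smul (a : E) : Complex.I • Complex.I • a = -a := by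
  rw [smul_smul, Complex.I_mul_I, neg_one_smul]

/-- The combination `B(a,b) + B(ia,ib) + i(B(a,ib) - B(ia,b))` is complex linear in `a` and
conjugate linear in `b` for every real bilinear `B`; symmetry of the second derivative plays no
role. -/
theorem leviForm_smul_left (f : E → ℝ) (z a b : E) (c : ℂ) :
    leviForm f z (c • a) b = c * leviForm f z a b := by
  have hI : Complex.I • c • a = c.re • (Complex.I • a) - c.im • a := by
    rw [smul_comm, complex_smul_eq_add c, I_smul_I_smul, smul_neg, sub_eq_add_neg]
  simp only [leviForm, hI]
  rw [complex_smul_eq_add c a]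
  simp only [map_add, map_sub, map_smul, add_apply,
    sub_apply, smul_apply, smul_eq_mul]
  push_cast
  conv_rhs => rw [← Complex.re_add_im c]
  linear_combination (-(c.im : ℂ) * (fderiv ℝ (fderiv ℝ f) z a (Complex.I • b) -
    fderiv ℝ (fderiv ℝ f) z (Complex.I • a) b)) * Complex.I_sq

theorem leviForm_smul_right (f : E → ℝ) (z a b : E) (c : ℂ) :
    leviForm f z a (c • b) = (starRingEnd ℂ) c * leviForm f z a b := by
  have hI : Complex.I • c • b = c.re • (Complex.I • b) - c.im • b := by
    rw [smul_comm, complex_smul_eq_add c, I_smul_I_smul, smul_neg, sub_eq_add_neg]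
  simp only [leviForm, hI]
  rw [complex_smul_eq_add c b]
  simp only [map_add, map_sub, map_smul, smul_eq_mul]
  push_cast
  have hc : (starRingEnd ℂ) c = c.re - c.im * Complex.I := by
    apply Complex.ext <;> simp
  rw [hc]
  linear_combination ((c.im : ℂ) * (fderiv ℝ (fderiv ℝ f) z a (Complex.I • b) -
    fderiv ℝ (fderiv ℝ f) z (Complex.I • a) b)) * Complex.I_sq

theorem fderiv_fderiv_add {f g : E → ℝ} {z : E} (hf : ContDiffAt ℝ 2 f z)
    (hg : ContDiffAt ℝ 2 g z) : fderiv ℝ (fderiv ℝ fun w => f w + g w) z =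
      fderiv ℝ (fderiv ℝ f) z + fderiv ℝ (fderiv ℝ g) z := by
  have h : (fderiv ℝ fun w => f w + g w) =ᶠ[nhds z] fun w => fderiv ℝ f w + fderiv ℝ g w := by
    filter_upwards [hf.eventually (by simp), hg.eventually (by simp)] with w h1 h2
    exact fderiv_fun_add (h1.differentiableAt (by simp)) (h2.differentiableAt (by simp))
  rw [h.fderiv_eq, fderiv_fun_add]
  · exact (hf.fderiv_right (m := 1) le_rfl).differentiableAt (by simp)
  · exact (hg.fderiv_right (m := 1) le_rfl).differentiableAt (by simp)

theorem leviForm_add {f g : E → ℝ} {z : E} (hf : ContDiffAt ℝ 2 f z)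
    (hg : ContDiffAt ℝ 2 g z) (a b : E) :
    leviForm (fun w => f w + g w) z a b = leviForm f z a b + leviForm g z a b := by
  simp only [leviForm, fderiv_fderiv_add hf hg, add_apply]
  push_cast; ring

theorem leviForm_const_mul (f : E → ℝ) (c : ℝ) (z a b : E) :
    leviForm (fun w => c * f w) z a b = c * leviForm f z a b := by
  have h : fderiv ℝ (fderiv ℝ fun w => c * f w) z = c • fderiv ℝ (fderiv ℝ f) z := by
    have h1 : (fderiv ℝ fun w => c * f w) = fun w => c • fderiv ℝ f w := by
      funext w
      exact congrFun (fderiv_const_smul_field (𝕜 := ℝ) (f := f) c) w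
    rw [h1]
    exact congrFun (fderiv_const_smul_field (𝕜 := ℝ) (f := fderiv ℝ f) c) z
  simp only [leviForm, h, smul_apply, smul_eq_mul]
  push_cast; ring

/-- The real Hessian of the composite has an additional term `df(D²φ(a, b))`. As `D²φ` is complex
bilinear, `D²φ(ia, ib) = -D²φ(a, b)` and `D²φ(a, ib) = D²φ(ia, b)`, so this term drops out of the
Levi form. -/
theorem leviForm_comp {f : E' → ℝ} {φ : E → E'} {z : E} (hφ : ContDiffAt ℂ 2 φ z)
    (hf : ContDiffAt ℝ 2 f (φ z)) (a b : E) :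
    leviForm (fun w => f (φ w)) z a b =
      leviForm f (φ z) (fderiv ℂ φ z a) (fderiv ℂ φ z b) := by
  have h : (fderiv ℝ fun w => f (φ w)) =ᶠ[nhds z]
      fun w => (fderiv ℝ f (φ w)).comp ((fderiv ℂ φ w).restrictScalars ℝ) := by
    filter_upwards [hφ.eventually (by simp),
      hφ.continuousAt.eventually (hf.eventually (by simp))] with w h1 h2
    have h3 : HasFDerivAt φ ((fderiv ℂ φ w).restrictScalars ℝ) w :=
      (h1.differentiableAt (by simp)).hasFDerivAt.restrictScalars ℝ
    exact ((h2.differentiableAt (by simp)).hasFDerivAt.comp w h3).fderiv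
  have hφ1 : HasFDerivAt φ ((fderiv ℂ φ z).restrictScalars ℝ) z :=
    (hφ.differentiableAt (by simp)).hasFDerivAt.restrictScalars ℝ
  have hφ2 : HasFDerivAt (fderiv ℂ φ) (fderiv ℂ (fderiv ℂ φ) z) z :=
    ((hφ.fderiv_right (m := 1) le_rfl).differentiableAt (by simp)).hasFDerivAt
  have hφ3 : HasFDerivAt (fun w => (fderiv ℂ φ w).restrictScalars ℝ)
      ((ContinuousLinearMap.restrictScalarsL ℂ E E' ℝ ℝ).comp
        ((fderiv ℂ (fderiv ℂ φ) z).restrictScalars ℝ)) z :=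
    (ContinuousLinearMap.restrictScalarsL ℂ E E' ℝ ℝ).hasFDerivAt.comp z
      (hφ2.restrictScalars ℝ)
  have hf2 : HasFDerivAt (fun w => fderiv ℝ f (φ w))
      ((fderiv ℝ (fderiv ℝ f) (φ z)).comp ((fderiv ℂ φ z).restrictScalars ℝ)) z :=
    ((hf.fderiv_right (m := 1) le_rfl).differentiableAt (by simp)).hasFDerivAt.comp z hφ1
  have key : ∀ a b : E, fderiv ℝ (fderiv ℝ fun w => f (φ w)) z a b =
      fderiv ℝ (fderiv ℝ f) (φ z) (fderiv ℂ φ z a) (fderiv ℂ φ z b) +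
        fderiv ℝ f (φ z) (fderiv ℂ (fderiv ℂ φ) z a b) := by
    intro a b
    rw [h.fderiv_eq, (hf2.clm_comp hφ3).fderiv]
    simp [add_comm]
  simp only [leviForm, key, map_smul, smul_apply, I_smul_I_smul, map_neg]
  push_cast; ring

/-- At a global maximum the trace of the Hessian over a complex line is not positive. -/
theorem fderiv_fderiv_nonpos_of_isMax {f : E → ℝ} {z : E} (hf : ContDiff ℝ 2 f)
    (hz : ∀ w, f w ≤ f z) (a : E) : fderiv ℝ (fderiv ℝ f) z a a ≤ 0 := by
  have hd : Differentiable ℝ (fderiv ℝ f) := (hf.fderiv_right (m := 1) le_rfl).differentiable (by simp)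
  have hl : ∀ t : ℝ, HasDerivAt (fun t : ℝ => z + t • a) a t := fun t => by
    simpa using ((hasDerivAt_id t).smul_const a).const_add z
  have h1 : ∀ t : ℝ, HasDerivAt (fun t : ℝ => f (z + t • a)) (fderiv ℝ f (z + t • a) a) t :=
    fun t => ((hf.differentiable (by simp)) _).hasFDerivAt.comp_hasDerivAt t (hl t)
  have h2 : HasDerivAt (fun t : ℝ => fderiv ℝ f (z + t • a) a)
      (fderiv ℝ (fderiv ℝ f) z a a) 0 := by
    have := (hd (z + (0 : ℝ) • a)).hasFDerivAt.comp_hasDerivAt 0 (hl 0)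
    have := this.clm_apply (hasDerivAt_const (0 : ℝ) a)
    simpa using this
  -- If the second derivative were positive, the second derivative test would make the maximum a
  -- local minimum too. The function would be locally constant on the line and its second derivative
  -- zero.
  by_contra hcon
  push Not at hcon
  have hder : deriv (fun t : ℝ => f (z + t • a)) = fun t => fderiv ℝ f (z + t • a) a :=
    funext fun t => (h1 t).deriv
  have hmax : IsLocalMax (fun t : ℝ => f (z + t • a)) 0 :=
    Filter.Eventually.of_forall fun t => by simpa using hz (z + t • a)
  have hmin : IsLocalMin (fun t : ℝ => f (z + t • a)) 0 := by
    refine isLocalMin_of_deriv_deriv_pos ?_ hmax.deriv_eq_zero (h1 0).continuousAt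
    rw [hder, h2.deriv]; exact hcon
  have hconst : (fun t : ℝ => f (z + t • a)) =ᶠ[nhds 0] fun _ => f z := by
    filter_upwards [hmax, hmin] with t h3 h4
    simpa using le_antisymm h3 h4
  have h0 : (fun t : ℝ => fderiv ℝ f (z + t • a) a) =ᶠ[nhds 0] fun _ => 0 := by
    rw [← hder]
    simpa using! hconst.deriv
  have := h2.deriv
  rw [h0.deriv_eq] at this
  simp at this
  exact hcon.ne this

/-- On the diagonal, the real part is the sum of the second derivatives in the directions `a` and
`ia`. -/
theorem leviForm_self_re_nonpos_of_isMax {f : E → ℝ} {z : E} (hf : ContDiff ℝ 2 f)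
    (hz : ∀ w, f w ≤ f z) (a : E) : (leviForm f z a a).re ≤ 0 := by
  have h1 := fderiv_fderiv_nonpos_of_isMax hf hz a
  have h2 := fderiv_fderiv_nonpos_of_isMax hf hz (Complex.I • a)
  have : (leviForm f z a a).re = fderiv ℝ (fderiv ℝ f) z a a +
      fderiv ℝ (fderiv ℝ f) z (Complex.I • a) (Complex.I • a) := by
    simp [leviForm]
  linarith

end LeviForm

/-! ## The complex Hessian -/

section ComplexHessian

variable {n : ℕ}

theorem single_I (i : Fin n) :
    (Pi.single i Complex.I : Fin n → ℂ) = Complex.I • Pi.single i 1 := by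
  rw [← Pi.single_smul]; simp

theorem fderiv_ofReal_comp {f : (Fin n → ℂ) → ℝ} {z : Fin n → ℂ} (hf : DifferentiableAt ℝ f z)
    (a : Fin n → ℂ) : fderiv ℝ (fun y => (f y : ℂ)) z a = (fderiv ℝ f z a : ℂ) := by
  have := (Complex.ofRealCLM.hasFDerivAt (x := f z)).comp z hf.hasFDerivAt
  exact congrArg (fun L => L a) this.fderiv

/-- Passing to the coordinate-free Levi form makes the chain rule available; `1/4` is the product of
the factors `1/2` of the two Wirtinger derivatives. -/
theorem complexHessian_apply {f : (Fin n → ℂ) → ℝ} {z : Fin n → ℂ} (hf : ContDiffAt ℝ 2 f z)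
    (i j : Fin n) : complexHessian f z i j =
      (1 / 4) * leviForm f z (Pi.single i 1) (Pi.single j 1) := by
  have h : (fun w => wirtingerBar j (fun y => (f y : ℂ)) w) =ᶠ[nhds z] fun w =>
      (1 / 2) * ((fderiv ℝ f w (Pi.single j 1) : ℂ) +
        Complex.I * (fderiv ℝ f w (Complex.I • Pi.single j 1) : ℂ)) := by
    filter_upwards [hf.eventually (by simp)] with w hw
    have hd := hw.differentiableAt (by simp)
    rw [wirtingerBar, fderiv_ofReal_comp hd, fderiv_ofReal_comp hd, single_I]
  have hd2 : HasFDerivAt (fderiv ℝ f) (fderiv ℝ (fderiv ℝ f) z) z :=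
    ((hf.fderiv_right (m := 1) le_rfl).differentiableAt (by simp)).hasFDerivAt
  have hd3 : ∀ b : Fin n → ℂ, HasFDerivAt (fun w => (fderiv ℝ f w b : ℂ))
      (Complex.ofRealCLM.comp ((fderiv ℝ (fderiv ℝ f) z).flip b)) z := by
    intro b
    have := hd2.clm_apply (hasFDerivAt_const b z)
    have := (Complex.ofRealCLM.hasFDerivAt (x := fderiv ℝ f z b)).comp z this
    simpa using! this
  have hd4 := ((hd3 (Pi.single j 1)).add ((hd3 (Complex.I • Pi.single j 1)).const_mul
    Complex.I)).const_mul ((1 : ℂ) / 2)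
  have hw : ∀ a : Fin n → ℂ,
      fderiv ℝ (fun w => wirtingerBar j (fun y => (f y : ℂ)) w) z a =
      (1 / 2) * ((fderiv ℝ (fderiv ℝ f) z a (Pi.single j 1) : ℂ) +
        Complex.I * (fderiv ℝ (fderiv ℝ f) z a (Complex.I • Pi.single j 1) : ℂ)) := by
    intro a
    rw [h.fderiv_eq]
    refine (congrArg (fun L => L a) hd4.fderiv).trans ?_
    simp [mul_add]
  rw [complexHessian, Matrix.of_apply, wirtinger, hw, hw, leviForm, single_I]
  linear_combination (-(fderiv ℝ (fderiv ℝ f) z (Complex.I • Pi.single i 1)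
    (Complex.I • Pi.single j 1) : ℂ) / 4) * Complex.I_sq

theorem leviForm_eq_sum {f : (Fin n → ℂ) → ℝ} {z : Fin n → ℂ} (hf : ContDiffAt ℝ 2 f z)
    (a b : Fin n → ℂ) : leviForm f z a b =
      4 * ∑ i, ∑ j, a i * (starRingEnd ℂ) (b j) * complexHessian f z i j := by
  have hs : ∀ a : Fin n → ℂ, a = ∑ i, a i • (Pi.single i 1 : Fin n → ℂ) := fun a => by
    conv_lhs => rw [pi_eq_sum_univ' a]
  have hl : ∀ b (s : Finset (Fin n)), leviForm f z (∑ i ∈ s, a i • (Pi.single i 1 : Fin n → ℂ)) b =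
      ∑ i ∈ s, a i * leviForm f z (Pi.single i 1) b := by
    intro b s
    induction s using Finset.induction_on with
    | empty => simp [leviForm]
    | insert i s hi ih =>
      rw [Finset.sum_insert hi, Finset.sum_insert hi, leviForm_add_left, ih, leviForm_smul_left]
  have hr : ∀ c (s : Finset (Fin n)), leviForm f z c (∑ i ∈ s, b i • (Pi.single i 1 : Fin n → ℂ)) =
      ∑ i ∈ s, (starRingEnd ℂ) (b i) * leviForm f z c (Pi.single i 1) := by
    intro c s
    induction s using Finset.induction_on with
    | empty => simp [leviForm]
    | insert i s hi ih =>
      rw [Finset.sum_insert hi, Finset.sum_insert hi, leviForm_add_right, ih, leviForm_smul_right]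
  conv_lhs => rw [hs a, hs b, hl]
  simp only [hr, complexHessian_apply hf, Finset.mul_sum]
  refine Finset.sum_congr rfl fun i _ => Finset.sum_congr rfl fun j _ => ?_
  ring

theorem complexHessian_congr {f g : (Fin n → ℂ) → ℝ} {z : Fin n → ℂ} (h : f =ᶠ[nhds z] g) :
    complexHessian f z = complexHessian g z := by
  ext i j
  simp only [complexHessian, Matrix.of_apply, wirtinger, wirtingerBar]
  have h1 : (fun y => (f y : ℂ)) =ᶠ[nhds z] fun y => (g y : ℂ) := h.mono fun y hy => by simp [hy]
  have h2 := h1.fderiv (𝕜 := ℝ)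
  have h3 : (fun w => 1 / 2 * (fderiv ℝ (fun y => (f y : ℂ)) w (Pi.single j 1) +
      Complex.I * fderiv ℝ (fun y => (f y : ℂ)) w (Pi.single j Complex.I))) =ᶠ[nhds z]
      (fun w => 1 / 2 * (fderiv ℝ (fun y => (g y : ℂ)) w (Pi.single j 1) +
      Complex.I * fderiv ℝ (fun y => (g y : ℂ)) w (Pi.single j Complex.I))) := by
    filter_upwards [h2] with w hw
    rw [hw]
  rw [h3.fderiv_eq]

theorem complexHessian_add {f g : (Fin n → ℂ) → ℝ} {z : Fin n → ℂ} (hf : ContDiffAt ℝ 2 f z)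
    (hg : ContDiffAt ℝ 2 g z) :
    complexHessian (fun w => f w + g w) z = complexHessian f z + complexHessian g z := by
  ext i j
  rw [complexHessian_apply (hf.add hg), leviForm_add hf hg, Matrix.add_apply,
    complexHessian_apply hf, complexHessian_apply hg]
  ring

theorem complexHessian_const_mul {f : (Fin n → ℂ) → ℝ} {z : Fin n → ℂ} (c : ℝ)
    (hf : ContDiffAt ℝ 2 f z) :
    complexHessian (fun w => c * f w) z = (c : ℂ) • complexHessian f z := by
  ext i j
  rw [complexHessian_apply (contDiffAt_const.mul hf), leviForm_const_mul, Matrix.smul_apply,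
    complexHessian_apply hf, smul_eq_mul]
  ring

theorem complexHessian_sub {f g : (Fin n → ℂ) → ℝ} {z : Fin n → ℂ} (hf : ContDiffAt ℝ 2 f z)
    (hg : ContDiffAt ℝ 2 g z) :
    complexHessian (fun w => f w - g w) z = complexHessian f z - complexHessian g z := by
  have h := complexHessian_add hf (contDiffAt_const.mul hg : ContDiffAt ℝ 2 (fun w => (-1) * g w) z)
  rw [complexHessian_const_mul _ hg] at h
  simpa [sub_eq_add_neg] using h

theorem complexHessian_sum {ι : Type*} (s : Finset ι) {f : ι → (Fin n → ℂ) → ℝ} {z : Fin n → ℂ}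
    (hf : ∀ i ∈ s, ContDiffAt ℝ 2 (f i) z) :
    complexHessian (fun w => ∑ i ∈ s, f i w) z = ∑ i ∈ s, complexHessian (f i) z := by
  classical
  induction s using Finset.induction_on with
  | empty =>
    ext i j
    simp [complexHessian, wirtinger, wirtingerBar]
  | insert a s ha ih =>
    simp only [Finset.sum_insert ha]
    rw [complexHessian_add (hf a (by simp))
      (ContDiffAt.sum fun i hi => hf i (by simp [hi])), ih fun i hi => hf i (by simp [hi])]

theorem continuous_complexHessian {f : (Fin n → ℂ) → ℝ} (hf : ContDiff ℝ 2 f) :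
    Continuous (complexHessian f) := by
  refine continuous_matrix fun i j => ?_
  have hc : Continuous (fderiv ℝ (fderiv ℝ f)) :=
    (hf.fderiv_right (m := 1) le_rfl).continuous_fderiv (by simp)
  have : (fun z => complexHessian f z i j) = fun z =>
      (1 / 4) * leviForm f z (Pi.single i 1) (Pi.single j 1) :=
    funext fun z => complexHessian_apply hf.contDiffAt i j
  rw [this]
  unfold leviForm
  fun_prop

/-- The complex Hessian is natural under holomorphic maps. -/
theorem complexHessian_comp {f : (Fin n → ℂ) → ℝ} {φ : (Fin n → ℂ) → Fin n → ℂ} {z : Fin n → ℂ}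
    (hφ : ContDiffAt ℂ 2 φ z) (hf : ContDiffAt ℝ 2 f (φ z)) :
    complexHessian (fun w => f (φ w)) z = pullbackMatrix φ z (complexHessian f (φ z)) := by
  ext i j
  have hc : ContDiffAt ℝ 2 (fun w => f (φ w)) z := hf.comp z (hφ.restrict_scalars ℝ)
  rw [complexHessian_apply hc, leviForm_comp hφ hf, leviForm_eq_sum hf, pullbackMatrix]
  simp only [Matrix.mul_apply, Matrix.transpose_apply, Matrix.map_apply, complexJacobian,
    Matrix.of_apply, Finset.sum_mul, Finset.mul_sum]
  rw [Finset.sum_comm]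
  refine Finset.sum_congr rfl fun k _ => Finset.sum_congr rfl fun l _ => ?_
  ring

theorem det_pullbackMatrix (f : (Fin n → ℂ) → Fin n → ℂ) (z : Fin n → ℂ)
    (h : Matrix (Fin n) (Fin n) ℂ) :
    (pullbackMatrix f z h).det = (‖(complexJacobian f z).det‖ ^ 2 : ℝ) * h.det := by
  rw [pullbackMatrix, Matrix.det_mul, Matrix.det_mul, Matrix.det_transpose]
  have : ((complexJacobian f z).map (starRingEnd ℂ)).det =
      (starRingEnd ℂ) (complexJacobian f z).det := (RingHom.map_det _ _).symm
  rw [this]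
  push_cast
  rw [← Complex.mul_conj']
  ring

/-- Liouville: a bounded pluriharmonic function on `ℂⁿ` is constant. -/
theorem eq_of_bounded_of_complexHessian_eq_zero {p : (Fin n → ℂ) → ℝ} (hp : ContDiff ℝ 2 p)
    (h0 : ∀ z, complexHessian p z = 0) {C : ℝ} (hC : ∀ z, |p z| ≤ C) (z : Fin n → ℂ) :
    p z = p 0 := by
  -- Restriction to the complex line through `0` and `z`: there the Levi form at `(1, 1)` is the
  -- Laplacian, and Liouville's theorem for harmonic functions on the plane applies.
  set φ : ℂ → Fin n → ℂ := fun ζ => ζ • z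
  have hφ : ContDiff ℂ 2 φ := contDiff_id.smul contDiff_const
  have hu : ContDiff ℝ 2 fun ζ => p (φ ζ) := hp.comp (hφ.restrict_scalars ℝ)
  have hlevi : ∀ ζ, leviForm (fun ζ => p (φ ζ)) ζ 1 1 = 0 := by
    intro ζ
    rw [leviForm_comp hφ.contDiffAt hp.contDiffAt, leviForm_eq_sum hp.contDiffAt]
    simp [h0]
  have hharm : InnerProductSpace.HarmonicOnNhd (fun ζ => p (φ ζ)) Set.univ := by
    intro ζ _
    refine ⟨hu.contDiffAt, Filter.Eventually.of_forall fun ζ => ?_⟩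
    have := congrArg Complex.re (hlevi ζ)
    rw [InnerProductSpace.laplacian_eq_iteratedFDeriv_complexPlane]
    simpa [leviForm, iteratedFDeriv_two_apply] using this
  have hb : Bornology.IsBounded (Set.range fun ζ => p (φ ζ)) := by
    refine (Metric.isBounded_closedBall (x := (0 : ℝ)) (r := C)).subset ?_
    rintro _ ⟨ζ, rfl⟩
    simpa using hC _
  obtain h := InnerProductSpace.bounded_harmonic_on_complex_plane_is_constant _ hharm hb 1 0
  simpa [φ] using h

end ComplexHessian

/-! ## Polynomials in `|z_1|², …, |z_n|²` -/

section EvalAbsSq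

variable {n : ℕ}

theorem wirtinger_mul {f g : (Fin n → ℂ) → ℂ} {z : Fin n → ℂ} (hf : DifferentiableAt ℝ f z)
    (hg : DifferentiableAt ℝ g z) (i : Fin n) :
    wirtinger i (fun w => f w * g w) z = wirtinger i f z * g z + f z * wirtinger i g z := by
  simp only [wirtinger, fderiv_fun_mul hf hg, add_apply, smul_apply, smul_eq_mul]
  ring

theorem wirtinger_inv {f : (Fin n → ℂ) → ℂ} {z : Fin n → ℂ} (hf : DifferentiableAt ℝ f z)
    (h0 : f z ≠ 0) (i : Fin n) :
    wirtinger i (fun w => (f w)⁻¹) z = -wirtinger i f z / f z ^ 2 := by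
  have h : HasFDerivAt (fun w => (f w)⁻¹) (-(f z ^ 2)⁻¹ • fderiv ℝ f z) z :=
    (hasDerivAt_inv h0).comp_hasFDerivAt z hf.hasFDerivAt
  simp only [wirtinger, h.fderiv, smul_apply, smul_eq_mul]
  ring

theorem wirtinger_coord (i j : Fin n) (z : Fin n → ℂ) :
    wirtinger i (fun w => w j) z = if i = j then 1 else 0 := by
  have h : HasFDerivAt (fun w : Fin n → ℂ => w j)
      (ContinuousLinearMap.proj (R := ℝ) (φ := fun _ : Fin n => ℂ) j) z :=
    (ContinuousLinearMap.proj (R := ℝ) (φ := fun _ : Fin n => ℂ) j).hasFDerivAt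
  simp only [wirtinger, h.fderiv, ContinuousLinearMap.proj_apply, Pi.single_apply]
  split_ifs with h1 h2 h2
  · rw [Complex.I_mul_I]; norm_num
  · exact absurd h1.symm h2
  · exact absurd h2.symm h1
  · simp

theorem hasFDerivAt_evalAbsSq (F : MvPolynomial (Fin n) ℝ) (z : Fin n → ℂ) :
    HasFDerivAt (evalAbsSq F) (∑ i, (2 * evalAbsSq (MvPolynomial.pderiv i F) z) •
      (innerSL ℝ (z i)).comp (ContinuousLinearMap.proj (R := ℝ) (φ := fun _ : Fin n => ℂ) i)) z := by
  induction F using MvPolynomial.induction_on with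
  | C a =>
    refine (hasFDerivAt_const a z).congr_fderiv ?_ |>.congr_of_eventuallyEq
      (Filter.Eventually.of_forall fun w => by simp [evalAbsSq])
    simp [evalAbsSq]
  | add p q hp hq =>
    refine (hp.add hq).congr_fderiv ?_ |>.congr_of_eventuallyEq
      (Filter.Eventually.of_forall fun w => by simp [evalAbsSq])
    rw [← Finset.sum_add_distrib]
    refine Finset.sum_congr rfl fun i _ => ?_
    rw [← add_smul]
    simp [evalAbsSq, mul_add]
  | mul_X p i hp =>
    have h1 : HasFDerivAt (fun w : Fin n → ℂ => w i)
        (ContinuousLinearMap.proj (R := ℝ) (φ := fun _ : Fin n => ℂ) i) z :=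
      (ContinuousLinearMap.proj (R := ℝ) (φ := fun _ : Fin n => ℂ) i).hasFDerivAt
    refine (hp.mul h1.norm_sq).congr_fderiv ?_ |>.congr_of_eventuallyEq
      (Filter.Eventually.of_forall fun w => by simp [evalAbsSq])
    ext a
    simp only [evalAbsSq, Derivation.leibniz, smul_eq_mul, map_add, map_mul, MvPolynomial.eval_X,
      MvPolynomial.pderiv_X, sum_apply, add_apply, smul_apply,
      ContinuousLinearMap.comp_apply]
    have : ∀ j, (MvPolynomial.eval fun k => ‖z k‖ ^ 2)
        (Pi.single (M := fun _ => MvPolynomial (Fin n) ℝ) j 1 i) = if j = i then 1 else 0 := by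
      intro j
      by_cases h : j = i
      · subst h; simp
      · simp [h, Ne.symm h]
    simp only [this, mul_add, add_mul, Finset.sum_add_distrib, mul_ite, mul_one, mul_zero,
      ite_mul, zero_mul, Finset.sum_ite_eq', Finset.mem_univ, if_true, Finset.mul_sum]
    congr 1
    · simp; ring
    · refine Finset.sum_congr rfl fun j _ => ?_
      ring

theorem fderiv_evalAbsSq (F : MvPolynomial (Fin n) ℝ) (z : Fin n → ℂ) (j : Fin n) (c : ℂ) :
    fderiv ℝ (evalAbsSq F) z (Pi.single j c) =
      2 * evalAbsSq (MvPolynomial.pderiv j F) z * ((starRingEnd ℂ) (z j) * c).re := by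
  rw [(hasFDerivAt_evalAbsSq F z).fderiv]
  simp only [sum_apply, smul_apply,
    ContinuousLinearMap.comp_apply, ContinuousLinearMap.proj_apply, innerSL_apply_apply, smul_eq_mul]
  rw [Finset.sum_eq_single j]
  · simp [Complex.inner, mul_comm]
  · intro b _ hb
    simp [hb]
  · simp

theorem contDiff_evalAbsSq (F : MvPolynomial (Fin n) ℝ) {k : WithTop ℕ∞} :
    ContDiff ℝ k (evalAbsSq F) := by
  induction F using MvPolynomial.induction_on with
  | C a =>
    have : evalAbsSq (MvPolynomial.C a) = fun _ : Fin n → ℂ => a := by funext; simp [evalAbsSq]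
    exact this ▸ contDiff_const
  | add p q hp hq =>
    have : evalAbsSq (p + q) = fun w => evalAbsSq p w + evalAbsSq q w := by
      funext; simp [evalAbsSq]
    exact this ▸ hp.add hq
  | mul_X p i hp =>
    have h1 : ContDiff ℝ k fun w : Fin n → ℂ => ‖w i‖ ^ 2 := (contDiff_apply ℝ ℂ i).norm_sq ℝ
    have : evalAbsSq (p * MvPolynomial.X i) = fun w => evalAbsSq p w * ‖w i‖ ^ 2 := by
      funext; simp [evalAbsSq]
    exact this ▸ hp.mul h1

theorem differentiable_ofReal_evalAbsSq (F : MvPolynomial (Fin n) ℝ) :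
    Differentiable ℝ fun w => (evalAbsSq F w : ℂ) :=
  Complex.ofRealCLM.differentiable.comp ((contDiff_evalAbsSq F (k := 1)).differentiable (by simp))

theorem wirtinger_evalAbsSq (F : MvPolynomial (Fin n) ℝ) (z : Fin n → ℂ) (j : Fin n) :
    wirtinger j (fun w => (evalAbsSq F w : ℂ)) z =
      evalAbsSq (MvPolynomial.pderiv j F) z * (starRingEnd ℂ) (z j) := by
  have hd := (contDiff_evalAbsSq F (k := 1)).differentiable (by simp) z
  rw [wirtinger, fderiv_ofReal_comp hd, fderiv_ofReal_comp hd, fderiv_evalAbsSq, fderiv_evalAbsSq]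
  have h2 : (1 / 2 : ℂ) = ((1 / 2 : ℝ) : ℂ) := by push_cast; rfl
  rw [h2]
  apply Complex.ext <;> simp <;> ring

theorem wirtingerBar_log_evalAbsSq {F : MvPolynomial (Fin n) ℝ} {z : Fin n → ℂ}
    (hF : evalAbsSq F z ≠ 0) (j : Fin n) :
    wirtingerBar j (fun w => (Real.log (evalAbsSq F w) : ℂ)) z =
      (evalAbsSq (MvPolynomial.pderiv j F) z : ℂ) * z j * (evalAbsSq F z : ℂ)⁻¹ := by
  have hd := (contDiff_evalAbsSq F (k := 1)).differentiable (by simp) z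
  rw [wirtingerBar, fderiv_ofReal_comp (hd.log hF), fderiv_ofReal_comp (hd.log hF),
    fderiv.log hd hF, smul_apply, smul_apply, fderiv_evalAbsSq, fderiv_evalAbsSq]
  have h2 : (1 / 2 : ℂ) = ((1 / 2 : ℝ) : ℂ) := by push_cast; rfl
  rw [h2]
  apply Complex.ext <;> simp [← Complex.ofReal_inv, -Complex.inv_re, -Complex.inv_im] <;> ring

/-- `∂∂̄ log F(|z_1|², …, |z_n|²)` in terms of the matrix `A` of the Einstein equation. -/
theorem complexHessian_log_evalAbsSq {F : MvPolynomial (Fin n) ℝ} {z : Fin n → ℂ}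
    (hF : evalAbsSq F z ≠ 0) :
    complexHessian (fun w => Real.log (evalAbsSq F w)) z =
      (((evalAbsSq F z : ℂ) ^ 2)⁻¹) • einsteinMatrix F z := by
  ext i j
  have h : (fun w => wirtingerBar j (fun y => (Real.log (evalAbsSq F y) : ℂ)) w) =ᶠ[nhds z]
      fun w => (evalAbsSq (MvPolynomial.pderiv j F) w : ℂ) * w j * (evalAbsSq F w : ℂ)⁻¹ := by
    filter_upwards [(contDiff_evalAbsSq F (k := 0)).continuous.continuousAt.eventually_ne hF]
      with w hw using wirtingerBar_log_evalAbsSq hw j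
  have hF' : (evalAbsSq F z : ℂ) ≠ 0 := by exact_mod_cast hF
  have h1 := differentiable_ofReal_evalAbsSq (MvPolynomial.pderiv j F) z
  have h2 : DifferentiableAt ℝ (fun w : Fin n → ℂ => w j) z := differentiableAt_apply j z
  have h3 := differentiable_ofReal_evalAbsSq F z
  rw [complexHessian, Matrix.of_apply, wirtinger, h.fderiv_eq]
  change wirtinger i (fun w => (evalAbsSq (MvPolynomial.pderiv j F) w : ℂ) * w j *
    (evalAbsSq F w : ℂ)⁻¹) z = _
  rw [wirtinger_mul (h1.fun_mul h2) (h3.fun_inv hF'), wirtinger_mul h1 h2, wirtinger_inv h3 hF',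
    wirtinger_evalAbsSq, wirtinger_evalAbsSq, wirtinger_coord, Matrix.smul_apply, einsteinMatrix,
    Matrix.of_apply]
  simp only [evalAbsSq, map_sub, map_mul, smul_eq_mul] at hF' ⊢
  push_cast
  split_ifs <;> field_simp <;> ring_nf

theorem continuous_einsteinMatrix (F : MvPolynomial (Fin n) ℝ) :
    Continuous (einsteinMatrix F) := by
  refine continuous_matrix fun i j => ?_
  have h : ∀ G : MvPolynomial (Fin n) ℝ, Continuous (evalAbsSq G) := fun G =>
    (contDiff_evalAbsSq G (k := 0)).continuous
  simp only [einsteinMatrix, Matrix.of_apply]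
  have h1 := h (F * MvPolynomial.pderiv i (MvPolynomial.pderiv j F)
        - MvPolynomial.pderiv i F * MvPolynomial.pderiv j F)
  have h2 := h (F * MvPolynomial.pderiv j F)
  split_ifs <;> fun_prop

/-- For `F = X_i` the only entry of `A` that could survive is `-|z_i|² + |z_i|² = 0`. This is why
monomial factors in the `|z_i|²` do not affect the metric. -/
theorem complexHessian_log_norm_sq {z : Fin n → ℂ} {i : Fin n} (hi : z i ≠ 0) :
    complexHessian (fun w => Real.log (‖w i‖ ^ 2)) z = 0 := by
  have hX : ∀ w : Fin n → ℂ, evalAbsSq (MvPolynomial.X i) w = ‖w i‖ ^ 2 := fun w => by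
    simp [evalAbsSq]
  have h := complexHessian_log_evalAbsSq (F := MvPolynomial.X i) (z := z) (by simpa [hX] using hi)
  simp only [hX] at h
  rw [h]
  have : einsteinMatrix (MvPolynomial.X i) z = 0 := by
    ext k l
    simp only [einsteinMatrix, Matrix.of_apply, Matrix.zero_apply, MvPolynomial.pderiv_X,
      Pi.single_apply]
    by_cases hl : i = l
    · subst hl
      by_cases hk : i = k
      · subst hk
        simp [evalAbsSq, ← Complex.mul_conj', mul_comm]
      · simp [evalAbsSq, hk, Ne.symm hk]
    · by_cases hk : i = k
      · subst hk
        simp [evalAbsSq, hl]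
      · by_cases hkl : k = l <;> simp [evalAbsSq, hk, hl, hkl]
  rw [this, smul_zero]

end EvalAbsSq

/-! ## Monomial maps and charts on the torus -/

section Monomial

variable {n : ℕ}

theorem dense_torus : Dense {z : Fin n → ℂ | ∀ i, z i ≠ 0} := by
  have := dense_pi (Set.univ : Set (Fin n)) (s := fun _ => ({0}ᶜ : Set ℂ))
    fun i _ => dense_compl_singleton (0 : ℂ)
  convert this using 1
  ext z; simp

theorem isOpen_torus : IsOpen {z : Fin n → ℂ | ∀ i, z i ≠ 0} := by
  rw [Set.ofPred_forall]
  exact isOpen_iInter_of_finite fun i => isOpen_ne_fun (continuous_apply i) continuous_const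

theorem monomialMap_one_left (z : Fin n → ℂ) : monomialMap 1 z = z := by
  funext j
  simp only [monomialMap]
  rw [Finset.prod_eq_single j]
  · simp
  · intro i _ hi
    simp [Ne.symm hi]
  · simp

theorem exists_monomialMap_eq {C : Matrix (Fin n) (Fin n) ℤ} (hC : IsUnit C.det) {w : Fin n → ℂ}
    (hw : ∀ i, w i ≠ 0) : ∃ z : Fin n → ℂ, (∀ i, z i ≠ 0) ∧ monomialMap C z = w :=
  ⟨monomialMap C⁻¹ w, monomialMap_ne_zero _ hw, by
    rw [monomialMap_comp _ _ hw, Matrix.mul_nonsing_inv _ hC, monomialMap_one_left]⟩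

theorem contDiffAt_monomialMap (B : Matrix (Fin n) (Fin n) ℤ) {z : Fin n → ℂ}
    (hz : ∀ i, z i ≠ 0) : ContDiffAt ℂ ω (monomialMap B) z := by
  rw [contDiffAt_pi]
  intro j
  change ContDiffAt ℂ ω (fun z : Fin n → ℂ => ∏ i, z i ^ B j i) _
  refine contDiffAt_prod fun i _ => AnalyticAt.contDiffAt ?_
  exact ((ContinuousLinearMap.proj (R := ℂ) (φ := fun _ : Fin n => ℂ) i).analyticAt z).fun_zpow
    (hz i)

/-- In logarithmic coordinates the map is linear with matrix `B`; the diagonal factors convert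
between `dz_i / z_i` and `dz_i`. -/
theorem complexJacobian_monomialMap (B : Matrix (Fin n) (Fin n) ℤ) {z : Fin n → ℂ}
    (hz : ∀ i, z i ≠ 0) : complexJacobian (monomialMap B) z =
      Matrix.diagonal (monomialMap B z) * B.map (Int.castRingHom ℂ) *
        Matrix.diagonal fun i => (z i)⁻¹ := by
  ext j i
  rw [complexJacobian, Matrix.of_apply, Matrix.mul_diagonal, Matrix.diagonal_mul]
  have h1 : DifferentiableAt ℂ (monomialMap B) z :=
    (contDiffAt_monomialMap B hz).differentiableAt (by simp)
  have h2 : ∀ k, HasFDerivAt (fun z : Fin n → ℂ => z k ^ B j k)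
      ((B j k * z k ^ (B j k - 1)) •
        ContinuousLinearMap.proj (R := ℂ) (φ := fun _ : Fin n => ℂ) k) z := fun k =>
    (hasDerivAt_zpow (B j k) (z k) (Or.inl (hz k))).comp_hasFDerivAt z
      (f := fun z : Fin n → ℂ => z k)
      (ContinuousLinearMap.proj (R := ℂ) (φ := fun _ : Fin n => ℂ) k).hasFDerivAt
  have h3 := HasFDerivAt.finsetProd (u := Finset.univ) fun k _ => h2 k
  have h4 : fderiv ℂ (monomialMap B) z (Pi.single i 1) j =
      fderiv ℂ (fun z : Fin n → ℂ => ∏ k, z k ^ B j k) z (Pi.single i 1) := by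
    exact (congrArg (fun L => L (Pi.single i 1))
      ((hasFDerivAt_pi'.1 h1.hasFDerivAt) j).fderiv).symm
  rw [h4, h3.fderiv]
  simp only [sum_apply, smul_apply, ContinuousLinearMap.proj_apply, smul_eq_mul, Pi.single_apply,
    mul_ite, mul_one, mul_zero]
  rw [Finset.sum_ite_eq' Finset.univ i, if_pos (Finset.mem_univ i), Matrix.map_apply, monomialMap,
    ← Finset.mul_prod_erase Finset.univ _ (Finset.mem_univ i), zpow_sub_one₀ (hz i)]
  simp only [eq_intCast]
  ring

theorem det_complexJacobian_monomialMap (B : Matrix (Fin n) (Fin n) ℤ) {z : Fin n → ℂ}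
    (hz : ∀ i, z i ≠ 0) : (complexJacobian (monomialMap B) z).det =
      (B.det : ℂ) * (∏ j, monomialMap B z j) / ∏ i, z i := by
  rw [complexJacobian_monomialMap B hz, Matrix.det_mul, Matrix.det_mul, Matrix.det_diagonal,
    Matrix.det_diagonal, Finset.prod_inv_distrib]
  have : (B.map (Int.castRingHom ℂ)).det = ((B.det : ℤ) : ℂ) :=
    (RingHom.map_det (Int.castRingHom ℂ) B).symm
  rw [this]
  ring

end Monomial

namespace SmoothCompleteFan

variable {n : ℕ} (S : SmoothCompleteFan n)

theorem isUnit_det_chartExponents (k : Fin S.numCones) : IsUnit (S.chartExponents k).det := by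
  rw [chartExponents, Matrix.det_neg, Matrix.det_transpose]
  exact ((isUnit_one.neg).pow _).mul (Matrix.isUnit_nonsing_inv_det _ (S.smooth k))

/-- The determinant of the exponents of a chart, which is `1` or `-1`. -/
noncomputable def chartSign (k : Fin S.numCones) : ℂ := ((S.chartExponents k).det : ℂ)

theorem chartSign_mul_self (k : Fin S.numCones) : S.chartSign k * S.chartSign k = 1 := by
  rw [chartSign, ← Int.cast_mul, Int.isUnit_mul_self (S.isUnit_det_chartExponents k), Int.cast_one]

theorem chartSign_ne_zero (k : Fin S.numCones) : S.chartSign k ≠ 0 := fun h => by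
  simpa [h] using S.chartSign_mul_self k

theorem norm_chartSign (k : Fin S.numCones) : ‖S.chartSign k‖ = 1 := by
  have h := congrArg norm (S.chartSign_mul_self k)
  rw [norm_mul, norm_one] at h
  nlinarith [norm_nonneg (S.chartSign k)]

/-- The coordinates of the chart `k` on the torus. -/
noncomputable def chartPoint (k : Fin S.numCones) (z : Fin n → ℂ) : Fin n → ℂ :=
  monomialMap (S.chartExponents k) z

theorem chartPoint_ne_zero (k : Fin S.numCones) {z : Fin n → ℂ} (hz : ∀ i, z i ≠ 0) (j : Fin n) :
    S.chartPoint k z j ≠ 0 := monomialMap_ne_zero _ hz j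

theorem prod_chartPoint_ne_zero (k : Fin S.numCones) {z : Fin n → ℂ} (hz : ∀ i, z i ≠ 0) :
    ∏ j, S.chartPoint k z j ≠ 0 :=
  Finset.prod_ne_zero_iff.2 fun j _ => S.chartPoint_ne_zero k hz j

theorem chartPoint_mul (k : Fin S.numCones) (z w : Fin n → ℂ) :
    S.chartPoint k (z * w) = S.chartPoint k z * S.chartPoint k w := monomialMap_mul _ z w

theorem exists_chartPoint_eq (k : Fin S.numCones) {w : Fin n → ℂ} (hw : ∀ i, w i ≠ 0) :
    ∃ z : Fin n → ℂ, (∀ i, z i ≠ 0) ∧ S.chartPoint k z = w :=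
  exists_monomialMap_eq (S.isUnit_det_chartExponents k) hw

theorem mem_glueDomain_of_ne_zero (k l : Fin S.numCones) {w : Fin n → ℂ} (hw : ∀ i, w i ≠ 0) :
    w ∈ S.glueDomain k l := fun i hi => absurd hi (hw i)

theorem glueMap_chartPoint (k l : Fin S.numCones) {z : Fin n → ℂ} (hz : ∀ i, z i ≠ 0) :
    S.glueMap k l (S.chartPoint k z) = S.chartPoint l z := by
  rw [glueMap, chartPoint, monomialMap_comp _ _ hz, glueExponents_mul_chartExponents]; rfl

theorem det_complexJacobian_glueMap (k l : Fin S.numCones) {z : Fin n → ℂ} (hz : ∀ i, z i ≠ 0) :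
    (complexJacobian (S.glueMap k l) (S.chartPoint k z)).det =
      S.chartSign k * S.chartSign l * (∏ j, S.chartPoint l z j) / ∏ j, S.chartPoint k z j := by
  have h := congrArg (fun A => ((Matrix.det A : ℤ) : ℂ)) (S.glueExponents_mul_chartExponents k l)
  simp only [Matrix.det_mul, Int.cast_mul] at h
  change _ * S.chartSign k = S.chartSign l at h
  have h2 := S.glueMap_chartPoint k l hz
  rw [glueMap] at h2 ⊢
  rw [det_complexJacobian_monomialMap _ (S.chartPoint_ne_zero k hz), h2, ← h]
  linear_combination (-((S.glueExponents k l).det : ℂ) * (∏ j, S.chartPoint l z j) /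
    ∏ j, S.chartPoint k z j) * S.chartSign_mul_self k

/-- The chart `k` as an element of the atlas. -/
noncomputable def chart (k : Fin S.numCones) : atlas (Fin n → ℂ) S.ToricManifold :=
  ⟨S.coordChart k, k, rfl⟩

theorem exists_chart_eq (e : atlas (Fin n → ℂ) S.ToricManifold) : ∃ k, S.chart k = e := by
  obtain ⟨_, k, rfl⟩ := e
  exact ⟨k, rfl⟩

theorem chart_target (k : Fin S.numCones) : (S.chart k).1.target = Set.univ :=
  S.coordChart_target k

theorem chart_symm (k : Fin S.numCones) : ⇑(S.chart k).1.symm = S.affineChart k :=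
  S.coordChart_symm k

theorem chart_affineChart (k : Fin S.numCones) (z : Fin n → ℂ) :
    (S.chart k).1 (S.affineChart k z) = z := S.coordChart_affineChart k z

theorem affineChart_mem_chart_source (k : Fin S.numCones) (z : Fin n → ℂ) :
    S.affineChart k z ∈ (S.chart k).1.source := by
  change _ ∈ (S.coordChart k).source
  rw [coordChart_source]; exact ⟨z, rfl⟩

theorem affineChart_eq_glueMap {k l : Fin S.numCones} {z : Fin n → ℂ}
    (hz : z ∈ S.glueDomain k l) : S.affineChart k z = S.affineChart l (S.glueMap k l z) :=
  S.affineChart_eq_iff.2 ⟨hz, rfl⟩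

theorem transition_source (k l : Fin S.numCones) :
    ((S.chart k).1.symm.trans (S.chart l).1).source = S.glueDomain k l := by
  ext z
  rw [OpenPartialHomeomorph.trans_source, OpenPartialHomeomorph.symm_source, chart_target,
    Set.univ_inter, Set.mem_preimage, chart_symm]
  constructor
  · intro h
    change _ ∈ (S.coordChart l).source at h
    rw [coordChart_source] at h
    obtain ⟨w, hw⟩ := h
    exact (S.affineChart_eq_iff.1 hw.symm).1
  · intro h
    rw [S.affineChart_eq_glueMap h]
    exact S.affineChart_mem_chart_source l _

theorem transition_apply {k l : Fin S.numCones} {z : Fin n → ℂ} (hz : z ∈ S.glueDomain k l) :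
    (S.chart k).1.symm.trans (S.chart l).1 z = S.glueMap k l z := by
  rw [OpenPartialHomeomorph.coe_trans, Function.comp_apply, chart_symm,
    S.affineChart_eq_glueMap hz, chart_affineChart]

theorem complexJacobian_transition {k l : Fin S.numCones} {z : Fin n → ℂ}
    (hz : z ∈ S.glueDomain k l) :
    complexJacobian ((S.chart k).1.symm.trans (S.chart l).1) z =
      complexJacobian (S.glueMap k l) z := by
  have h : ((S.chart k).1.symm.trans (S.chart l).1 : (Fin n → ℂ) → Fin n → ℂ) =ᶠ[nhds z]
      S.glueMap k l := by
    filter_upwards [(S.isOpen_glueDomain k l).mem_nhds hz] with w hw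
      using S.transition_apply hw
  simp only [complexJacobian, h.fderiv_eq]

/-- Different indices may give the same element of the atlas, so anything defined by choosing an
index must not depend on it. The exponents are recovered from the chart by evaluating it at torus
points with one coordinate `2` and the others `1`. -/
theorem chartExponents_eq_of_chart_eq {k l : Fin S.numCones} (h : S.chart k = S.chart l) :
    S.chartExponents k = S.chartExponents l := by
  have haff : S.affineChart k = S.affineChart l := by rw [← chart_symm, h, chart_symm]
  ext j i
  have hz : ∀ i', (Function.update 1 i 2 : Fin n → ℂ) i' ≠ 0 := by
    intro i'
    by_cases hi : i' = i
    · subst hi; simp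
    · simp [hi]
  have h1 := (S.torusEmbedding_eq k hz).symm.trans (S.torusEmbedding_eq l hz)
  rw [haff] at h1
  have h2 := congrFun ((S.isOpenEmbedding_affineChart l).injective h1) j
  have h3 : ∀ B : Matrix (Fin n) (Fin n) ℤ,
      monomialMap B (Function.update 1 i 2) j = (2 : ℂ) ^ B j i := by
    intro B
    rw [monomialMap, Finset.prod_eq_single i]
    · simp
    · intro b _ hb
      simp [hb]
    · simp
  rw [h3, h3] at h2
  have h4 : ((2 : ℝ) ^ S.chartExponents k j i) = (2 : ℝ) ^ S.chartExponents l j i := by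
    simpa using congrArg norm h2
  exact zpow_right_injective₀ (by norm_num) (by norm_num) h4

/-! ## Anticanonical sections on the torus -/

/-- The coefficient with respect to `z_1∂_{z_1} ∧ ⋯ ∧ z_n∂_{z_n}`, on the torus, of the section
`f ∂_{w_1} ∧ ⋯ ∧ ∂_{w_n}` in the chart `k`. -/
noncomputable def torusCoeff (k : Fin S.numCones) (f : (Fin n → ℂ) → ℂ) (z : Fin n → ℂ) : ℂ :=
  S.chartSign k * f (S.chartPoint k z) / ∏ j, S.chartPoint k z j

theorem apply_chartPoint (k : Fin S.numCones) (f : (Fin n → ℂ) → ℂ) {z : Fin n → ℂ}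
    (hz : ∀ i, z i ≠ 0) : f (S.chartPoint k z) =
      S.chartSign k * (∏ j, S.chartPoint k z j) * S.torusCoeff k f z := by
  have h := S.prod_chartPoint_ne_zero k hz
  rw [torusCoeff]
  field_simp
  linear_combination (-f (S.chartPoint k z)) * S.chartSign_mul_self k

/-- The frame `z_1∂_1 ∧ ⋯ ∧ z_n∂_n` does not depend on the chart, so the Jacobian transformation
rule turns into an equality of coefficients. -/
theorem torusCoeff_eq_iff (k l : Fin S.numCones) (f g : (Fin n → ℂ) → ℂ) {z : Fin n → ℂ}
    (hz : ∀ i, z i ≠ 0) : S.torusCoeff k f z = S.torusCoeff l g z ↔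
      g (S.glueMap k l (S.chartPoint k z)) =
        (complexJacobian (S.glueMap k l) (S.chartPoint k z)).det * f (S.chartPoint k z) := by
  have hk := S.prod_chartPoint_ne_zero k hz
  have hl := S.prod_chartPoint_ne_zero l hz
  rw [S.glueMap_chartPoint k l hz, S.det_complexJacobian_glueMap k l hz,
    S.apply_chartPoint k f hz, S.apply_chartPoint l g hz]
  have : S.chartSign k * S.chartSign l * (∏ j, S.chartPoint l z j) / (∏ j, S.chartPoint k z j) *
      (S.chartSign k * (∏ j, S.chartPoint k z j) * S.torusCoeff k f z) =
      S.chartSign l * (∏ j, S.chartPoint l z j) * S.torusCoeff k f z := by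
    field_simp
    linear_combination (S.chartSign l * S.torusCoeff k f z) * S.chartSign_mul_self k
  rw [this, mul_right_inj' (mul_ne_zero (S.chartSign_ne_zero l) hl), eq_comm]

/-- `H⁰(M, K*)`. -/
noncomputable abbrev Sections := AnticanonicalSections n S.ToricManifold

variable {S}

theorem differentiable_section (s : S.Sections) (k : Fin S.numCones) :
    Differentiable ℂ (s.1 (S.chart k)) := by
  have := s.2.1 (S.chart k)
  rwa [chart_target, differentiableOn_univ] at this

theorem section_glueMap (s : S.Sections) {k l : Fin S.numCones} {z : Fin n → ℂ}
    (hz : z ∈ S.glueDomain k l) : s.1 (S.chart l) (S.glueMap k l z) =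
      (complexJacobian (S.glueMap k l) z).det * s.1 (S.chart k) z := by
  have h := s.2.2.2 (S.chart k) (S.chart l) z (by rwa [transition_source])
  rwa [transition_apply S hz, complexJacobian_transition S hz] at h

theorem torusCoeff_section (s : S.Sections) (k l : Fin S.numCones) {z : Fin n → ℂ}
    (hz : ∀ i, z i ≠ 0) :
    S.torusCoeff k (s.1 (S.chart k)) z = S.torusCoeff l (s.1 (S.chart l)) z :=
  (S.torusCoeff_eq_iff k l _ _ hz).2 (section_glueMap s
    (S.mem_glueDomain_of_ne_zero k l (S.chartPoint_ne_zero k hz)))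

theorem section_ext {s t : S.Sections} (h : ∀ k, s.1 (S.chart k) = t.1 (S.chart k)) : s = t := by
  refine Subtype.ext (funext fun e => ?_)
  obtain ⟨k, rfl⟩ := S.exists_chart_eq e
  exact h k

theorem eq_of_torusCoeff_eq (k : Fin S.numCones) {f g : (Fin n → ℂ) → ℂ} (hf : Continuous f)
    (hg : Continuous g) (h : ∀ z : Fin n → ℂ, (∀ i, z i ≠ 0) →
      S.torusCoeff k f z = S.torusCoeff k g z) : f = g := by
  refine Continuous.ext_on dense_torus hf hg fun w hw => ?_
  obtain ⟨z, hz, rfl⟩ := S.exists_chartPoint_eq k hw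
  rw [S.apply_chartPoint k f hz, S.apply_chartPoint k g hz, h z hz]

/-- Entire functions on the charts that agree on the torus are a section. -/
noncomputable def toSection (f : Fin S.numCones → (Fin n → ℂ) → ℂ)
    (hd : ∀ k, Differentiable ℂ (f k)) (hc : ∀ k l, ∀ z : Fin n → ℂ, (∀ i, z i ≠ 0) →
      S.torusCoeff k (f k) z = S.torusCoeff l (f l) z) : S.Sections :=
  ⟨fun e => f (S.exists_chart_eq e).choose, fun e => (hd _).differentiableOn, fun e z hz => by
    obtain ⟨k, rfl⟩ := S.exists_chart_eq e
    simp [chart_target] at hz, by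
    have key : ∀ k l, ∀ z ∈ S.glueDomain k l, f l (S.glueMap k l z) =
        (complexJacobian (S.glueMap k l) z).det * f k z := by
      intro k l
      have hJ : ContinuousOn (fun z => complexJacobian (S.glueMap k l) z) (S.glueDomain k l) := by
        have h1 := (S.contDiffOn_glueMap k l).continuousOn_fderiv_of_isOpen
          (S.isOpen_glueDomain k l) (by simp)
        refine continuousOn_pi.2 fun a => continuousOn_pi.2 fun b => ?_
        have h2 := h1.clm_apply (continuousOn_const (c := (Pi.single b 1 : Fin n → ℂ)))
        exact (continuous_apply a).comp_continuousOn h2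
      have hdet : ContinuousOn (fun z => (complexJacobian (S.glueMap k l) z).det)
          (S.glueDomain k l) :=
        (Continuous.matrix_det continuous_id).comp_continuousOn hJ
      -- Both sides are continuous on the overlap and the torus is dense, so it suffices to check
      -- the transformation rule on the torus.
      refine Set.EqOn.of_subset_closure (s := {z : Fin n → ℂ | ∀ i, z i ≠ 0}) ?_
        ((hd l).continuous.comp_continuousOn (S.contDiffOn_glueMap k l).continuousOn)
        (hdet.mul (hd k).continuous.continuousOn)
        (fun z hz => S.mem_glueDomain_of_ne_zero k l hz)
        (by rw [dense_torus.closure_eq]; exact Set.subset_univ _)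
      intro w hw
      obtain ⟨z, hz, rfl⟩ := S.exists_chartPoint_eq k hw
      exact (S.torusCoeff_eq_iff k l _ _ hz).1 (hc k l z hz)
    intro e e' z hz
    have he := (S.exists_chart_eq e).choose_spec
    have he' := (S.exists_chart_eq e').choose_spec
    have hz' : z ∈ S.glueDomain (S.exists_chart_eq e).choose (S.exists_chart_eq e').choose := by
      rwa [← transition_source, he, he']
    have h1 := transition_apply S hz'
    have h2 := complexJacobian_transition S hz'
    rw [he, he'] at h1 h2
    rw [h1, h2]
    exact key _ _ z hz'⟩

/-- The index chosen for `S.chart k` need not be `k`, but it has the same exponents. The two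
functions then have the same torus coefficient, hence agree by density. -/
theorem toSection_apply (f : Fin S.numCones → (Fin n → ℂ) → ℂ)
    (hd : ∀ k, Differentiable ℂ (f k)) (hc : ∀ k l, ∀ z : Fin n → ℂ, (∀ i, z i ≠ 0) →
      S.torusCoeff k (f k) z = S.torusCoeff l (f l) z) (k : Fin S.numCones) :
    (toSection f hd hc).1 (S.chart k) = f k := by
  change f (S.exists_chart_eq (S.chart k)).choose = f k
  have h := (S.exists_chart_eq (S.chart k)).choose_spec
  have hC := S.chartExponents_eq_of_chart_eq h
  refine eq_of_torusCoeff_eq k (hd _).continuous (hd k).continuous fun z hz => ?_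
  rw [← hc (S.exists_chart_eq (S.chart k)).choose k z hz]
  simp only [torusCoeff, chartSign, chartPoint, hC]

/-! ### The torus action on anticanonical sections. -/

theorem differentiable_torusPullback (lam : Fin n → ℂ) (s : S.Sections) (k : Fin S.numCones) :
    Differentiable ℂ fun w =>
      (∏ j, S.chartPoint k lam j)⁻¹ * s.1 (S.chart k) (S.chartPoint k lam * w) := by
  have := differentiable_section s k
  have h2 : Differentiable ℂ fun w : Fin n → ℂ => S.chartPoint k lam * w := by fun_prop
  exact (this.comp h2).const_mul _

/-- The factor `(∏ j, S.chartPoint k lam j)⁻¹` accounts for the scaling of the frame `∂_{w_1} ∧ ⋯ ∧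
∂_{w_n}`; with it, the action on torus coefficients is plain translation by `lam`, visibly
independent of the chart. -/
theorem torusCoeff_torusPullback (lam : Fin n → ℂ) (s : S.Sections) (k : Fin S.numCones)
    (z : Fin n → ℂ) : S.torusCoeff k (fun w =>
      (∏ j, S.chartPoint k lam j)⁻¹ * s.1 (S.chart k) (S.chartPoint k lam * w)) z =
      S.torusCoeff k (s.1 (S.chart k)) (lam * z) := by
  simp only [torusCoeff, chartPoint_mul, Pi.mul_apply, Finset.prod_mul_distrib]
  ring

/-- The action of the complex torus on the sections. -/
noncomputable def torusPullback (lam : Fin n → ℂ) (hlam : ∀ i, lam i ≠ 0) :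
    S.Sections →ₗ[ℂ] S.Sections where
  toFun s := toSection _ (differentiable_torusPullback lam s) fun k l z hz => by
    rw [torusCoeff_torusPullback, torusCoeff_torusPullback]
    exact torusCoeff_section s k l fun i => mul_ne_zero (hlam i) (hz i)
  map_add' s t := section_ext fun k => by
    rw [toSection_apply]
    change _ = (toSection _ _ _).1 (S.chart k) + (toSection _ _ _).1 (S.chart k)
    rw [toSection_apply, toSection_apply]
    funext w
    change _ * (s.1 _ _ + t.1 _ _) = _ * _ + _ * _
    ring
  map_smul' c s := section_ext fun k => by
    rw [toSection_apply]
    change _ = c • (toSection _ _ _).1 (S.chart k)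
    rw [toSection_apply]
    funext w
    change _ * (c * s.1 _ _) = c * (_ * _)
    ring

theorem torusPullback_apply (lam : Fin n → ℂ) (hlam : ∀ i, lam i ≠ 0) (s : S.Sections)
    (k : Fin S.numCones) (w : Fin n → ℂ) : (torusPullback lam hlam s).1 (S.chart k) w =
      (∏ j, S.chartPoint k lam j)⁻¹ * s.1 (S.chart k) (S.chartPoint k lam * w) :=
  congrFun (toSection_apply _ (differentiable_torusPullback lam s) (fun k l z hz => by
    rw [torusCoeff_torusPullback, torusCoeff_torusPullback]
    exact torusCoeff_section s k l fun i => mul_ne_zero (hlam i) (hz i)) k) w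

end SmoothCompleteFan

/-! ## Polynomials in several variables -/

section Interpolation

open Polynomial in
/-- A function that is a polynomial of bounded degree in each variable is a polynomial. -/
theorem exists_mvPolynomial_of_separately {n D : ℕ} (f : (Fin n → ℂ) → ℂ)
    (hf : ∀ i w, ∃ P : ℂ[X], P.degree < D ∧ ∀ ζ, f (Function.update w i ζ) = P.eval ζ) :
    ∃ p : MvPolynomial (Fin n) ℂ, ∀ w, f w = MvPolynomial.eval w p := by
  have hinj : Set.InjOn (fun m : ℕ => (m : ℂ)) (Finset.range D) :=
    fun a _ b _ h => Nat.cast_injective h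
  let L : ℕ → ℂ[X] := Lagrange.basis (Finset.range D) (fun m : ℕ => (m : ℂ))
  -- Degree less than `D` makes Lagrange interpolation at the nodes `0, …, D - 1` exact, with basis
  -- polynomials that do not depend on the other variables.
  have hL : ∀ i w, f w = ∑ m ∈ Finset.range D,
      f (Function.update w i (m : ℂ)) * (L m).eval (w i) := by
    intro i w
    obtain ⟨P, hP, h⟩ := hf i w
    have h1 := h (w i)
    rw [Function.update_eq_self, Lagrange.eq_interpolate (f := P) hinj (by simpa using hP),
      Lagrange.interpolate_apply, Polynomial.eval_finsetSum] at h1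
    rw [h1]
    refine Finset.sum_congr rfl fun m _ => ?_
    rw [h, Polynomial.eval_mul, Polynomial.eval_C]
  -- Induction on the set `s` of free variables, the others being frozen at `c`. Freeing `i`
  -- interpolates between the polynomials obtained by freezing the `i`-th variable at the nodes.
  have claim : ∀ s : Finset (Fin n), ∀ c : Fin n → ℂ, ∃ p : MvPolynomial (Fin n) ℂ, ∀ w,
      (∀ i ∉ s, w i = c i) → f w = MvPolynomial.eval w p := by
    intro s
    induction s using Finset.induction_on with
    | empty =>
      intro c
      refine ⟨MvPolynomial.C (f c), fun w hw => ?_⟩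
      rw [MvPolynomial.eval_C, funext fun i => hw i (Finset.notMem_empty i)]
    | insert i s hi ih =>
      intro c
      choose p hp using ih
      refine ⟨∑ m ∈ Finset.range D,
        MvPolynomial.bind₁ (Function.update MvPolynomial.X i (MvPolynomial.C (m : ℂ)))
          (p (Function.update c i (m : ℂ))) *
        Polynomial.aeval (MvPolynomial.X i : MvPolynomial (Fin n) ℂ) (L m), fun w hw => ?_⟩
      rw [hL i w, map_sum]
      refine Finset.sum_congr rfl fun m _ => ?_
      rw [map_mul]
      congr 1
      · rw [hp (Function.update c i (m : ℂ)) (Function.update w i (m : ℂ))]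
        · rw [← MvPolynomial.coe_aeval_eq_eval, ← MvPolynomial.coe_aeval_eq_eval]
          change _ = MvPolynomial.aeval w (MvPolynomial.bind₁ _ _)
          rw [MvPolynomial.aeval_bind₁]
          change MvPolynomial.aeval _ _ = _
          congr 2
          funext j
          by_cases hj : j = i
          · subst hj; simp
          · simp [hj]
        · intro j hj
          by_cases hji : j = i
          · subst hji; simp
          · simp only [Function.update_of_ne hji]
            exact hw j (by simp [hji, hj])
      · have := Polynomial.aeval_algHom_apply (MvPolynomial.aeval w : MvPolynomial (Fin n) ℂ →ₐ[ℂ] ℂ)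
          (MvPolynomial.X i) (L m)
        rw [MvPolynomial.aeval_X, Polynomial.coe_aeval_eq_eval] at this
        rw [this, ← MvPolynomial.coe_aeval_eq_eval]
        rfl
  obtain ⟨p, hp⟩ := claim Finset.univ 0
  exact ⟨p, fun w => hp w (by simp)⟩

/-- An entire function with finitely many non-zero Taylor coefficients is a polynomial. -/
theorem exists_polynomial_of_iteratedDeriv {g : ℂ → ℂ} (hg : Differentiable ℂ g) {D : ℕ}
    (h0 : ∀ d, D ≤ d → iteratedDeriv d g 0 = 0) :
    ∃ P : Polynomial ℂ, P.degree < D ∧ ∀ ζ, g ζ = P.eval ζ := by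
  refine ⟨∑ d ∈ Finset.range D,
    Polynomial.monomial d ((d.factorial : ℂ)⁻¹ * iteratedDeriv d g 0), ?_, fun ζ => ?_⟩
  · rw [Polynomial.degree_lt_iff_coeff_zero]
    intro m hm
    rw [Polynomial.finsetSum_coeff]
    refine Finset.sum_eq_zero fun d hd => ?_
    rw [Polynomial.coeff_monomial, if_neg]
    have := Finset.mem_range.1 hd
    omega
  · rw [← Complex.taylorSeries_eq_of_entire' 0 ζ hg, tsum_eq_sum (s := Finset.range D),
      Polynomial.eval_finsetSum]
    · simp
    · intro d hd
      rw [h0 d (by simpa using hd)]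
      simp

end Interpolation

/-! ## Laurent monomials -/

section Laurent

variable {n : ℕ}

/-- The character `z^m` of the torus. -/
noncomputable def laurentMonomial (m : Fin n → ℤ) (z : Fin n → ℂ) : ℂ := ∏ i, z i ^ m i

theorem laurentMonomial_mul_arg (m : Fin n → ℤ) (z w : Fin n → ℂ) :
    laurentMonomial m (z * w) = laurentMonomial m z * laurentMonomial m w := by
  simp only [laurentMonomial, Pi.mul_apply, mul_zpow, Finset.prod_mul_distrib]

theorem laurentMonomial_zero (z : Fin n → ℂ) : laurentMonomial 0 z = 1 := by
  simp [laurentMonomial]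

theorem laurentMonomial_monomialMap (C : Matrix (Fin n) (Fin n) ℤ) (b : Fin n → ℤ) {z : Fin n → ℂ}
    (hz : ∀ i, z i ≠ 0) :
    laurentMonomial b (monomialMap C z) = laurentMonomial (Matrix.vecMul b C) z := by
  simp only [laurentMonomial, monomialMap]
  simp_rw [← Finset.prod_zpow]
  rw [Finset.prod_comm]
  refine Finset.prod_congr rfl fun i _ => ?_
  rw [Matrix.vecMul, dotProduct, zpow_sum_eq_prod (hz i)]
  exact Finset.prod_congr rfl fun j _ => by rw [← zpow_mul, mul_comm]

theorem laurentMonomial_update_one (m : Fin n → ℤ) (i : Fin n) (u : ℂ) :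
    laurentMonomial m (Function.update 1 i u) = u ^ m i := by
  rw [laurentMonomial, Finset.prod_eq_single i]
  · simp
  · intro b _ hb
    simp [hb]
  · simp

theorem update_one_ne_zero (i : Fin n) {u : ℂ} (hu : u ≠ 0) (j : Fin n) :
    (Function.update 1 i u : Fin n → ℂ) j ≠ 0 := by
  by_cases h : j = i
  · subst h; simpa
  · simp [h]

/-- The map `z ↦ z^m z̄^m'`, as a homomorphism from the torus. -/
noncomputable def hermitianMonomialHom (p : (Fin n → ℤ) × (Fin n → ℤ)) :
    (Fin n → ℂˣ) →* ℂ where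
  toFun z := laurentMonomial p.1 (fun i => (z i : ℂ)) *
    (starRingEnd ℂ) (laurentMonomial p.2 (fun i => (z i : ℂ)))
  map_one' := by simp [laurentMonomial]
  map_mul' z w := by
    have : (fun i => (((z * w) i : ℂˣ) : ℂ)) = (fun i => (z i : ℂ)) * fun i => (w i : ℂ) := by
      funext i; simp
    rw [this, laurentMonomial_mul_arg, laurentMonomial_mul_arg, map_mul]
    ring

/-- Distinctness is what Dedekind's independence of characters requires. In the `i`-th variable
alone, the value at `2` detects `m i + m' i`. A difference `d ≠ 0` between the values of `m i - m'
i` is detected at `exp(πi/d)`, whose `d`-th power is `-1`. -/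
theorem hermitianMonomialHom_injective :
    Function.Injective (hermitianMonomialHom : (Fin n → ℤ) × (Fin n → ℤ) → _) := by
  rintro ⟨m, m'⟩ ⟨l, l'⟩ h
  have key : ∀ i, ∀ u : ℂ, u ≠ 0 → u ^ m i * (starRingEnd ℂ) (u ^ m' i) =
      u ^ l i * (starRingEnd ℂ) (u ^ l' i) := by
    intro i u hu
    have h1 := congrArg (fun f => f (Function.update (1 : Fin n → ℂˣ) i (Units.mk0 u hu))) h
    have h2 : (fun j => (Function.update (1 : Fin n → ℂˣ) i (Units.mk0 u hu) j : ℂ)) =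
        Function.update (1 : Fin n → ℂ) i u := by
      funext j
      by_cases hj : j = i
      · subst hj; simp
      · simp [hj]
    change laurentMonomial m _ * (starRingEnd ℂ) (laurentMonomial m' _) =
      laurentMonomial l _ * (starRingEnd ℂ) (laurentMonomial l' _) at h1
    simpa only [h2, laurentMonomial_update_one] using h1
  have hsum : ∀ i, m i + m' i = l i + l' i := by
    intro i
    have h1 := key i 2 (by norm_num)
    rw [map_zpow₀, map_zpow₀, Complex.conj_ofNat, ← zpow_add₀ (by norm_num),
      ← zpow_add₀ (by norm_num)] at h1
    have h2 : (2 : ℝ) ^ (m i + m' i) = (2 : ℝ) ^ (l i + l' i) := by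
      simpa using congrArg norm h1
    exact zpow_right_injective₀ (by norm_num) (by norm_num) h2
  have hdiff : ∀ i, m i - m' i = l i - l' i := by
    intro i
    by_contra hne
    set d : ℤ := (m i - m' i) - (l i - l' i) with hd
    have hd0 : d ≠ 0 := fun h0 => hne (by omega)
    set u : ℂ := Complex.exp (Real.pi / d * Complex.I) with hu
    have hu0 : u ≠ 0 := Complex.exp_ne_zero _
    have hconj : (starRingEnd ℂ) u = u⁻¹ := by
      rw [hu, ← Complex.exp_conj, ← Complex.exp_neg]
      simp
    have h1 := key i u hu0
    rw [map_zpow₀, map_zpow₀, hconj, inv_zpow', inv_zpow', ← zpow_add₀ hu0, ← zpow_add₀ hu0] at h1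
    have h2 : u ^ d = 1 := by
      have : d = (m i + -m' i) - (l i + -l' i) := by omega
      rw [this, zpow_sub₀ hu0, h1, div_self (zpow_ne_zero _ hu0)]
    have h3 : u ^ d = -1 := by
      rw [hu, ← Complex.exp_int_mul, ← Complex.exp_pi_mul_I]
      congr 1
      have : (d : ℂ) ≠ 0 := by exact_mod_cast hd0
      field_simp
    rw [h3] at h2
    norm_num at h2
  refine Prod.ext (funext fun i => ?_) (funext fun i => ?_)
  · have := hsum i; have := hdiff i; dsimp only; omega
  · have := hsum i; have := hdiff i; dsimp only; omega

/-- The functions `z^m z̄^m'` on the torus are linearly independent. -/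
theorem hermitianMonomial_independent (A : Finset ((Fin n → ℤ) × (Fin n → ℤ)))
    (g : (Fin n → ℤ) × (Fin n → ℤ) → ℂ)
    (h : ∀ z : Fin n → ℂ, (∀ i, z i ≠ 0) →
      ∑ p ∈ A, g p * (laurentMonomial p.1 z * (starRingEnd ℂ) (laurentMonomial p.2 z)) = 0) :
    ∀ p ∈ A, g p = 0 := by
  have hli := (linearIndependent_monoidHom (Fin n → ℂˣ) ℂ).comp _ hermitianMonomialHom_injective
  refine linearIndependent_iff'.1 hli A g (funext fun z => ?_)
  have := h (fun i => (z i : ℂ)) fun i => (z i).ne_zero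
  simpa [hermitianMonomialHom] using this

theorem laurentMonomial_independent (A : Finset (Fin n → ℤ)) (g : (Fin n → ℤ) → ℂ)
    (h : ∀ z : Fin n → ℂ, (∀ i, z i ≠ 0) → ∑ m ∈ A, g m * laurentMonomial m z = 0) :
    ∀ m ∈ A, g m = 0 := by
  intro m hm
  have := hermitianMonomial_independent (A ×ˢ {0}) (fun p => g p.1) (fun z hz => by
    rw [Finset.sum_product]
    simpa [laurentMonomial_zero] using h z hz) (m, 0) (by simp [hm])
  exact this

end Laurent

/-! ## The Laurent expansion of anticanonical sections -/

namespace SmoothCompleteFan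

variable {n : ℕ} {S : SmoothCompleteFan n}

/-- The Taylor coefficients of a section in one of the variables. -/
noncomputable def taylorFunctional (k : Fin S.numCones) (i : Fin n) (w : Fin n → ℂ) (d : ℕ) :
    S.Sections →ₗ[ℂ] ℂ where
  toFun s := iteratedDeriv d (fun ζ => s.1 (S.chart k) (Function.update w i ζ)) 0
  map_add' s t := by
    have h : ∀ s : S.Sections, ContDiffAt ℂ d
        (fun ζ => s.1 (S.chart k) (Function.update w i ζ)) 0 := fun s =>
      (((differentiable_section s k).comp fun ζ =>
        (hasFDerivAt_update w ζ).differentiableAt).contDiff).contDiffAt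
    exact iteratedDeriv_fun_add (h s) (h t)
  map_smul' c s := by
    exact iteratedDeriv_const_mul_field c
      (fun ζ => s.1 (S.chart k) (Function.update w i ζ))

theorem differentiable_section_update (s : S.Sections) (k : Fin S.numCones) (i : Fin n)
    (w : Fin n → ℂ) : Differentiable ℂ fun ζ => s.1 (S.chart k) (Function.update w i ζ) :=
  (differentiable_section s k).comp fun ζ => (hasFDerivAt_update w ζ).differentiableAt

/-- The torus element `lam` doubles the `i`-th coordinate of the chart and fixes the others. Taylor
coefficients are therefore eigenfunctionals; the division by `2` comes from the frame. -/
theorem taylorFunctional_torusPullback (k : Fin S.numCones) (i : Fin n) {lam : Fin n → ℂ}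
    (hlam : ∀ i, lam i ≠ 0) (h2 : S.chartPoint k lam = Function.update (1 : Fin n → ℂ) i 2) (w : Fin n → ℂ)
    (d : ℕ) (s : S.Sections) : taylorFunctional k i w d (torusPullback lam hlam s) =
      2 ^ d / 2 * taylorFunctional k i w d s := by
  have hprod : ∏ j, S.chartPoint k lam j = 2 := by
    rw [h2, Finset.prod_update_of_mem (Finset.mem_univ i)]
    simp
  have hmul : ∀ ζ : ℂ, (Function.update 1 i 2 : Fin n → ℂ) * Function.update w i ζ =
      Function.update w i (2 * ζ) := by
    intro ζ
    funext j
    by_cases hj : j = i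
    · subst hj; simp
    · simp [hj]
  change iteratedDeriv d (fun ζ => (torusPullback lam hlam s).1 _ _) 0 = _ * iteratedDeriv d _ 0
  simp only [torusPullback_apply, hprod]
  rw [iteratedDeriv_const_mul_field, h2]
  simp only [hmul]
  rw [iteratedDeriv_comp_const_mul (f := fun ζ => s.1 (S.chart k) (Function.update w i ζ))
    (differentiable_section_update s k i w).contDiff 2]
  simp only [mul_zero]
  ring

theorem taylorFunctional_aeval (k : Fin S.numCones) (i : Fin n) {lam : Fin n → ℂ}
    (hlam : ∀ i, lam i ≠ 0) (h2 : S.chartPoint k lam = Function.update (1 : Fin n → ℂ) i 2) (w : Fin n → ℂ)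
    (d : ℕ) (q : Polynomial ℂ) (s : S.Sections) :
    taylorFunctional k i w d (Polynomial.aeval (torusPullback (S := S) lam hlam) q s) =
      q.eval (2 ^ d / 2) * taylorFunctional k i w d s := by
  induction q using Polynomial.induction_on' generalizing s with
  | add p q hp hq =>
    rw [map_add, LinearMap.add_apply, map_add, hp, hq, Polynomial.eval_add, add_mul]
  | monomial m a =>
    rw [Polynomial.aeval_monomial, Polynomial.eval_monomial, Module.End.mul_apply,
      Module.algebraMap_end_apply, map_smul, smul_eq_mul, mul_assoc]
    congr 1
    induction m with
    | zero => simp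
    | succ m ih =>
      rw [pow_succ', Module.End.mul_apply, taylorFunctional_torusPullback k i hlam h2, ih]
      ring

/-- On a toric manifold with finitely many sections, the sections are polynomials in the charts. -/
theorem exists_mvPolynomial_section [Module.Finite ℂ S.Sections] (k : Fin S.numCones)
    (s : S.Sections) : ∃ p : MvPolynomial (Fin n) ℂ, ∀ w, s.1 (S.chart k) w =
      MvPolynomial.eval w p := by
  have hD : ∀ i, ∃ D : ℕ, ∀ w d, D ≤ d → taylorFunctional k i w d s = 0 := by
    intro i
    obtain ⟨lam, hlam, h2⟩ := S.exists_chartPoint_eq k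
      (update_one_ne_zero (n := n) i (two_ne_zero : (2 : ℂ) ≠ 0))
    -- By Cayley–Hamilton, a Taylor coefficient of order `d` can be non-zero only if `2^d/2` is a
    -- root of `χ`. This bounds `d` uniformly in the frozen variables `w`.
    set χ := (torusPullback (S := S) lam hlam).charpoly with hχ
    have hfin : {d : ℕ | χ.eval (2 ^ d / 2) = 0}.Finite := by
      have h0 : χ ≠ 0 := (LinearMap.charpoly_monic _).ne_zero
      refine (χ.rootSet_finite ℂ).preimage (f := fun d : ℕ => (2 : ℂ) ^ d / 2) ?_ |>.subset ?_
      · intro a _ b _ hab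
        have hab' : (2 : ℂ) ^ a = 2 ^ b := by
          have : (2 : ℂ) ^ a / 2 = 2 ^ b / 2 := hab
          field_simp at this
          exact this
        have : (2 : ℕ) ^ a = 2 ^ b := by exact_mod_cast hab'
        exact Nat.pow_right_injective le_rfl this
      · intro d hd
        rw [Set.mem_preimage, Polynomial.mem_rootSet]
        exact ⟨h0, by simpa [Polynomial.coe_aeval_eq_eval] using hd⟩
    obtain ⟨D, hD⟩ := hfin.bddAbove
    refine ⟨D + 1, fun w d hd => ?_⟩
    have h1 := taylorFunctional_aeval k i hlam h2 w d χ s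
    rw [hχ, LinearMap.aeval_self_charpoly, LinearMap.zero_apply, map_zero, ← hχ] at h1
    refine (mul_eq_zero.1 h1.symm).resolve_left fun h => ?_
    have := hD h
    omega
  choose D hD using hD
  refine exists_mvPolynomial_of_separately (D := Finset.univ.sup D) _ fun i w => ?_
  exact exists_polynomial_of_iteratedDeriv (differentiable_section_update s k i w)
    fun d hd => hD i w d ((Finset.le_sup (Finset.mem_univ i)).trans hd)

/-! ### Weights and monomial sections. -/

variable (S) in
/-- The weights of the torus on the anticanonical sections. -/
def weights : Set (Fin n → ℤ) := {m | ∀ k i, Matrix.mulVec (S.gen k) m i ≤ 1}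

theorem vecMul_chartExponents (k : Fin S.numCones) (b m : Fin n → ℤ) :
    Matrix.vecMul b (S.chartExponents k) = m ↔ b = -Matrix.mulVec (S.gen k) m := by
  rw [chartExponents, Matrix.vecMul_neg, Matrix.vecMul_transpose]
  constructor
  · rintro rfl
    rw [Matrix.mulVec_neg, Matrix.mulVec_mulVec, Matrix.mul_nonsing_inv _ (S.smooth k),
      Matrix.one_mulVec, neg_neg]
  · rintro rfl
    rw [Matrix.mulVec_neg, Matrix.mulVec_mulVec, Matrix.nonsing_inv_mul _ (S.smooth k),
      Matrix.one_mulVec, neg_neg]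

theorem laurentMonomial_chartPoint (k : Fin S.numCones) (m : Fin n → ℤ) {z : Fin n → ℂ}
    (hz : ∀ i, z i ≠ 0) :
    laurentMonomial (-Matrix.mulVec (S.gen k) m) (S.chartPoint k z) = laurentMonomial m z := by
  rw [chartPoint, laurentMonomial_monomialMap _ _ hz, (S.vecMul_chartExponents k _ m).2 rfl]

/-- The section with weight `m` in the chart `k`. -/
noncomputable def monomialCoeff (m : Fin n → ℤ) (k : Fin S.numCones) (w : Fin n → ℂ) : ℂ :=
  S.chartSign k * ∏ j, w j ^ (1 - Matrix.mulVec (S.gen k) m j).toNat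

theorem torusCoeff_prod_pow (k : Fin S.numCones) (a : Fin n → ℕ) {z : Fin n → ℂ}
    (hz : ∀ i, z i ≠ 0) : S.torusCoeff k (fun w => ∏ j, w j ^ a j) z =
      S.chartSign k * laurentMonomial (fun j => (a j : ℤ) - 1) (S.chartPoint k z) := by
  rw [torusCoeff, mul_div_assoc, laurentMonomial, ← Finset.prod_div_distrib]
  congr 1
  refine Finset.prod_congr rfl fun j _ => ?_
  rw [zpow_sub_one₀ (S.chartPoint_ne_zero k hz j), zpow_natCast, div_eq_mul_inv]

/-- The exponent of `w_j` is `-⟨m, u_j⟩` from the character plus `1` from the frame. For a weight it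
is non-negative, so `toNat` loses nothing, and the two chart signs multiply to `1`. -/
theorem torusCoeff_monomialCoeff {m : Fin n → ℤ} (hm : m ∈ S.weights) (k : Fin S.numCones)
    {z : Fin n → ℂ} (hz : ∀ i, z i ≠ 0) :
    S.torusCoeff k (monomialCoeff m k) z = laurentMonomial m z := by
  have h := torusCoeff_prod_pow k (fun j => (1 - Matrix.mulVec (S.gen k) m j).toNat) hz
  have h2 : (fun j => (((1 - Matrix.mulVec (S.gen k) m j).toNat : ℕ) : ℤ) - 1) =
      -Matrix.mulVec (S.gen k) m := by
    funext j
    have := hm k j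
    rw [Pi.neg_apply, Int.toNat_of_nonneg (by omega)]
    ring
  rw [h2, laurentMonomial_chartPoint k m hz] at h
  have h3 : S.torusCoeff k (monomialCoeff m k) z = S.chartSign k * S.torusCoeff k
      (fun w => ∏ j, w j ^ (1 - Matrix.mulVec (S.gen k) m j).toNat) z := by
    simp only [torusCoeff, monomialCoeff]; ring
  rw [h3, h, ← mul_assoc, chartSign_mul_self, one_mul]

theorem differentiable_monomialCoeff (m : Fin n → ℤ) (k : Fin S.numCones) :
    Differentiable ℂ (monomialCoeff m k) := by
  unfold monomialCoeff
  fun_prop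

/-- The anticanonical section with weight `m`. -/
noncomputable def monomialSection (m : S.weights) : S.Sections :=
  toSection (monomialCoeff m.1) (differentiable_monomialCoeff m.1) fun k l z hz => by
    rw [torusCoeff_monomialCoeff m.2 k hz, torusCoeff_monomialCoeff m.2 l hz]

theorem monomialSection_apply (m : S.weights) (k : Fin S.numCones) :
    (monomialSection m).1 (S.chart k) = monomialCoeff m.1 k :=
  toSection_apply _ _ _ k

theorem section_sum_apply {ι : Type*} (A : Finset ι) (a : ι → ℂ) (s : ι → S.Sections)
    (e : atlas (Fin n → ℂ) S.ToricManifold) (w : Fin n → ℂ) :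
    (∑ i ∈ A, a i • s i).1 e w = ∑ i ∈ A, a i * (s i).1 e w := by
  rw [AddSubmonoidClass.coe_finsetSum, Finset.sum_apply, Finset.sum_apply]
  rfl

theorem torusCoeff_section_sum {ι : Type*} (A : Finset ι) (a : ι → ℂ) (s : ι → S.Sections)
    (k : Fin S.numCones) (z : Fin n → ℂ) :
    S.torusCoeff k ((∑ i ∈ A, a i • s i).1 (S.chart k)) z =
      ∑ i ∈ A, a i * S.torusCoeff k ((s i).1 (S.chart k)) z := by
  rw [torusCoeff, section_sum_apply, Finset.mul_sum, Finset.sum_div]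
  refine Finset.sum_congr rfl fun i _ => ?_
  rw [torusCoeff]; ring

/-- Monomial sections of distinct weights are linearly independent, so a finite-dimensional space
leaves room for only finitely many. -/
theorem finite_weights [Module.Finite ℂ S.Sections] : S.weights.Finite := by
  classical
  have : LinearIndependent ℂ (monomialSection (S := S)) := by
    rw [linearIndependent_iff']
    intro A g h m hm
    have h2 := laurentMonomial_independent (A.map (Function.Embedding.subtype _))
      (fun m => if h : m ∈ S.weights then g ⟨m, h⟩ else 0) (fun z hz => by
        have h3 := torusCoeff_section_sum A g monomialSection S.exists_cone.some z
        rw [h] at h3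
        rw [Finset.sum_map]
        simp only [monomialSection_apply] at h3
        have h4 : S.torusCoeff S.exists_cone.some
            ((0 : S.Sections).1 (S.chart S.exists_cone.some)) z = 0 := by
          change _ * (0 : ℂ) / _ = 0
          simp
        rw [h4] at h3
        rw [h3]
        refine Finset.sum_congr rfl fun m _ => ?_
        rw [torusCoeff_monomialCoeff m.2 _ hz]
        simp) m.1 (by simpa using hm)
    simpa using h2
  have := this.finite
  exact Set.toFinite _

/-- The Laurent expansion of a section in a chart. -/
theorem exists_laurent_chart [Module.Finite ℂ S.Sections] (s : S.Sections) (k : Fin S.numCones) :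
    ∃ (A : Finset (Fin n → ℤ)) (c : (Fin n → ℤ) → ℂ),
      (∀ m, c m ≠ 0 → m ∈ A ∧ ∀ i, Matrix.mulVec (S.gen k) m i ≤ 1) ∧
      ∀ z : Fin n → ℂ, (∀ i, z i ≠ 0) →
        S.torusCoeff k (s.1 (S.chart k)) z = ∑ m ∈ A, c m * laurentMonomial m z := by
  classical
  obtain ⟨p, hp⟩ := exists_mvPolynomial_section k s
  -- The weight of the chart monomial `w^a`: by `he`, `a i - 1 = -⟨u_i, m⟩`, so `a i ≥ 0` is exactly
  -- the inequality `⟨u_i, m⟩ ≤ 1`.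
  let e : (Fin n →₀ ℕ) → Fin n → ℤ := fun a =>
    Matrix.vecMul (fun j => (a j : ℤ) - 1) (S.chartExponents k)
  have he : ∀ a, (fun j => (a j : ℤ) - 1) = -Matrix.mulVec (S.gen k) (e a) := fun a =>
    (S.vecMul_chartExponents k _ _).1 rfl
  have hinj : Function.Injective e := by
    intro a b hab
    have h := (he a).trans (hab ▸ (he b).symm)
    ext j
    have : (a j : ℤ) - 1 = b j - 1 := congrFun h j
    omega
  refine ⟨p.support.image e, fun m => if h : ∃ a ∈ p.support, e a = m then
    S.chartSign k * p.coeff h.choose else 0, fun m hm => ?_, fun z hz => ?_⟩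
  · by_cases h : ∃ a ∈ p.support, e a = m
    · obtain ⟨a, ha, rfl⟩ := h
      refine ⟨Finset.mem_image_of_mem _ ha, fun i => ?_⟩
      have := congrFun (he a) i
      simp only [Pi.neg_apply] at this
      omega
    · exact absurd (dif_neg h) hm
  · rw [Finset.sum_image hinj.injOn]
    have h1 : S.torusCoeff k (s.1 (S.chart k)) z =
        ∑ a ∈ p.support, p.coeff a * S.torusCoeff k (fun w => ∏ j, w j ^ a j) z := by
      rw [torusCoeff, hp, MvPolynomial.eval_eq', Finset.mul_sum, Finset.sum_div]
      refine Finset.sum_congr rfl fun a _ => ?_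
      rw [torusCoeff]; ring
    rw [h1]
    refine Finset.sum_congr rfl fun a ha => ?_
    have h : ∃ b ∈ p.support, e b = e a := ⟨a, ha, rfl⟩
    have h2 : (if h : ∃ b ∈ p.support, e b = e a then S.chartSign k * p.coeff h.choose else 0) =
        S.chartSign k * p.coeff a := by
      rw [dif_pos h, hinj h.choose_spec.2]
    dsimp only
    rw [h2, torusCoeff_prod_pow k _ hz, he a,
      laurentMonomial_chartPoint k _ hz]
    ring

/-- The Laurent expansion of a section. -/
theorem exists_laurent [Module.Finite ℂ S.Sections] (s : S.Sections) :
    ∃ c : (Fin n → ℤ) → ℂ, ∀ k, ∀ z : Fin n → ℂ, (∀ i, z i ≠ 0) →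
      S.torusCoeff k (s.1 (S.chart k)) z =
        ∑ m ∈ (finite_weights (S := S)).toFinset, c m * laurentMonomial m z := by
  classical
  choose A c hc hsum using exists_laurent_chart s
  set k₀ := S.exists_cone.some
  have hext : ∀ k (B : Finset (Fin n → ℤ)), A k ⊆ B → ∀ z : Fin n → ℂ, (∀ i, z i ≠ 0) →
      S.torusCoeff k (s.1 (S.chart k)) z = ∑ m ∈ B, c k m * laurentMonomial m z := by
    intro k B hB z hz
    rw [hsum k z hz]
    refine Finset.sum_subset hB fun m _ hm => ?_
    by_contra h
    exact hm (hc k m (left_ne_zero_of_mul h)).1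
  -- All charts expand the same function on the torus, so independence of characters identifies the
  -- coefficients. Adjoining `{m}` covers the indices outside both supports.
  have heq : ∀ k m, c k m = c k₀ m := by
    intro k m
    have h := laurentMonomial_independent (A k ∪ A k₀ ∪ {m}) (fun m => c k m - c k₀ m)
      (fun z hz => by
        simp only [sub_mul, Finset.sum_sub_distrib]
        rw [← hext k _ (by grind) z hz, ← hext k₀ _ (by grind) z hz, torusCoeff_section s k k₀ hz,
          sub_self]) m (by simp)
    exact sub_eq_zero.1 h
  refine ⟨c k₀, fun k z hz => ?_⟩
  rw [torusCoeff_section s k k₀ hz,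
    hext k₀ (A k₀ ∪ (finite_weights (S := S)).toFinset) Finset.subset_union_left z hz]
  symm
  refine Finset.sum_subset Finset.subset_union_right fun m _ hm => ?_
  by_contra h
  -- A non-zero coefficient is non-zero in the expansion of every chart, hence its exponent
  -- satisfies the inequalities of every cone.
  refine hm ((finite_weights (S := S)).mem_toFinset.2 fun l => ?_)
  refine (hc l m ?_).2
  rw [heq]
  exact left_ne_zero_of_mul h

end SmoothCompleteFan

/-! ## The normalized anticanonical polytope -/

namespace SmoothCompleteFan

variable {n : ℕ} {S : SmoothCompleteFan n} {v : Fin n → ℤ}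

theorem mem_anticanonicalPolytope_iff (J : Fin n → ℤ) :
    (fun i => (J i : ℝ)) ∈ S.anticanonicalPolytope v ↔ J - v ∈ S.weights := by
  have h : ∀ k i, ∑ j, ((J j : ℝ) - v j) * (S.gen k i j : ℝ) ≤ 1 ↔
      Matrix.mulVec (S.gen k) (J - v) i ≤ 1 := by
    intro k i
    have : ∑ j, ((J j : ℝ) - v j) * (S.gen k i j : ℝ) =
        ((Matrix.mulVec (S.gen k) (J - v) i : ℤ) : ℝ) := by
      simp [Matrix.mulVec, dotProduct, mul_comm]
    rw [this]
    exact_mod_cast Iff.rfl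
  simp only [anticanonicalPolytope, weights, Set.mem_ofPred_eq, h]

theorem nonneg_of_mem_hull_single {x : Fin n → ℝ}
    (hx : x ∈ PointedCone.hull ℝ (Set.range fun i => (Pi.single i 1 : Fin n → ℝ))) (i : Fin n) :
    0 ≤ x i := by
  induction hx using Submodule.span_induction with
  | mem x h =>
    obtain ⟨j, rfl⟩ := h
    simp only [Pi.single_apply]
    split_ifs <;> norm_num
  | zero => simp
  | add x y _ _ hx hy => exact add_nonneg hx hy
  | smul c x _ hx => exact mul_nonneg c.2 hx

theorem nonneg_of_mem_anticanonicalPolytope (hnorm : IsNormalizedAtOrigin (S.anticanonicalPolytope v))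
    {x : Fin n → ℝ} (hx : x ∈ S.anticanonicalPolytope v) (i : Fin n) : 0 ≤ x i :=
  nonneg_of_mem_hull_single (hnorm.2 ▸ Submodule.subset_span hx) i

/-- The translation that normalizes the anticanonical polytope is by `(1, …, 1)`. -/
theorem translation_eq_one (hnorm : IsNormalizedAtOrigin (S.anticanonicalPolytope v)) (i : Fin n) :
    v i = 1 := by
  have h0 : ∀ k l, -1 ≤ ∑ j, v j * S.gen k l j := by
    intro k l
    have h := hnorm.1.1 k l
    have h2 : (∑ j, ((0 : Fin n → ℝ) j - v j) * (S.gen k l j : ℝ)) =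
        ((-∑ j, v j * S.gen k l j : ℤ) : ℝ) := by
      simp
    rw [h2] at h
    have : -∑ j, v j * S.gen k l j ≤ 1 := by exact_mod_cast h
    linarith
  -- A constraint active at the origin becomes homogeneous, so it holds on the whole cone spanned by
  -- the polytope, in particular at each `e_j`.
  have hactive : ∀ k l, ∑ j, v j * S.gen k l j = -1 → ∀ j, S.gen k l j ≤ 0 := by
    intro k l hkl j
    have h1 : ∀ x ∈ PointedCone.hull ℝ (S.anticanonicalPolytope v),
        ∑ j, x j * (S.gen k l j : ℝ) ≤ 0 := by
      intro x hx
      induction hx using Submodule.span_induction with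
      | mem x h =>
        have h2 := h k l
        have h3 : (∑ j, (v j : ℝ) * S.gen k l j) = -1 := by exact_mod_cast hkl
        simp only [sub_mul, Finset.sum_sub_distrib] at h2
        linarith
      | zero => simp
      | add x y _ _ hx hy =>
        simp only [Pi.add_apply, add_mul, Finset.sum_add_distrib]
        linarith
      | smul c x _ hx =>
        have : ∑ j, (c • x) j * (S.gen k l j : ℝ) = (c : ℝ) * ∑ j, x j * (S.gen k l j : ℝ) := by
          rw [Finset.mul_sum]
          refine Finset.sum_congr rfl fun j _ => ?_
          change (c : ℝ) * x j * _ = _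
          ring
        rw [this]
        exact mul_nonpos_of_nonneg_of_nonpos c.2 hx
    have h2 := h1 (Pi.single j 1) (by
      rw [hnorm.2]
      exact Submodule.subset_span ⟨j, rfl⟩)
    simp only [Pi.single_apply, ite_mul, one_mul, zero_mul, Finset.sum_ite_eq',
      Finset.mem_univ, if_true] at h2
    exact_mod_cast h2
  set T : ℤ := ∑ k, ∑ l, ∑ j, |S.gen k l j| with hT
  have hTle : ∀ k l j, |S.gen k l j| ≤ T := by
    intro k l j
    have h1 := Finset.single_le_sum (f := fun j => |S.gen k l j|) (fun j _ => abs_nonneg _)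
      (Finset.mem_univ j)
    have h2 := Finset.single_le_sum (f := fun l => ∑ j, |S.gen k l j|)
      (fun l _ => Finset.sum_nonneg fun j _ => abs_nonneg _) (Finset.mem_univ l)
    have h3 := Finset.single_le_sum (f := fun k => ∑ l, ∑ j, |S.gen k l j|)
      (fun k _ => Finset.sum_nonneg fun l _ => Finset.sum_nonneg fun j _ => abs_nonneg _)
      (Finset.mem_univ k)
    exact (h1.trans h2).trans h3
  -- This vector is outside the cone generated by the `e_j`, so some active constraint excludes it.
  -- The entry `T`, which bounds all entries of all generators, will force that constraint to be the
  -- facet `x_i ≥ 0`.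
  set x : Fin n → ℤ := Function.update (fun _ => T) i (-1) with hx
  have hex : ∃ k l, ∑ j, v j * S.gen k l j = -1 ∧ 0 < ∑ j, x j * S.gen k l j := by
    by_contra! hcon
    -- If no active constraint excluded `x`, then `x / M` would lie in the polytope: by integrality
    -- an inactive constraint has slack at least `1` at the origin, and `⟨x, u⟩ ≤ M`. But its `i`-th
    -- coordinate is negative.
    set M : ℝ := 1 + ∑ k, ∑ l, |∑ j, (x j : ℝ) * S.gen k l j| with hM
    have hM0 : 0 < M := by positivity
    have hmem : (fun j => M⁻¹ * (x j : ℝ)) ∈ S.anticanonicalPolytope v := by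
      intro k l
      have h1 : ∑ j, (M⁻¹ * (x j : ℝ) - v j) * (S.gen k l j : ℝ) =
          M⁻¹ * ∑ j, (x j : ℝ) * S.gen k l j - ∑ j, (v j : ℝ) * S.gen k l j := by
        simp only [sub_mul, Finset.sum_sub_distrib, Finset.mul_sum, mul_assoc]
      rw [h1]
      rcases (h0 k l).eq_or_lt with h | h
      · have h2 : (∑ j, (x j : ℝ) * S.gen k l j) ≤ 0 := by exact_mod_cast hcon k l h.symm
        have h3 : (∑ j, (v j : ℝ) * S.gen k l j) = -1 := by exact_mod_cast h.symm
        have := mul_nonpos_of_nonneg_of_nonpos (inv_nonneg.2 hM0.le) h2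
        linarith
      · have h3 : 0 ≤ (∑ j, (v j : ℝ) * S.gen k l j) := by
          have : 0 ≤ ∑ j, v j * S.gen k l j := by omega
          exact_mod_cast this
        have h4 : (∑ j, (x j : ℝ) * S.gen k l j) ≤ M := by
          have h5 := Finset.single_le_sum (f := fun l => |∑ j, (x j : ℝ) * S.gen k l j|)
            (fun l _ => abs_nonneg _) (Finset.mem_univ l)
          have h6 := Finset.single_le_sum (f := fun k => ∑ l, |∑ j, (x j : ℝ) * S.gen k l j|)
            (fun k _ => Finset.sum_nonneg fun l _ => abs_nonneg _) (Finset.mem_univ k)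
          have h7 := le_abs_self (∑ j, (x j : ℝ) * S.gen k l j)
          linarith
        have h8 : M⁻¹ * (∑ j, (x j : ℝ) * S.gen k l j) ≤ 1 := by
          rw [inv_mul_le_iff₀ hM0]
          linarith
        linarith
    have h2 := nonneg_of_mem_anticanonicalPolytope hnorm hmem i
    have hxi : x i = -1 := by simp [hx]
    rw [hxi] at h2
    have : 0 < M⁻¹ := inv_pos.2 hM0
    push_cast at h2
    linarith
  obtain ⟨k, l, hv, hpos⟩ := hex
  have hsplit : ∑ j, x j * S.gen k l j =
      -S.gen k l i + ∑ j ∈ Finset.univ.erase i, T * S.gen k l j := by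
    rw [← Finset.add_sum_erase _ _ (Finset.mem_univ i)]
    congr 1
    · simp [hx]
    · refine Finset.sum_congr rfl fun j hj => ?_
      rw [hx, Function.update_of_ne (Finset.ne_of_mem_erase hj)]
  have hT0 : 0 ≤ T := (abs_nonneg _).trans (hTle k l i)
  -- All entries of `u` are non-positive; one entry `≤ -1` with `j ≠ i` would give `⟨x, u⟩ ≤ |u_i| -
  -- T ≤ 0`.
  have hzero : ∀ j, j ≠ i → S.gen k l j = 0 := by
    intro j hj
    by_contra hne
    have h1 : S.gen k l j ≤ -1 := by have := hactive k l hv j; omega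
    have h2 : ∑ j ∈ Finset.univ.erase i, T * S.gen k l j ≤ T * S.gen k l j := by
      rw [← Finset.add_sum_erase _ _ (Finset.mem_erase.2 ⟨hj, Finset.mem_univ j⟩)]
      have := Finset.sum_nonpos (s := (Finset.univ.erase i).erase j)
        fun j' (_ : j' ∈ _) => mul_nonpos_of_nonneg_of_nonpos hT0 (hactive k l hv j')
      linarith
    have h3 := hTle k l i
    have h4 := neg_abs_le (S.gen k l i)
    nlinarith
  rw [Finset.sum_eq_single i (fun j _ hj => by rw [hzero j hj, mul_zero]) (by simp)] at hv
  have hneg : S.gen k l i ≤ 0 := hactive k l (by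
    rw [Finset.sum_eq_single i (fun j _ hj => by rw [hzero j hj, mul_zero]) (by simp), hv]) i
  -- What remains is `v_i u_i = -1` in the integers with `u_i ≤ 0`.
  have hu : IsUnit (v i) := IsUnit.of_mul_eq_one (-S.gen k l i) (by linarith)
  rcases Int.isUnit_iff.1 hu with h | h
  · exact h
  · rw [h] at hv
    omega

end SmoothCompleteFan

/-! ## The potential of a projectively induced metric -/

namespace SmoothCompleteFan

variable {n : ℕ} {S : SmoothCompleteFan n} {ι : Type*} [Fintype ι]

/-- The potential `∑ |t_j|²` in the chart `k`. -/
noncomputable def sectionNormSq (t : ι → S.Sections) (k : Fin S.numCones) (w : Fin n → ℂ) : ℝ :=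
  ∑ j, ‖(t j).1 (S.chart k) w‖ ^ 2

/-- The potential `∑ |t_j|²` on the torus. -/
noncomputable def torusNormSq (t : ι → S.Sections) (z : Fin n → ℂ) : ℝ :=
  ∑ j, ‖S.torusCoeff S.exists_cone.some ((t j).1 (S.chart S.exists_cone.some)) z‖ ^ 2

theorem torusNormSq_eq (t : ι → S.Sections) (k : Fin S.numCones) {z : Fin n → ℂ}
    (hz : ∀ i, z i ≠ 0) :
    torusNormSq t z = ∑ j, ‖S.torusCoeff k ((t j).1 (S.chart k)) z‖ ^ 2 := by
  simp only [torusNormSq, torusCoeff_section _ S.exists_cone.some k hz]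

theorem sectionNormSq_chartPoint (t : ι → S.Sections) (k : Fin S.numCones) {z : Fin n → ℂ}
    (hz : ∀ i, z i ≠ 0) : sectionNormSq t k (S.chartPoint k z) =
      (∏ j, ‖S.chartPoint k z j‖ ^ 2) * torusNormSq t z := by
  rw [torusNormSq_eq t k hz, sectionNormSq, Finset.mul_sum]
  refine Finset.sum_congr rfl fun j _ => ?_
  rw [S.apply_chartPoint k ((t j).1 (S.chart k)) hz, norm_mul, norm_mul, norm_chartSign, norm_prod,
    Finset.prod_pow]
  ring

theorem sectionNormSq_pos {t : ι → S.Sections} {k : Fin S.numCones} {w : Fin n → ℂ}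
    (h : ∃ j, (t j).1 (S.chart k) w ≠ 0) : 0 < sectionNormSq t k w := by
  obtain ⟨j, hj⟩ := h
  exact Finset.sum_pos' (fun j _ => by positivity) ⟨j, Finset.mem_univ j, by positivity⟩

theorem sectionNormSq_glueMap (t : ι → S.Sections) {k l : Fin S.numCones} {z : Fin n → ℂ}
    (hz : z ∈ S.glueDomain k l) : sectionNormSq t l (S.glueMap k l z) =
      ‖(complexJacobian (S.glueMap k l) z).det‖ ^ 2 * sectionNormSq t k z := by
  simp only [sectionNormSq, section_glueMap _ hz, norm_mul, mul_pow, Finset.mul_sum]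

theorem contDiff_section [Module.Finite ℂ S.Sections] (s : S.Sections) (k : Fin S.numCones)
    {r : WithTop ℕ∞} : ContDiff ℂ r (s.1 (S.chart k)) := by
  obtain ⟨p, hp⟩ := exists_mvPolynomial_section k s
  rw [funext hp]
  exact contDiff_iff_contDiffAt.2 fun x =>
    (AnalyticOnNhd.eval_mvPolynomial p x (Set.mem_univ x)).contDiffAt

theorem contDiff_sectionNormSq [Module.Finite ℂ S.Sections] (t : ι → S.Sections)
    (k : Fin S.numCones) {r : WithTop ℕ∞} : ContDiff ℝ r (sectionNormSq t k) :=
  ContDiff.sum fun j _ => ((contDiff_section (t j) k).restrict_scalars ℝ).norm_sq ℝ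

theorem norm_chartPoint_circle (k : Fin S.numCones) (θ : Fin n → Circle) (j : Fin n) :
    ‖S.chartPoint k (fun i => (θ i : ℂ)) j‖ = 1 := by
  rw [chartPoint, monomialMap, norm_prod]
  exact Finset.prod_eq_one fun i _ => by rw [norm_zpow, Circle.norm_coe, one_zpow]

/-- A rotation acts on the sections by a fixed matrix in the basis `t`, and Cauchy–Schwarz bounds
the rotated potential by its squared entries; the added `1` keeps the constant positive. This
supplies the boundedness for Liouville's theorem. -/
theorem exists_sectionNormSq_le (t : Module.Basis ι ℂ S.Sections) (k : Fin S.numCones)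
    (θ : Fin n → Circle) : ∃ C : ℝ, 0 < C ∧ ∀ w,
      sectionNormSq t k (S.chartPoint k (fun i => (θ i : ℂ)) * w) ≤ C * sectionNormSq t k w := by
  have hθ : ∀ i, ((θ i : Circle) : ℂ) ≠ 0 := fun i => (θ i).coe_ne_zero
  set T := torusPullback (S := S) (fun i => (θ i : ℂ)) hθ
  set a : ι → ι → ℂ := fun j i => t.repr (T (t j)) i
  refine ⟨1 + ∑ j, ∑ i, ‖a j i‖ ^ 2, by positivity, fun w => ?_⟩
  have h1 : ∀ j, ‖(t j).1 (S.chart k) (S.chartPoint k (fun i => (θ i : ℂ)) * w)‖ ^ 2 ≤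
      (∑ i, ‖a j i‖ ^ 2) * sectionNormSq t k w := by
    intro j
    have h2 := torusPullback_apply _ hθ (t j) k w
    have h3 : (T (t j)).1 (S.chart k) w = ∑ i, a j i * (t i).1 (S.chart k) w := by
      rw [← section_sum_apply, t.sum_repr]
    have h4 : ‖(t j).1 (S.chart k) (S.chartPoint k (fun i => (θ i : ℂ)) * w)‖ =
        ‖∑ i, a j i * (t i).1 (S.chart k) w‖ := by
      rw [← h3, h2, norm_mul, norm_inv, norm_prod,
        Finset.prod_congr rfl fun j _ => norm_chartPoint_circle k θ j]
      simp
    rw [h4]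
    have h5 : ‖∑ i, a j i * (t i).1 (S.chart k) w‖ ≤
        ∑ i, ‖a j i‖ * ‖(t i).1 (S.chart k) w‖ :=
      (norm_sum_le _ _).trans_eq (Finset.sum_congr rfl fun i _ => norm_mul _ _)
    exact (pow_le_pow_left₀ (norm_nonneg _) h5 2).trans (Finset.sum_mul_sq_le_sq_mul_sq _ _ _)
  have h2 := Finset.sum_le_sum fun j (_ : j ∈ Finset.univ) => h1 j
  rw [← Finset.sum_mul] at h2
  have h3 : 0 ≤ sectionNormSq t k w := Finset.sum_nonneg fun j _ => by positivity
  refine h2.trans ?_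
  nlinarith

theorem torusAction_affineChart (lam : Fin n → ℂˣ) (k : Fin S.numCones) (z : Fin n → ℂ) :
    S.torusAction lam (S.affineChart k z) =
      S.affineChart k (S.chartPoint k (fun i => (lam i : ℂ)) * z) := rfl

variable (S) in
/-- The sections `t` induce the metric `g`. -/
def Induces (t : ι → S.Sections) (g : KahlerMetric n S.ToricManifold) : Prop :=
  ∀ k w, 0 < sectionNormSq t k w ∧
    g.coeff (S.chart k) w = complexHessian (fun w => Real.log (sectionNormSq t k w)) w

variable {g : KahlerMetric n S.ToricManifold}

/-- The potential of an invariant metric is invariant under the real torus. -/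
theorem sectionNormSq_circle_mul (t : Module.Basis ι ℂ S.Sections) (ht : S.Induces t g)
    (htoric : ∀ θ : Fin n → Circle, g.IsInvariant (S.torusAction fun i => (θ i).toUnits))
    (k : Fin S.numCones) (θ : Fin n → Circle) (w : Fin n → ℂ) :
    sectionNormSq t k (S.chartPoint k (fun i => (θ i : ℂ)) * w) = sectionNormSq t k w := by
  have : Module.Finite ℂ S.Sections := Module.Finite.of_basis t
  set D : Fin n → ℂ := S.chartPoint k (fun i => (θ i : ℂ)) with hD
  have hlog : ContDiff ℝ 2 fun w => Real.log (sectionNormSq t k w) :=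
    (contDiff_sectionNormSq _ k).log fun w => (ht k w).1.ne'
  have hmul : ContDiff ℂ 2 fun w : Fin n → ℂ => D * w := contDiff_const.mul contDiff_id
  have hlogD : ContDiff ℝ 2 fun w => Real.log (sectionNormSq t k (D * w)) :=
    hlog.comp (hmul.restrict_scalars ℝ)
  have hinv : ∀ z, complexHessian (fun w => Real.log (sectionNormSq t k (D * w))) z =
      complexHessian (fun w => Real.log (sectionNormSq t k w)) z := by
    intro z
    rw [complexHessian_comp (f := fun w => Real.log (sectionNormSq t k w))
      (φ := fun w => D * w) hmul.contDiffAt hlog.contDiffAt, ← (ht k z).2, ← (ht k _).2]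
    have hact : ∀ z, S.torusAction (fun i => (θ i).toUnits) ((S.chart k).1.symm z) =
        S.affineChart k (D * z) := by
      intro z
      rw [chart_symm, torusAction_affineChart]
      rfl
    have h := htoric θ (S.chart k) (S.chart k) z (by rw [chart_target]; trivial) (by
      rw [hact]; exact S.affineChart_mem_chart_source k _)
    simpa only [KahlerMetric.pullback, hact, chart_affineChart] using h
  obtain ⟨C, hC0, hC⟩ := exists_sectionNormSq_le t k θ
  obtain ⟨C', hC'0, hC'⟩ := exists_sectionNormSq_le t k θ⁻¹
  have hDD : ∀ w, S.chartPoint k (fun i => ((θ⁻¹ i : Circle) : ℂ)) * (D * w) = w := by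
    intro w
    rw [← mul_assoc, hD, ← chartPoint_mul]
    have : (fun i => ((θ⁻¹ i : Circle) : ℂ)) * (fun i => ((θ i : Circle) : ℂ)) = 1 := by
      funext i
      simp
    rw [this]
    have : S.chartPoint k 1 = 1 := by
      funext j
      simp [chartPoint, monomialMap]
    rw [this, one_mul]
  -- The comparison for `θ` bounds the difference of logarithms above, the one for `θ⁻¹` bounds it
  -- below. The constant is its value at `0`, which is zero because `D * 0 = 0`.
  have hconst := eq_of_bounded_of_complexHessian_eq_zero
    (p := fun w => Real.log (sectionNormSq t k (D * w)) - Real.log (sectionNormSq t k w))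
    (hlogD.sub hlog) (fun z => by
      rw [complexHessian_sub hlogD.contDiffAt hlog.contDiffAt, hinv, sub_self])
    (C := |Real.log C| + |Real.log C'|) (fun z => by
      have h1 := Real.log_le_log (ht k _).1 (hC z)
      have h2 := hC' (D * z)
      rw [hDD] at h2
      replace h2 := Real.log_le_log (ht k _).1 h2
      rw [Real.log_mul hC0.ne' (ht k _).1.ne'] at h1
      rw [Real.log_mul hC'0.ne' (ht k _).1.ne'] at h2
      have h3 := le_abs_self (Real.log C)
      have h4 := le_abs_self (Real.log C')
      have h5 := abs_nonneg (Real.log C)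
      have h6 := abs_nonneg (Real.log C')
      rw [abs_le]
      constructor <;> linarith) w
  simp only [mul_zero, sub_self] at hconst
  exact Real.log_injOn_pos (ht k _).1 (ht k _).1 (sub_eq_zero.1 hconst)

theorem torusNormSq_circle_mul (t : Module.Basis ι ℂ S.Sections) (ht : S.Induces t g)
    (htoric : ∀ θ : Fin n → Circle, g.IsInvariant (S.torusAction fun i => (θ i).toUnits))
    (θ : Fin n → Circle) {z : Fin n → ℂ} (hz : ∀ i, z i ≠ 0) :
    torusNormSq t ((fun i => (θ i : ℂ)) * z) = torusNormSq t z := by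
  set k := S.exists_cone.some
  have h := sectionNormSq_circle_mul t ht htoric k θ (S.chartPoint k z)
  have hθz : ∀ i, ((fun i => (θ i : ℂ)) * z) i ≠ 0 := fun i =>
    mul_ne_zero (θ i).coe_ne_zero (hz i)
  rw [← chartPoint_mul, sectionNormSq_chartPoint _ _ hz, sectionNormSq_chartPoint _ _ hθz] at h
  simp only [chartPoint_mul, Pi.mul_apply, norm_mul, norm_chartPoint_circle, one_mul] at h
  refine mul_left_cancel₀ ?_ h
  exact Finset.prod_ne_zero_iff.2 fun j _ =>
    pow_ne_zero 2 (norm_ne_zero_iff.2 (S.chartPoint_ne_zero k hz j))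

/-- The potential of an invariant metric is diagonal in the basis of characters. -/
theorem exists_torusNormSq_eq_sum (t : Module.Basis ι ℂ S.Sections) (ht : S.Induces t g)
    (htoric : ∀ θ : Fin n → Circle, g.IsInvariant (S.torusAction fun i => (θ i).toUnits)) :
    ∃ (hW : S.weights.Finite) (a : (Fin n → ℤ) → ℝ), (∀ m ∈ S.weights, 0 < a m) ∧
      ∀ z : Fin n → ℂ, (∀ i, z i ≠ 0) →
        torusNormSq t z = ∑ m ∈ hW.toFinset, a m * ‖laurentMonomial m z‖ ^ 2 := by
  classical
  have : Module.Finite ℂ S.Sections := Module.Finite.of_basis t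
  choose c hc using exists_laurent (S := S)
  set W := (finite_weights (S := S)).toFinset with hW
  set k := S.exists_cone.some
  -- The Gram matrix of the Laurent coefficients; its diagonal will be the coefficients of `F`.
  set G : (Fin n → ℤ) × (Fin n → ℤ) → ℂ := fun p =>
    ∑ j, c (t j) p.1 * (starRingEnd ℂ) (c (t j) p.2) with hG
  have hexp : ∀ z : Fin n → ℂ, (∀ i, z i ≠ 0) → (torusNormSq t z : ℂ) = ∑ p ∈ W ×ˢ W,
      G p * (laurentMonomial p.1 z * (starRingEnd ℂ) (laurentMonomial p.2 z)) := by
    intro z hz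
    have h1 : ∀ j, ((‖S.torusCoeff k ((t j).1 (S.chart k)) z‖ ^ 2 : ℝ) : ℂ) =
        ∑ p ∈ W ×ˢ W, c (t j) p.1 * (starRingEnd ℂ) (c (t j) p.2) *
          (laurentMonomial p.1 z * (starRingEnd ℂ) (laurentMonomial p.2 z)) := by
      intro j
      rw [hc (t j) k z hz, Complex.ofReal_pow, ← Complex.mul_conj', map_sum,
        Finset.sum_mul_sum, Finset.sum_product]
      refine Finset.sum_congr rfl fun m _ => Finset.sum_congr rfl fun m' _ => ?_
      rw [map_mul]
      ring
    rw [torusNormSq_eq t k hz, Complex.ofReal_sum]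
    simp only [h1, hG, Finset.sum_mul]
    exact Finset.sum_comm
  -- Rotating `z_i` by `exp(πi/d)`, with `d = m i - m' i`, multiplies `z^m z̄^m'` by `-1`, so
  -- invariance gives `-2 G = 0` at this pair.
  have hoff : ∀ p ∈ W ×ˢ W, p.1 ≠ p.2 → G p = 0 := by
    rintro ⟨m, m'⟩ hp hne
    obtain ⟨i, hi⟩ := Function.ne_iff.1 hne
    dsimp only at hi
    set d : ℤ := m i - m' i with hd
    have hd0 : (d : ℂ) ≠ 0 := by
      have : d ≠ 0 := by omega
      exact_mod_cast this
    set u : Circle := Circle.exp (Real.pi / d) with hu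
    set θ : Fin n → Circle := Function.update 1 i u with hθ
    have hθu : (fun j => (θ j : ℂ)) = Function.update (1 : Fin n → ℂ) i (u : ℂ) := by
      funext j
      by_cases hj : j = i
      · subst hj; simp [hθ]
      · simp [hθ, hj]
    have h1 := hermitianMonomial_independent (W ×ˢ W)
      (fun p => G p * (laurentMonomial p.1 (fun j => (θ j : ℂ)) *
        (starRingEnd ℂ) (laurentMonomial p.2 (fun j => (θ j : ℂ))) - 1)) (fun z hz => by
        have h2 := congrArg Complex.ofReal (torusNormSq_circle_mul t ht htoric θ hz)
        have hθz : ∀ i, ((fun i => (θ i : ℂ)) * z) i ≠ 0 := fun i =>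
          mul_ne_zero (θ i).coe_ne_zero (hz i)
        rw [hexp z hz, hexp _ hθz] at h2
        rw [← sub_eq_zero, ← Finset.sum_sub_distrib] at h2
        rw [← h2]
        refine Finset.sum_congr rfl fun p _ => ?_
        rw [laurentMonomial_mul_arg, laurentMonomial_mul_arg, map_mul]
        ring) (m, m') hp
    refine (mul_eq_zero.1 h1).resolve_right ?_
    rw [hθu, laurentMonomial_update_one, laurentMonomial_update_one, map_zpow₀,
      ← Circle.coe_inv_eq_conj, Circle.coe_inv, inv_zpow', ← zpow_add₀ u.coe_ne_zero,
      ← sub_eq_add_neg]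
    have h3 : (u : ℂ) ^ d = -1 := by
      rw [hu, Circle.coe_exp, ← Complex.exp_int_mul, ← Complex.exp_pi_mul_I]
      congr 1
      push_cast
      field_simp
    rw [← hd, h3]
    norm_num
  refine ⟨finite_weights, fun m => ∑ j, ‖c (t j) m‖ ^ 2, fun m hm => ?_, fun z hz => ?_⟩
  -- If the coefficient at `m` vanished for every `t_j`, it would vanish for every section, whereas
  -- the monomial section of weight `m` has coefficient `1`.
  · by_contra hcon
    have h0 : ∀ j, c (t j) m = 0 := by
      intro j
      have h1 : ∑ j, ‖c (t j) m‖ ^ 2 = 0 :=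
        le_antisymm (not_lt.1 hcon) (Finset.sum_nonneg fun j _ => by positivity)
      have := (Finset.sum_eq_zero_iff_of_nonneg (fun j _ => by positivity)).1 h1 j
        (Finset.mem_univ j)
      simpa using this
    set b := t.repr (monomialSection ⟨m, hm⟩)
    have h1 := laurentMonomial_independent W
      (fun l => (if l = m then 1 else 0) - ∑ j, b j * c (t j) l) (fun z hz => by
        have h2 := torusCoeff_section_sum Finset.univ b t k z
        rw [t.sum_repr, monomialSection_apply, torusCoeff_monomialCoeff hm k hz] at h2
        simp only [hc _ k z hz, Finset.mul_sum] at h2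
        rw [Finset.sum_comm] at h2
        simp only [sub_mul, Finset.sum_sub_distrib, Finset.sum_mul, mul_assoc]
        rw [← h2]
        simp [hm, W]) m (by simpa [hW] using hm)
    simp [h0] at h1
  · apply Complex.ofReal_injective
    rw [hexp z hz, Finset.sum_product, Complex.ofReal_sum]
    refine Finset.sum_congr rfl fun m hm => ?_
    rw [Finset.sum_eq_single m]
    · simp only [hG, Complex.mul_conj']
      push_cast
      ring
    · intro m' hm' hne
      rw [hoff (m, m') (Finset.mem_product.2 ⟨hm, hm'⟩) hne.symm, zero_mul]
    · exact fun h => absurd hm h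

end SmoothCompleteFan

/-! ## The logarithmic potential on the torus -/

theorem evalAbsSq_eq_sum {n : ℕ} (F : MvPolynomial (Fin n) ℝ) (z : Fin n → ℂ) :
    evalAbsSq F z = ∑ I ∈ F.support, F.coeff I * ∏ i, (‖z i‖ ^ 2) ^ I i :=
  MvPolynomial.eval_eq' _ _

theorem HasPositiveSupport.pos_iff {n : ℕ} {F : MvPolynomial (Fin n) ℝ} {P : Set (Fin n → ℝ)}
    (hF : HasPositiveSupport F P) (I : Fin n →₀ ℕ) :
    0 < F.coeff I ↔ (fun i => ((I i : ℤ) : ℝ)) ∈ P := by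
  have h : (fun i => (I i : ℤ)) ∈ {J : Fin n → ℤ | (fun i => (J i : ℝ)) ∈ P} ↔
      (fun i => ((I i : ℤ) : ℝ)) ∈ P := Iff.rfl
  rw [← h, ← hF.2]
  constructor
  · exact fun h => ⟨I, h, rfl⟩
  · rintro ⟨I', h', hI⟩
    have : I' = I := by
      ext i
      have h1 : (I' i : ℤ) = I i := congrFun hI i
      exact_mod_cast h1
    exact this ▸ h'

theorem HasPositiveSupport.mem_support_iff {n : ℕ} {F : MvPolynomial (Fin n) ℝ}
    {P : Set (Fin n → ℝ)} (hF : HasPositiveSupport F P) (I : Fin n →₀ ℕ) :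
    I ∈ F.support ↔ (fun i => ((I i : ℤ) : ℝ)) ∈ P := by
  rw [← hF.pos_iff, MvPolynomial.mem_support_iff]
  exact ⟨fun h => lt_of_le_of_ne (hF.1 I) h.symm, fun h => h.ne'⟩

theorem HasPositiveSupport.evalAbsSq_pos {n : ℕ} {F : MvPolynomial (Fin n) ℝ}
    {P : Set (Fin n → ℝ)} (hF : HasPositiveSupport F P) (h0 : 0 ∈ P) (z : Fin n → ℂ) :
    0 < evalAbsSq F z := by
  have hc : 0 < F.coeff 0 := (hF.pos_iff 0).2 (by simpa using! h0)
  rw [evalAbsSq_eq_sum]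
  refine Finset.sum_pos' (fun I _ => mul_nonneg (hF.1 I) (by positivity)) ⟨0, ?_, by simpa using hc⟩
  exact MvPolynomial.mem_support_iff.2 hc.ne'

/-- The supports coincide and all monomials are non-negative at `|z_i|²`, so it is enough to compare
the coefficients one by one. -/
theorem HasPositiveSupport.exists_evalAbsSq_le {n : ℕ} {F G : MvPolynomial (Fin n) ℝ}
    {P : Set (Fin n → ℝ)} (hF : HasPositiveSupport F P) (hG : HasPositiveSupport G P) :
    ∃ C : ℝ, 0 < C ∧ ∀ z, evalAbsSq F z ≤ C * evalAbsSq G z := by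
  have hs : F.support = G.support := by
    ext I
    rw [hF.mem_support_iff, hG.mem_support_iff]
  have hpos : ∀ I ∈ G.support, 0 < G.coeff I := fun I hI =>
    (hG.pos_iff I).2 ((hG.mem_support_iff I).1 hI)
  have hnn : ∀ I ∈ G.support, 0 ≤ F.coeff I / G.coeff I := fun I _ => div_nonneg (hF.1 I) (hG.1 I)
  refine ⟨1 + ∑ I ∈ G.support, F.coeff I / G.coeff I,
    add_pos_of_pos_of_nonneg one_pos (Finset.sum_nonneg hnn), fun z => ?_⟩
  rw [evalAbsSq_eq_sum, evalAbsSq_eq_sum, hs, Finset.mul_sum]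
  refine Finset.sum_le_sum fun I hI => ?_
  rw [← mul_assoc]
  refine mul_le_mul_of_nonneg_right ?_ (by positivity)
  rw [← div_le_iff₀ (hpos I hI)]
  have := Finset.single_le_sum hnn hI
  linarith

/-- Two polynomials with the same support that have the same complex Hessian on the torus are
proportional. -/
theorem exists_evalAbsSq_eq_mul {n : ℕ} {F G : MvPolynomial (Fin n) ℝ} {P : Set (Fin n → ℝ)}
    (hF : HasPositiveSupport F P) (hG : HasPositiveSupport G P) (h0 : 0 ∈ P)
    (h : ∀ z : Fin n → ℂ, (∀ i, z i ≠ 0) → complexHessian (fun w => Real.log (evalAbsSq F w)) z =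
      complexHessian (fun w => Real.log (evalAbsSq G w)) z) :
    ∃ κ : ℝ, 0 < κ ∧ ∀ z, evalAbsSq F z = κ * evalAbsSq G z := by
  have hFp := hF.evalAbsSq_pos h0
  have hGp := hG.evalAbsSq_pos h0
  have hFc : ContDiff ℝ 2 fun w => Real.log (evalAbsSq F w) :=
    (contDiff_evalAbsSq F).log fun z => (hFp z).ne'
  have hGc : ContDiff ℝ 2 fun w => Real.log (evalAbsSq G w) :=
    (contDiff_evalAbsSq G).log fun z => (hGp z).ne'
  have hH : complexHessian (fun w => Real.log (evalAbsSq F w)) =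
      complexHessian (fun w => Real.log (evalAbsSq G w)) :=
    Continuous.ext_on dense_torus (continuous_complexHessian hFc) (continuous_complexHessian hGc)
      fun z hz => h z hz
  obtain ⟨C, hC0, hC⟩ := hF.exists_evalAbsSq_le hG
  obtain ⟨C', hC'0, hC'⟩ := hG.exists_evalAbsSq_le hF
  -- The constant terms make both polynomials positive on all of `ℂⁿ`, so the logarithm of the
  -- quotient is a globally defined bounded function, pluriharmonic by density of the torus.
  have hconst := eq_of_bounded_of_complexHessian_eq_zero
    (p := fun w => Real.log (evalAbsSq F w) - Real.log (evalAbsSq G w)) (hFc.sub hGc)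
    (fun z => by rw [complexHessian_sub hFc.contDiffAt hGc.contDiffAt, hH, sub_self])
    (C := |Real.log C| + |Real.log C'|) (fun z => by
      have h1 := Real.log_le_log (hFp z) (hC z)
      have h2 := Real.log_le_log (hGp z) (hC' z)
      rw [Real.log_mul hC0.ne' (hGp z).ne'] at h1
      rw [Real.log_mul hC'0.ne' (hFp z).ne'] at h2
      have h3 := le_abs_self (Real.log C)
      have h4 := le_abs_self (Real.log C')
      have h5 := abs_nonneg (Real.log C)
      have h6 := abs_nonneg (Real.log C')
      rw [abs_le]
      constructor <;> linarith)
  refine ⟨evalAbsSq F 0 / evalAbsSq G 0, div_pos (hFp 0) (hGp 0), fun z => ?_⟩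
  have h1 := hconst z
  rw [← Real.log_div (hFp z).ne' (hGp z).ne', ← Real.log_div (hFp 0).ne' (hGp 0).ne'] at h1
  have h2 := Real.log_injOn_pos (div_pos (hFp z) (hGp z)) (div_pos (hFp 0) (hGp 0)) h1
  rw [← h2, div_mul_cancel₀ _ (hGp z).ne']

namespace SmoothCompleteFan

variable {n : ℕ} {S : SmoothCompleteFan n} {ι : Type*} [Fintype ι] {v : Fin n → ℤ}
  {g : KahlerMetric n S.ToricManifold}

theorem chart_torusEmbedding (k : Fin S.numCones) {z : Fin n → ℂ} (hz : ∀ i, z i ≠ 0) :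
    (S.chart k).1 (S.torusEmbedding z) = S.chartPoint k z := by
  rw [S.torusEmbedding_eq k hz, chart_affineChart]; rfl

theorem pullback_torusEmbedding (g : KahlerMetric n S.ToricManifold) (k : Fin S.numCones)
    {z : Fin n → ℂ} (hz : ∀ i, z i ≠ 0) : g.pullback S.torusEmbedding (S.chart k) z =
      pullbackMatrix (S.chartPoint k) z (g.coeff (S.chart k) (S.chartPoint k z)) := by
  have h : (fun w => (S.chart k).1 (S.torusEmbedding w)) =ᶠ[nhds z] S.chartPoint k := by
    filter_upwards [isOpen_torus.mem_nhds hz] with w hw using S.chart_torusEmbedding k hw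
  simp only [KahlerMetric.pullback, pullbackMatrix, complexJacobian, h.fderiv_eq,
    chart_torusEmbedding k hz]

theorem prod_norm_sq_pos {z : Fin n → ℂ} (hz : ∀ i, z i ≠ 0) : 0 < ∏ i, ‖z i‖ ^ 2 :=
  Finset.prod_pos fun i _ => pow_pos (norm_pos_iff.2 (hz i)) 2

theorem torusNormSq_pos {t : ι → S.Sections} (ht : S.Induces t g) {z : Fin n → ℂ}
    (hz : ∀ i, z i ≠ 0) : 0 < torusNormSq t z := by
  have h := (ht S.exists_cone.some (S.chartPoint S.exists_cone.some z)).1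
  rw [sectionNormSq_chartPoint t _ hz] at h
  exact pos_of_mul_pos_right h (prod_norm_sq_pos (S.chartPoint_ne_zero _ hz)).le

theorem log_norm_chartPoint (k : Fin S.numCones) {z : Fin n → ℂ} (hz : ∀ i, z i ≠ 0) (j : Fin n) :
    Real.log ‖S.chartPoint k z j‖ = ∑ i, S.chartExponents k j i * Real.log ‖z i‖ := by
  rw [chartPoint, monomialMap, norm_prod, Real.log_prod fun i _ =>
    norm_ne_zero_iff.2 (zpow_ne_zero _ (hz i))]
  refine Finset.sum_congr rfl fun i _ => ?_
  rw [norm_zpow, Real.log_zpow]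

/-- The function on the left and the potential of the chart `k`, pulled back to the torus, differ by
a Laurent monomial in the `|z_i|²`, whose logarithm is pluriharmonic. -/
theorem complexHessian_log_torusNormSq [Module.Finite ℂ S.Sections] {t : ι → S.Sections}
    (ht : S.Induces t g) (k : Fin S.numCones) {z : Fin n → ℂ} (hz : ∀ i, z i ≠ 0) :
    complexHessian (fun w => Real.log ((∏ i, ‖w i‖ ^ 2) * torusNormSq t w)) z =
      pullbackMatrix (S.chartPoint k) z (g.coeff (S.chart k) (S.chartPoint k z)) := by
  have hcp : ContDiffAt ℂ 2 (S.chartPoint k) z := (contDiffAt_monomialMap _ hz).of_le (by simp)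
  have hlog : ContDiff ℝ 2 fun w => Real.log (sectionNormSq t k w) :=
    (contDiff_sectionNormSq _ k).log fun w => (ht k w).1.ne'
  have hlogcp : ContDiffAt ℝ 2 (fun w => Real.log (sectionNormSq t k (S.chartPoint k w))) z :=
    hlog.contDiffAt.comp z (hcp.restrict_scalars ℝ)
  have hn : ∀ i, ContDiffAt ℝ 2 (fun w : Fin n → ℂ => Real.log (‖w i‖ ^ 2)) z := fun i =>
    ((contDiff_apply (𝕜 := ℝ) (E := ℂ) (n := 2) i).norm_sq ℝ).contDiffAt.log
      (pow_ne_zero 2 (norm_ne_zero_iff.2 (hz i)))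
  have h : (fun w => Real.log ((∏ i, ‖w i‖ ^ 2) * torusNormSq t w)) =ᶠ[nhds z]
      fun w => Real.log (sectionNormSq t k (S.chartPoint k w)) +
        ∑ i, (1 - ∑ j, (S.chartExponents k j i : ℝ)) * Real.log (‖w i‖ ^ 2) := by
    filter_upwards [isOpen_torus.mem_nhds hz] with w hw
    rw [sectionNormSq_chartPoint t k hw,
      Real.log_mul (prod_norm_sq_pos hw).ne' (torusNormSq_pos ht hw).ne',
      Real.log_mul (prod_norm_sq_pos (S.chartPoint_ne_zero k hw)).ne' (torusNormSq_pos ht hw).ne',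
      Real.log_prod fun i _ => pow_ne_zero 2 (norm_ne_zero_iff.2 (hw i)),
      Real.log_prod fun i _ => pow_ne_zero 2 (norm_ne_zero_iff.2 (S.chartPoint_ne_zero k hw i))]
    simp only [Real.log_pow, log_norm_chartPoint k hw, sub_mul, Finset.sum_sub_distrib,
      Finset.sum_mul, Finset.mul_sum, one_mul]
    rw [Finset.sum_comm (f := fun i j => (S.chartExponents k j i : ℝ) *
      (((2 : ℕ) : ℝ) * Real.log ‖w i‖))]
    have : ∀ i j, ((2 : ℕ) : ℝ) * ((S.chartExponents k i j : ℝ) * Real.log ‖w j‖) =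
        (S.chartExponents k i j : ℝ) * (((2 : ℕ) : ℝ) * Real.log ‖w j‖) := fun i j => by ring
    simp only [this]
    ring
  rw [complexHessian_congr h, complexHessian_add hlogcp
    (ContDiffAt.sum fun i _ => contDiffAt_const.mul (hn i)),
    complexHessian_sum _ fun i _ => contDiffAt_const.mul (hn i)]
  have hzero : ∀ i, complexHessian (fun w : Fin n → ℂ =>
      (1 - ∑ j, (S.chartExponents k j i : ℝ)) * Real.log (‖w i‖ ^ 2)) z = 0 := fun i => by
    rw [complexHessian_const_mul _ (hn i), complexHessian_log_norm_sq (hz i), smul_zero]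
  simp only [hzero, Finset.sum_const_zero, add_zero]
  rw [complexHessian_comp (f := fun w => Real.log (sectionNormSq t k w)) hcp hlog.contDiffAt,
    ← (ht k _).2]

/-- A toric projectively induced metric has a potential that is the logarithm of a polynomial. -/
theorem exists_polynomial_potential (hnorm : IsNormalizedAtOrigin (S.anticanonicalPolytope v))
    (t : Module.Basis ι ℂ S.Sections) (ht : S.Induces t g)
    (htoric : ∀ θ : Fin n → Circle, g.IsInvariant (S.torusAction fun i => (θ i).toUnits)) :
    ∃ F : MvPolynomial (Fin n) ℝ, HasPositiveSupport F (S.anticanonicalPolytope v) ∧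
      IsLogPotential g F ∧ ∀ z : Fin n → ℂ, (∀ i, z i ≠ 0) →
        evalAbsSq F z = (∏ i, ‖z i‖ ^ 2) * torusNormSq t z := by
  classical
  have : Module.Finite ℂ S.Sections := Module.Finite.of_basis t
  obtain ⟨hW, a, ha, hsum⟩ := exists_torusNormSq_eq_sum t ht htoric
  have hv := translation_eq_one hnorm
  have hmem : ∀ m : Fin n → ℤ, m ∈ S.weights ↔
      (fun i => ((m i + 1 : ℤ) : ℝ)) ∈ S.anticanonicalPolytope v := by
    intro m
    rw [mem_anticanonicalPolytope_iff]
    have : (fun i => m i + 1) - v = m := by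
      funext i
      simp [hv i]
    rw [this]
  have hnn : ∀ m ∈ S.weights, ∀ i, 0 ≤ m i + 1 := fun m hm i => by
    exact_mod_cast nonneg_of_mem_anticanonicalPolytope hnorm ((hmem m).1 hm) i
  -- The shift by `v = (1, …, 1)` carries the weights to the lattice points of the polytope; these
  -- lie in the positive orthant, so `toNat` is exact.
  let e : (Fin n → ℤ) → Fin n →₀ ℕ := fun m => Finsupp.equivFunOnFinite.symm fun i => (m i + 1).toNat
  have he : ∀ m ∈ S.weights, ∀ i, ((e m i : ℕ) : ℤ) = m i + 1 := fun m hm i =>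
    Int.toNat_of_nonneg (hnn m hm i)
  set F : MvPolynomial (Fin n) ℝ := ∑ m ∈ hW.toFinset, MvPolynomial.monomial (e m) (a m) with hF
  have hcoeff : ∀ I, F.coeff I = ∑ m ∈ hW.toFinset, if e m = I then a m else 0 := fun I => by
    simp only [hF, MvPolynomial.coeff_sum, MvPolynomial.coeff_monomial]
  have hFnn : ∀ m ∈ hW.toFinset, ∀ I, 0 ≤ if e m = I then a m else 0 := fun m hm I => by
    have := ha m (by simpa using hm)
    split_ifs <;> linarith
  have heval : ∀ z : Fin n → ℂ, (∀ i, z i ≠ 0) →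
      evalAbsSq F z = (∏ i, ‖z i‖ ^ 2) * torusNormSq t z := by
    intro z hz
    rw [hsum z hz, hF, evalAbsSq, map_sum, Finset.mul_sum]
    refine Finset.sum_congr rfl fun m hm => ?_
    rw [MvPolynomial.eval_monomial, Finsupp.prod_fintype _ _ (fun i => pow_zero _),
      laurentMonomial, norm_prod, ← Finset.prod_pow, mul_left_comm, ← Finset.prod_mul_distrib]
    congr 1
    refine Finset.prod_congr rfl fun i _ => ?_
    have h0 : ‖z i‖ ≠ 0 := norm_ne_zero_iff.2 (hz i)
    rw [norm_zpow, ← zpow_natCast (‖z i‖ ^ 2), he m (by simpa using hm), zpow_add_one₀ (by positivity),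
      ← zpow_natCast (‖z i‖ ^ m i), ← zpow_natCast ‖z i‖, ← zpow_mul, ← zpow_mul]
    rw [mul_comm, mul_comm (m i)]
  refine ⟨F, ⟨fun I => ?_, ?_⟩, ?_, heval⟩
  · rw [hcoeff]
    exact Finset.sum_nonneg fun m hm => hFnn m hm I
  · ext J
    constructor
    · rintro ⟨I, hI, rfl⟩
      rw [Set.mem_ofPred_eq, hcoeff] at hI
      obtain ⟨m, hm, hmI⟩ := Finset.exists_ne_zero_of_sum_ne_zero hI.ne'
      have hmI' : e m = I := by
        by_contra h
        exact hmI (if_neg h)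
      have hmW : m ∈ S.weights := by simpa using hm
      have h := (hmem m).1 hmW
      rw [Set.mem_ofPred_eq, ← hmI']
      simpa only [he m hmW] using h
    · intro hJ
      have hJ' : (fun i => J i - 1) ∈ S.weights := (hmem _).2 (by simpa using! hJ)
      refine ⟨e fun i => J i - 1, ?_, funext fun i => (he _ hJ' i).trans (by ring)⟩
      rw [Set.mem_ofPred_eq, hcoeff]
      exact Finset.sum_pos' (fun m hm => hFnn m hm _)
        ⟨fun i => J i - 1, by simpa using hJ', by simpa using ha _ hJ'⟩
  · intro z hz e _
    obtain ⟨k, rfl⟩ := S.exists_chart_eq e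
    rw [pullback_torusEmbedding g k hz, ← complexHessian_log_torusNormSq ht k hz]
    refine (complexHessian_congr ?_).symm
    filter_upwards [isOpen_torus.mem_nhds hz] with w hw
    rw [heval w hw]

end SmoothCompleteFan

/-! ## Kähler–Einstein metrics -/

namespace SmoothCompleteFan

variable {n : ℕ} {S : SmoothCompleteFan n} {ι : Type*} [Fintype ι] {v : Fin n → ℤ}
  {g : KahlerMetric n S.ToricManifold}

/-- The toric manifold of a complete fan is covered by the unit polydiscs of the charts. -/
theorem exists_norm_chartPoint_le (z : Fin n → ℂ) (hz : ∀ i, z i ≠ 0) :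
    ∃ k, ∀ j, ‖S.chartPoint k z j‖ ≤ 1 := by
  -- Take a cone containing `(log |z_1|, …, log |z_n|)`. Since `⟨m_j, u_i⟩ = -δ_{ij}`, the chart
  -- exponents are non-positive on it, which means `log |w_j| ≤ 0`.
  obtain ⟨k, hk⟩ := S.complete fun i => Real.log ‖z i‖
  refine ⟨k, fun j => ?_⟩
  have key : ∀ y ∈ realCone (Set.range (S.gen k)),
      ∑ i, (S.chartExponents k j i : ℝ) * y i ≤ 0 := by
    intro y hy
    induction hy using Submodule.span_induction with
    | mem y h =>
      obtain ⟨_, ⟨i, rfl⟩, rfl⟩ := h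
      have h1 : S.chartExponents k * (S.gen k).transpose = -1 := by
        rw [chartExponents, Matrix.neg_mul, ← Matrix.transpose_mul,
          Matrix.mul_nonsing_inv _ (S.smooth k), Matrix.transpose_one]
      have h2 : ∑ q, S.chartExponents k j q * S.gen k i q = (-1 : Matrix (Fin n) (Fin n) ℤ) j i := by
        rw [← h1, Matrix.mul_apply]
        rfl
      have h3 : ∑ q, S.chartExponents k j q * S.gen k i q ≤ 0 := by
        rw [h2, Matrix.neg_apply, Matrix.one_apply]
        split_ifs <;> norm_num
      change ∑ q, (S.chartExponents k j q : ℝ) * (S.gen k i q : ℝ) ≤ 0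
      exact_mod_cast h3
    | zero => simp
    | add x y _ _ hx hy =>
      simp only [Pi.add_apply, mul_add, Finset.sum_add_distrib]
      linarith
    | smul c x _ hx =>
      have : ∑ i, (S.chartExponents k j i : ℝ) * (c • x) i =
          (c : ℝ) * ∑ i, (S.chartExponents k j i : ℝ) * x i := by
        rw [Finset.mul_sum]
        refine Finset.sum_congr rfl fun i _ => ?_
        change _ * ((c : ℝ) * x i) = _
        ring
      rw [this]
      exact mul_nonpos_of_nonneg_of_nonpos c.2 hx
  have h := key _ hk
  rw [← log_norm_chartPoint k hz] at h
  exact (Real.log_nonpos_iff (norm_nonneg _)).1 h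

/-- A continuous function on the toric manifold has a maximum. -/
theorem exists_isMax {f : Fin S.numCones → (Fin n → ℂ) → ℝ} (hc : ∀ k, Continuous (f k))
    (hf : ∀ k l, ∀ z : Fin n → ℂ, (∀ i, z i ≠ 0) →
      f k (S.chartPoint k z) = f l (S.chartPoint l z)) :
    ∃ k w, ∀ l w', f l w' ≤ f k w := by
  have : Nonempty (Fin S.numCones) := S.exists_cone
  have h1 : ∀ k, ∃ w ∈ Metric.closedBall (0 : Fin n → ℂ) 1,
      IsMaxOn (f k) (Metric.closedBall (0 : Fin n → ℂ) 1) w := fun k =>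
    (isCompact_closedBall _ _).exists_isMaxOn ⟨0, by simp⟩ (hc k).continuousOn
  choose w _ hmax using h1
  obtain ⟨k, hk⟩ := Finite.exists_max fun k => f k (w k)
  refine ⟨k, w k, fun l w' => ?_⟩
  -- The best of the finitely many polydisc maxima dominates `f` on the torus, which the polydiscs
  -- cover, and then everywhere by density.
  have hcl : IsClosed {w' | f l w' ≤ f k (w k)} := isClosed_le (hc l) continuous_const
  have hsub : {z : Fin n → ℂ | ∀ i, z i ≠ 0} ⊆ {w' | f l w' ≤ f k (w k)} := by
    intro x hx
    obtain ⟨z, hz, rfl⟩ := S.exists_chartPoint_eq l hx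
    obtain ⟨p, hp⟩ := S.exists_norm_chartPoint_le z hz
    have h2 : S.chartPoint p z ∈ Metric.closedBall (0 : Fin n → ℂ) 1 := by
      rw [mem_closedBall_zero_iff]
      exact (pi_norm_le_iff_of_nonneg zero_le_one).2 hp
    change f l _ ≤ _
    rw [hf l p z hz]
    exact (hmax p h2).trans (hk p)
  have := closure_minimal hsub hcl
  rw [dense_torus.closure_eq] at this
  exact this (Set.mem_univ w')

/-! ### The volume ratio and the Einstein condition. -/

theorem contDiff_coeff_det (g : KahlerMetric n S.ToricManifold) (k : Fin S.numCones) :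
    ContDiff ℝ 2 fun w => (g.coeff (S.chart k) w).det.re := by
  have h : ∀ i j, ContDiff ℝ 2 fun w => g.coeff (S.chart k) w i j := fun i j => by
    have := g.smooth (S.chart k) i j
    rw [chart_target, contDiffOn_univ] at this
    exact contDiff_infty.1 this 2
  have hdet : ContDiff ℝ 2 fun w => (g.coeff (S.chart k) w).det := by
    simp only [Matrix.det_apply']
    exact ContDiff.sum fun σ _ => contDiff_const.mul (contDiff_prod fun i _ => h _ _)
  exact Complex.reCLM.contDiff.comp hdet

theorem coeff_det_pos (g : KahlerMetric n S.ToricManifold) (k : Fin S.numCones) (w : Fin n → ℂ) :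
    0 < (g.coeff (S.chart k) w).det.re :=
  (Complex.lt_def.1 (g.posDef (S.chart k) w (by rw [chart_target]; trivial)).det_pos).1

theorem coeff_det_eq (g : KahlerMetric n S.ToricManifold) (k : Fin S.numCones) (w : Fin n → ℂ) :
    (g.coeff (S.chart k) w).det = ((g.coeff (S.chart k) w).det.re : ℂ) := by
  have h := (Complex.lt_def.1
    (g.posDef (S.chart k) w (by rw [chart_target]; trivial)).det_pos).2
  exact Complex.ext rfl (by simpa using h.symm)

/-- The ratio of the volume form of the metric to the one defined by the sections. -/
noncomputable def volumeRatio (g : KahlerMetric n S.ToricManifold) (t : ι → S.Sections)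
    (k : Fin S.numCones) (w : Fin n → ℂ) : ℝ :=
  (g.coeff (S.chart k) w).det.re * sectionNormSq t k w

theorem volumeRatio_pos {t : ι → S.Sections} (ht : S.Induces t g) (k : Fin S.numCones)
    (w : Fin n → ℂ) : 0 < volumeRatio g t k w :=
  mul_pos (coeff_det_pos g k w) (ht k w).1

theorem contDiff_volumeRatio [Module.Finite ℂ S.Sections] (g : KahlerMetric n S.ToricManifold)
    (t : ι → S.Sections) (k : Fin S.numCones) : ContDiff ℝ 2 (volumeRatio g t k) :=
  (contDiff_coeff_det g k).mul (contDiff_sectionNormSq t k)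

/-- Under a change of chart `det g` and `∑ |t_j|²` are multiplied by inverse powers of the same
`|Jacobian|²`, so the product descends to the manifold. -/
theorem volumeRatio_chartPoint (t : ι → S.Sections) (k l : Fin S.numCones) {z : Fin n → ℂ}
    (hz : ∀ i, z i ≠ 0) :
    volumeRatio g t k (S.chartPoint k z) = volumeRatio g t l (S.chartPoint l z) := by
  have hmem := S.mem_glueDomain_of_ne_zero k l (S.chartPoint_ne_zero k hz)
  have h := g.compat (S.chart k) (S.chart l) (S.chartPoint k z) (by rwa [transition_source])
  rw [pullbackMatrix, transition_apply S hmem, complexJacobian_transition S hmem,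
    ← pullbackMatrix, S.glueMap_chartPoint k l hz] at h
  have h2 := congrArg (fun A => (Matrix.det A).re) h
  simp only [det_pullbackMatrix, Complex.re_ofReal_mul] at h2
  have h3 := sectionNormSq_glueMap t hmem
  rw [S.glueMap_chartPoint k l hz] at h3
  rw [volumeRatio, volumeRatio, h2, h3]
  ring

theorem complexHessian_log_volumeRatio [Module.Finite ℂ S.Sections] {t : ι → S.Sections}
    (ht : S.Induces t g) (k : Fin S.numCones) (w : Fin n → ℂ) :
    complexHessian (fun w => Real.log (volumeRatio g t k w)) w =
      g.coeff (S.chart k) w - g.ricci (S.chart k) w := by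
  have h1 : ContDiff ℝ 2 fun w => Real.log (g.coeff (S.chart k) w).det.re :=
    (contDiff_coeff_det g k).log
      fun w => (coeff_det_pos g k w).ne'
  have h2 : ContDiff ℝ 2 fun w => Real.log (sectionNormSq t k w) :=
    (contDiff_sectionNormSq _ k).log fun w => (ht k w).1.ne'
  have h3 : (fun w => Real.log (volumeRatio g t k w)) = fun w =>
      Real.log (g.coeff (S.chart k) w).det.re + Real.log (sectionNormSq t k w) :=
    funext fun w => Real.log_mul (coeff_det_pos g k w).ne' (ht k w).1.ne'
  rw [h3, complexHessian_add h1.contDiffAt h2.contDiffAt, ← (ht k w).2, KahlerMetric.ricci]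
  abel

/-- At a maximum of a function whose complex Hessian is a multiple of the metric, the factor is
not positive. -/
theorem nonpos_of_isMax (hn : 1 ≤ n) {k : Fin S.numCones} {f : (Fin n → ℂ) → ℝ} {w : Fin n → ℂ}
    (hf : ContDiff ℝ 2 f) (hw : ∀ w', f w' ≤ f w) {μ : ℝ}
    (hμ : complexHessian f w = (μ : ℂ) • g.coeff (S.chart k) w) : μ ≤ 0 := by
  have h := leviForm_self_re_nonpos_of_isMax hf hw (Pi.single ⟨0, hn⟩ 1)
  have h2 := complexHessian_apply hf.contDiffAt ⟨0, hn⟩ ⟨0, hn⟩ (z := w)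
  have h3 := (Complex.lt_def.1
    ((g.posDef (S.chart k) w (by rw [chart_target]; trivial)).diag_pos (i := ⟨0, hn⟩))).1
  rw [hμ, Matrix.smul_apply, smul_eq_mul] at h2
  have h4 := congrArg (fun x => (4 * x : ℂ).re) h2
  have h5 : (4 * ((1 / 4 : ℂ) * leviForm f w (Pi.single ⟨0, hn⟩ 1) (Pi.single ⟨0, hn⟩ 1))) =
      leviForm f w (Pi.single ⟨0, hn⟩ 1) (Pi.single ⟨0, hn⟩ 1) := by ring
  simp only [h5, Complex.mul_re, Complex.ofReal_re, Complex.ofReal_im, Complex.re_ofNat,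
    Complex.im_ofNat, zero_mul, sub_zero] at h4
  have h6 : (0 : ℂ).re = 0 := rfl
  rw [h6] at h3
  by_contra! hμ0
  have := mul_pos hμ0 h3
  linarith

/-- The complex Hessian of `log V` is `(1 - lam/2) g`. A maximum of `log V` gives `1 - lam/2 ≤ 0`
and a maximum of `-log V` the opposite inequality, so `log V` is pluriharmonic; its global extrema
bound it, and Liouville applies in each chart. -/
theorem volumeRatio_eq_of_isEinstein [Module.Finite ℂ S.Sections] (hn : 1 ≤ n) {t : ι → S.Sections}
    (ht : S.Induces t g) (hE : g.IsEinstein) (k : Fin S.numCones) (w : Fin n → ℂ) :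
    volumeRatio g t k w = volumeRatio g t k 0 := by
  obtain ⟨lam, hlam⟩ := hE
  have hpos := volumeRatio_pos ht
  have hcd : ∀ k, ContDiff ℝ 2 fun w => Real.log (volumeRatio g t k w) := fun k =>
    (contDiff_volumeRatio g t k).log fun w => (hpos k w).ne'
  have hH : ∀ k w, complexHessian (fun w => Real.log (volumeRatio g t k w)) w =
      ((1 - lam / 2 : ℝ) : ℂ) • g.coeff (S.chart k) w := by
    intro k w
    rw [complexHessian_log_volumeRatio ht, hlam (S.chart k) w (by rw [chart_target]; trivial)]
    push_cast
    rw [sub_smul, one_smul]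
  obtain ⟨k₁, w₁, h₁⟩ := exists_isMax (fun k => (hcd k).continuous)
    fun k l z hz => by rw [volumeRatio_chartPoint t k l hz]
  obtain ⟨k₂, w₂, h₂⟩ := exists_isMax (f := fun k w => -1 * Real.log (volumeRatio g t k w))
    (fun k => continuous_const.mul (hcd k).continuous)
    fun k l z hz => by rw [volumeRatio_chartPoint t k l hz]
  have hμ₁ := nonpos_of_isMax hn (hcd k₁) (fun w' => h₁ k₁ w') (hH k₁ w₁)
  have hμ₂ := nonpos_of_isMax (g := g) (k := k₂) hn (contDiff_const.mul (hcd k₂))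
    (fun w' => h₂ k₂ w') (μ := -(1 - lam / 2)) (by
      rw [complexHessian_const_mul _ (hcd k₂).contDiffAt, hH, smul_smul]
      push_cast
      ring_nf)
  have hμ : 1 - lam / 2 = 0 := by linarith
  have h := eq_of_bounded_of_complexHessian_eq_zero (hcd k) (fun z => by rw [hH, hμ]; simp)
    (C := |Real.log (volumeRatio g t k₁ w₁)| + |Real.log (volumeRatio g t k₂ w₂)|) (fun z => by
      have h3 := h₁ k z
      have h4 := h₂ k z
      have h5 := le_abs_self (Real.log (volumeRatio g t k₁ w₁))
      have h6 := neg_abs_le (Real.log (volumeRatio g t k₂ w₂))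
      have h7 := abs_nonneg (Real.log (volumeRatio g t k₁ w₁))
      have h8 := abs_nonneg (Real.log (volumeRatio g t k₂ w₂))
      rw [abs_le]
      constructor <;> linarith) w
  exact Real.log_injOn_pos (hpos k w) (hpos k 0) h

/-- A constant ratio makes `g - ricci` vanish, which is the Einstein equation with `lam = 2`. -/
theorem isEinstein_of_volumeRatio_eq [Module.Finite ℂ S.Sections] {t : ι → S.Sections}
    (ht : S.Induces t g) {c : ℝ} (hc : ∀ k w, volumeRatio g t k w = c) : g.IsEinstein := by
  refine ⟨2, fun e z _ => ?_⟩
  obtain ⟨k, rfl⟩ := S.exists_chart_eq e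
  have h := complexHessian_log_volumeRatio ht k z
  simp only [hc] at h
  have h0 : complexHessian (fun _ : Fin n → ℂ => Real.log c) z = 0 := by
    ext i j
    simp [complexHessian, wirtinger, wirtingerBar]
  rw [h0] at h
  rw [← sub_eq_zero.1 h.symm]
  simp

/-- The determinant of the Einstein matrix on the torus. -/
theorem det_einsteinMatrix_eq (hn : 1 ≤ n) {t : ι → S.Sections} {F : MvPolynomial (Fin n) ℝ}
    (hF : IsLogPotential g F) {κ : ℝ} {z : Fin n → ℂ} (hz : ∀ i, z i ≠ 0)
    (hFz : 0 < evalAbsSq F z)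
    (hκ : evalAbsSq F z = κ * ((∏ i, ‖z i‖ ^ 2) * torusNormSq t z)) (k : Fin S.numCones) :
    (einsteinMatrix F z).det =
      ((κ * volumeRatio g t k (S.chartPoint k z) * evalAbsSq F z ^ (2 * n - 1) : ℝ) : ℂ) := by
  have h := hF z hz (S.chart k) (by
    rw [S.torusEmbedding_eq k hz]
    exact S.affineChart_mem_chart_source k _)
  rw [pullback_torusEmbedding g k hz, complexHessian_log_evalAbsSq hFz.ne'] at h
  have h2 := congrArg Matrix.det h
  rw [det_pullbackMatrix, Matrix.det_smul, Fintype.card_fin, coeff_det_eq] at h2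
  -- The exponent matrix is unimodular, so only the quotient of the products of the coordinates
  -- survives in the modulus.
  have hJ : ‖(complexJacobian (S.chartPoint k) z).det‖ ^ 2 =
      (∏ j, ‖S.chartPoint k z j‖ ^ 2) / ∏ i, ‖z i‖ ^ 2 := by
    have h3 := det_complexJacobian_monomialMap (S.chartExponents k) hz
    change (complexJacobian (S.chartPoint k) z).det = S.chartSign k * (∏ j, S.chartPoint k z j) / _
      at h3
    rw [h3, norm_div, norm_mul, norm_chartSign, one_mul, div_pow, norm_prod, norm_prod,
      Finset.prod_pow, Finset.prod_pow]
  rw [hJ] at h2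
  have hFC : (evalAbsSq F z : ℂ) ≠ 0 := by exact_mod_cast hFz.ne'
  have h4 : (einsteinMatrix F z).det = ((evalAbsSq F z ^ (2 * n) *
      ((∏ j, ‖S.chartPoint k z j‖ ^ 2) / ∏ i, ‖z i‖ ^ 2) *
        (g.coeff (S.chart k) (S.chartPoint k z)).det.re : ℝ) : ℂ) := by
    rw [Complex.ofReal_mul, Complex.ofReal_mul, mul_assoc, h2]
    push_cast
    rw [← mul_assoc, pow_mul, ← mul_pow, mul_inv_cancel₀ (pow_ne_zero 2 hFC), one_pow, one_mul]
  rw [h4, volumeRatio, sectionNormSq_chartPoint t k hz]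
  congr 1
  -- The matrix `A / F²` contributes `F^(2n)` to `det A`. One factor `F` is replaced using `hκ`; it
  -- cancels `∏ |z_i|²` and turns `det g` into the volume ratio, leaving the exponent `2n - 1`.
  have h5 : 2 * n = (2 * n - 1) + 1 := by omega
  have h6 := (prod_norm_sq_pos hz).ne'
  rw [h5, pow_succ, Nat.add_sub_cancel]
  nth_rewrite 2 [hκ]
  field_simp

end SmoothCompleteFan

theorem KahlerMetric.IsProjectivelyInduced.exists_induces {n : ℕ} {S : SmoothCompleteFan n}
    {g : KahlerMetric n S.ToricManifold} (h : g.IsProjectivelyInduced) :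
    ∃ (N : ℕ) (t : Module.Basis (Fin (N + 1)) ℂ S.Sections), S.Induces t g := by
  obtain ⟨N, t, ht⟩ := h
  refine ⟨N, t, fun k w => ?_⟩
  have h := ht (S.chart k) w (by rw [S.chart_target]; trivial)
  exact ⟨SmoothCompleteFan.sectionNormSq_pos h.1, h.2⟩

open SmoothCompleteFan in
theorem lemma4p1 (n : ℕ) (hn : 1 ≤ n) (S : SmoothCompleteFan n) (v : Fin n → ℤ)
    (hnorm : IsNormalizedAtOrigin (S.anticanonicalPolytope v))
    (g : KahlerMetric n S.ToricManifold)
    (hproj : g.IsProjectivelyInduced)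
    (htoric : ∀ θ : Fin n → Circle, g.IsInvariant (S.torusAction fun i => (θ i).toUnits)) :
    (∃ F : MvPolynomial (Fin n) ℝ,
      HasPositiveSupport F (S.anticanonicalPolytope v) ∧ IsLogPotential g F) ∧
    ∀ F : MvPolynomial (Fin n) ℝ,
      HasPositiveSupport F (S.anticanonicalPolytope v) → IsLogPotential g F →
      (g.IsEinstein ↔ ∃ c : ℝ, 0 < c ∧ ∀ z : Fin n → ℂ,
        (einsteinMatrix F z).det = ((c * evalAbsSq F z ^ (2 * n - 1) : ℝ) : ℂ)) := by
  obtain ⟨N, t, ht⟩ := hproj.exists_induces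
  have : Module.Finite ℂ S.Sections := Module.Finite.of_basis t
  obtain ⟨F₀, hF₀, hg₀, hval⟩ := exists_polynomial_potential hnorm t ht htoric
  refine ⟨⟨F₀, hF₀, hg₀⟩, fun F hF hg => ?_⟩
  have h0 : (0 : Fin n → ℝ) ∈ S.anticanonicalPolytope v := hnorm.1.1
  have hmem : ∀ k, ∀ z : Fin n → ℂ, (∀ i, z i ≠ 0) →
      S.torusEmbedding z ∈ (S.chart k).1.source := fun k z hz => by
    rw [S.torusEmbedding_eq k hz]
    exact S.affineChart_mem_chart_source k _
  set k := S.exists_cone.some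
  -- An arbitrary admissible `F` is a multiple of the polynomial built from the sections, which
  -- links its determinant to the volume ratio.
  obtain ⟨κ, hκ, hFF⟩ := exists_evalAbsSq_eq_mul hF hF₀ h0 fun z hz =>
    (hg z hz (S.chart k) (hmem k z hz)).symm.trans (hg₀ z hz (S.chart k) (hmem k z hz))
  have hpos := hF.evalAbsSq_pos h0
  have hdet : ∀ z : Fin n → ℂ, (∀ i, z i ≠ 0) → ∀ k, (einsteinMatrix F z).det =
      ((κ * volumeRatio g t k (S.chartPoint k z) * evalAbsSq F z ^ (2 * n - 1) : ℝ) : ℂ) :=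
    fun z hz k => det_einsteinMatrix_eq hn hg hz (hpos z) (by rw [hFF, hval z hz]) k
  constructor
  · intro hE
    have hconst := volumeRatio_eq_of_isEinstein hn ht hE k
    refine ⟨κ * volumeRatio g t k 0, mul_pos hκ (volumeRatio_pos ht k 0), fun z => ?_⟩
    have hc1 : Continuous fun z => (einsteinMatrix F z).det :=
      (continuous_einsteinMatrix F).matrix_det
    have hc2 : Continuous fun z =>
        ((κ * volumeRatio g t k 0 * evalAbsSq F z ^ (2 * n - 1) : ℝ) : ℂ) :=
      Complex.continuous_ofReal.comp
        (continuous_const.mul ((contDiff_evalAbsSq F (k := 0)).continuous.pow _))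
    -- The identity is known on the torus; both sides are continuous, so it extends to the
    -- coordinate hyperplanes.
    exact congrFun (Continuous.ext_on dense_torus hc1 hc2 fun z hz => by
      rw [hdet z hz k, hconst]) z
  · rintro ⟨c, -, hc⟩
    -- Cancelling `F^(2n-1) > 0` from `det A = κ V F^(2n-1) = c F^(2n-1)` leaves `V = c / κ` on the
    -- torus, hence on every chart by density.
    refine isEinstein_of_volumeRatio_eq ht (c := c / κ) fun l w => ?_
    refine congrFun (Continuous.ext_on dense_torus (contDiff_volumeRatio g t l).continuous
      (continuous_const (y := c / κ)) fun x hx => ?_) w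
    obtain ⟨z, hz, rfl⟩ := S.exists_chartPoint_eq l hx
    have h1 := (hdet z hz l).symm.trans (hc z)
    have h2 := mul_right_cancel₀ (pow_ne_zero _ (hpos z).ne') (Complex.ofReal_injective h1)
    rw [eq_div_iff hκ.ne', mul_comm]
    exact h2
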